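/- Let $\mathcal C$ be a model category (with all small limits and colimits), and let $G:\mathcal C\to\mathcal C$ be a left Quillen endofunctor with right adjoint $U$. A *spectrum* $X$ is a sequence of objects $X_0,X_1,\dots$ of $\mathcal C$ with structure maps $GX_n\to X_{n+1}$; a map of spectra $f$ is a sequence of maps $f_n$ compatible with the structure maps. It is a *level equivalence* (*level fibration*, *level trivial fibration*) if every $f_n$ is a weak equivalence (fibration, trivial fibration) in $\mathcal C$; the *projective model structure* has the level equivalences as weak equivalences, the level fibrations as fibrations, and as cofibrations the maps with the left lifting property against level trivial fibrations. A *$U$-spectrum* is a spectrum $X$ with every $X_n$ fibrant and every adjoint structure map $X_n\to UX_{n+1}$ a weak equivalence. A map of spectra $f:A\to B$ is a *stable equivalence* if, for every $U$-spectrum $W$, the induced map $\operatorname{map}(B,W)\to\operatorname{map}(A,W)$ of homotopy function complexes, formed with respect to the projective model structure (maps from a cofibrant approximation into a simplicial resolution), is a weak equivalence of simplicial sets. Call an object $A$ of $\mathcal C$ *finitely presented* if $\mathcal C(A,-)$ preserves colimits of sequences $X_0\to X_1\to\cdots$. Suppose that $\mathcal C$ is *almost finitely generated*: it is cofibrantly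 generated, with generating cofibrations whose domains and codomains are finitely presented, and there is a set $J'$ of trivial cofibrations with finitely presented domains and codomains such that a map with fibrant codomain is a fibration if and only if it has the right lifting property with respect to $J'$. Suppose also that sequential colimits in $\mathcal C$ preserve finite products and that $U$ preserves sequential colimits. Let $R=sU$, where $(UX)_n=UX_n$ has structure maps $GUX_n\to X_n\to UGX_n\to UX_{n+1}$ (counit, unit, and $U$ of the structure map of $X$) and $(sX)_n=X_{n+1}$; let $\iota_X:X\to RX$ be the natural map given by the adjoint structure maps $X_n\to UX_{n+1}$; and let $$R^\infty X=\operatorname{colim}\bigl(X\xrightarrow{\iota_X}RX\xrightarrow{R\iota_X}R^2X\xrightarrow{R^2\iota_X}\cdots\bigr),$$ with its canonical map $j_X:X\to R^\infty X$. Let $L'$ be a fibrant replacement functor in the projective model structure, that is, a functor with a natural level equivalence $A\to L'A$ such that every $L'A$ is level fibrant. Then for every spectrum $A$ the composite $A\to L'A\xrightarrow{j_{L'A}}R^\infty L'A$ is a stable equivalence, and $R^\infty L'A$ is a $U$-spectrum. Moreover, a map of spectra $f:A\to B$ is a stable equivalence if and only if $R^\infty L'f$ is a level equivalence. -/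

import Mathlib

open CategoryTheory CategoryTheory.Limits HomotopicalAlgebra Opposite Simplicial

universe w w' v u

/-! ### Weak equivalences of simplicial sets -/

namespace SSet

/-- A map `f : X ⟶ Y` of simplicial sets is a weak (homotopy) equivalence if, for every Kan
complex `K`, precomposition with `f` is a bijection from the homotopy classes of maps `Y ⟶ K` to
the homotopy classes of maps `X ⟶ K`. (Since `K` is a Kan complex, simplicial homotopy is an
equivalence relation on maps into `K`.) -/
def IsWeakEquivalence {X Y : SSet.{w}} (f : X ⟶ Y) : Prop :=
  ∀ (K : SSet.{w}), SSet.KanComplex K →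
    (∀ g : X ⟶ K, ∃ h : Y ⟶ K, Nonempty (SSet.Homotopy (f ≫ h) g)) ∧
    (∀ h h' : Y ⟶ K, Nonempty (SSet.Homotopy (f ≫ h) (f ≫ h')) → Nonempty (SSet.Homotopy h h'))

end SSet

namespace Hovey

/-! ### Smallness, cofibrant generation, almost finite generation -/

section Generation

variable {C : Type u} [Category.{v} C]

/-- `A` is small relative to the class of maps `D`: there is a cardinal `κ` such that for every
`κ`-filtered ordinal `J` (a limit ordinal in which every subset of cardinality at most `κ` is
bounded) and every `J`-sequence `F` whose successive maps belong to `D`, the functor `C(A, -)`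
preserves the colimit of `F`. -/
def IsSmallRelativeTo (A : C) (D : MorphismProperty C) : Prop :=
  ∃ κ : Cardinal.{v}, ∀ (J : Type v) [LinearOrder J] [OrderBot J] [SuccOrder J]
    [WellFoundedLT J] [NoMaxOrder J],
    (∀ S : Set J, Cardinal.mk S ≤ κ → BddAbove S) →
    ∀ (F : J ⥤ C) [F.IsWellOrderContinuous],
      (∀ j : J, D (F.map (homOfLE (Order.le_succ j)))) →
      PreservesColimit F (coyoneda.obj (op A))

/-- Relative `I`-cell complexes: the transfinite compositions of pushouts of maps of `I`. -/
def relativeCells (I : MorphismProperty C) : MorphismProperty C :=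
  MorphismProperty.transfiniteCompositions.{v} I.pushouts

/-- An object `A` is finitely presented if `C(A, -)` preserves colimits of sequences
`X₀ ⟶ X₁ ⟶ X₂ ⟶ ⋯`. -/
def IsFinitelyPresented (A : C) : Prop :=
  PreservesColimitsOfShape ℕ (coyoneda.obj (op A))

/-- The domains and codomains of all the maps of `I` are finitely presented. -/
def HasFinitelyPresentedEnds (I : MorphismProperty C) : Prop :=
  ∀ ⦃A B : C⦄ (i : A ⟶ B), I i → IsFinitelyPresented A ∧ IsFinitelyPresented B

variable [ModelCategory C]

/-- The set `I` is a set of generating cofibrations and the set `J` is a set of generating trivial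
cofibrations of the model category `C`. -/
structure IsCofibrantlyGeneratedBy (I J : MorphismProperty C) : Prop where
  isSmall_I : MorphismProperty.IsSmall.{v} I
  isSmall_J : MorphismProperty.IsSmall.{v} J
  small_domains_I : ∀ ⦃A B : C⦄ (i : A ⟶ B), I i → IsSmallRelativeTo A (relativeCells I)
  small_domains_J : ∀ ⦃A B : C⦄ (j : A ⟶ B), J j → IsSmallRelativeTo A (relativeCells J)
  fibrations_eq : fibrations C = J.rlp
  trivialFibrations_eq : trivialFibrations C = I.rlp

variable (C) in
/-- The model category `C` is almost finitely generated: it is cofibrantly generated, the domains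
and codomains of the generating cofibrations are finitely presented, and there is a set `J'` of
trivial cofibrations with finitely presented domains and codomains such that a map whose codomain
is fibrant is a fibration if and only if it has the right lifting property with respect to `J'`. -/
def IsAlmostFinitelyGenerated : Prop :=
  ∃ I J : MorphismProperty C, IsCofibrantlyGeneratedBy I J ∧ HasFinitelyPresentedEnds I ∧
    ∃ J' : MorphismProperty C, MorphismProperty.IsSmall.{v} J' ∧ J' ≤ trivialCofibrations C ∧
      HasFinitelyPresentedEnds J' ∧
      ∀ ⦃X Y : C⦄ (f : X ⟶ Y), IsFibrant Y → (fibrations C f ↔ J'.rlp f)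

/-- A left Quillen endofunctor: a left adjoint that preserves cofibrations and trivial
cofibrations. -/
structure IsLeftQuillen (G : C ⥤ C) : Prop where
  isLeftAdjoint : G.IsLeftAdjoint
  map_cofibration : ∀ ⦃A B : C⦄ (i : A ⟶ B), cofibrations C i → cofibrations C (G.map i)
  map_trivialCofibration : ∀ ⦃A B : C⦄ (i : A ⟶ B),
    trivialCofibrations C i → trivialCofibrations C (G.map i)

end Generation

/-! ### Homotopy function complexes -/

section FunctionComplex

variable {D : Type u} [Category.{v} D]

/-- The diagram indexed by the simplices of `∂Δ[n]` whose limit is the `n`-th matching object. -/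
abbrev matchingDiagram (X : SimplicialObject D) (n : ℕ) :
    (SSet.boundary.{0} n : SSet.{0}).Elements ⥤ D :=
  CategoryOfElements.π (SSet.boundary.{0} n : SSet.{0}) ⋙ X

/-- The cone over `matchingDiagram X n` with point `Xₙ`: a simplex of `∂Δ[n]` is a monotone map
`⦋m⦌ ⟶ ⦋n⦌`, and the projection attached to it is the corresponding map `Xₙ ⟶ Xₘ`. -/
def matchingCone (X : SimplicialObject D) (n : ℕ) : Cone (matchingDiagram X n) where
  pt := X.obj (op ⦋n⦌)
  π :=
    { app := fun p => X.map (SSet.stdSimplex.objEquiv p.2.1).op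
      naturality := by
        intro p q f
        refine (Category.id_comp _).trans ?_
        refine Eq.trans ?_ (X.map_comp (SSet.stdSimplex.objEquiv p.2.1).op f.1)
        exact congrArg (fun y : (SSet.boundary.{0} n : SSet.{0}).obj q.1 =>
          X.map (SSet.stdSimplex.objEquiv y.1).op) f.2.symm }

variable [HasLimits D]

/-- The `n`-th matching object `Mₙ X`. -/
noncomputable def matchingObject (X : SimplicialObject D) (n : ℕ) : D :=
  limit (matchingDiagram X n)

/-- The canonical map `Xₙ ⟶ Mₙ X`. -/
noncomputable def matchingMap (X : SimplicialObject D) (n : ℕ) :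
    X.obj (op ⦋n⦌) ⟶ matchingObject X n :=
  limit.lift (matchingDiagram X n) (matchingCone X n)

variable [CategoryWithFibrations D] [CategoryWithWeakEquivalences D]

/-- A simplicial object is Reedy fibrant if all its matching maps are fibrations. -/
def IsReedyFibrant (X : SimplicialObject D) : Prop :=
  ∀ n : ℕ, fibrations D (matchingMap X n)

/-- A simplicial resolution of `W`: a Reedy fibrant simplicial object together with a levelwise
weak equivalence from the constant simplicial object on `W`. -/
structure SimplicialResolution (W : D) where
  obj : SimplicialObject D
  ι : (SimplicialObject.const D).obj W ⟶ obj
  weakEquivalence_ι : ∀ n : SimplexCategoryᵒᵖ, weakEquivalences D (ι.app n)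
  isReedyFibrant : IsReedyFibrant obj

variable [CategoryWithCofibrations D] [HasInitial D]

/-- A cofibrant approximation of a map `f : A ⟶ B`: a map `A' ⟶ B'` between cofibrant objects with
trivial fibrations `A' ⟶ A` and `B' ⟶ B` making the square commute. -/
structure CofibrantApproximation {A B : D} (f : A ⟶ B) where
  src : D
  tgt : D
  map : src ⟶ tgt
  pSrc : src ⟶ A
  pTgt : tgt ⟶ B
  cofibrant_src : IsCofibrant src
  cofibrant_tgt : IsCofibrant tgt
  trivialFibration_pSrc : trivialFibrations D pSrc
  trivialFibration_pTgt : trivialFibrations D pTgt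
  comm : map ≫ pTgt = pSrc ≫ f

/-- The map of simplicial sets `D(B', W_•) ⟶ D(A', W_•)` given by precomposition with
`f : A' ⟶ B'`. -/
def precompSSet {A B : D} (f : A ⟶ B) (W : SimplicialObject D) :
    ((W ⋙ coyoneda.obj (op B) : SimplexCategoryᵒᵖ ⥤ Type v) : SSet.{v}) ⟶
      ((W ⋙ coyoneda.obj (op A) : SimplexCategoryᵒᵖ ⥤ Type v) : SSet.{v}) :=
  Functor.whiskerLeft W (coyoneda.map f.op)

/-- The map `map(B, W) ⟶ map(A, W)` of homotopy function complexes induced by `f : A ⟶ B` is a weak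
equivalence. The homotopy function complex `map(A, W)` is modelled by `D(A', W_•)`, for a cofibrant
approximation `A'` of `A` and a simplicial resolution `W_•` of `W`; in a model category such models
exist and the condition does not depend on their choice. -/
def IsMapEquivalence {A B : D} (f : A ⟶ B) (W : D) : Prop :=
  ∀ (f' : CofibrantApproximation f) (W' : SimplicialResolution W),
    SSet.IsWeakEquivalence (precompSSet f'.map W'.obj)

end FunctionComplex

/-! ### Spectra -/

variable {C : Type u} [Category.{v} C]

/-- A spectrum: objects `X₀, X₁, …` with structure maps `G Xₙ ⟶ Xₙ₊₁`. -/
structure Spectrum (G : C ⥤ C) where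
  obj : ℕ → C
  str : ∀ n, G.obj (obj n) ⟶ obj (n + 1)

namespace Spectrum

variable {G U : C ⥤ C}

/-- Maps of spectra. -/
@[ext]
structure Hom (X Y : Spectrum G) where
  app : ∀ n, X.obj n ⟶ Y.obj n
  comm : ∀ n, G.map (app n) ≫ Y.str n = X.str n ≫ app (n + 1)

instance : Category (Spectrum G) where
  Hom := Hom
  id X := { app := fun n => 𝟙 _, comm := fun n => by simp }
  comp f g :=
    { app := fun n => f.app n ≫ g.app n
      comm := fun n => by
        rw [G.map_comp, Category.assoc, g.comm, ← Category.assoc, f.comm, Category.assoc] }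

@[ext]
theorem hom_ext {X Y : Spectrum G} {f g : X ⟶ Y} (h : ∀ n, f.app n = g.app n) : f = g :=
  Hom.ext (funext h)

@[simp]
theorem id_app (X : Spectrum G) (n : ℕ) : Hom.app (𝟙 X) n = 𝟙 (X.obj n) := rfl

@[simp]
theorem comp_app {X Y Z : Spectrum G} (f : X ⟶ Y) (g : Y ⟶ Z) (n : ℕ) :
    Hom.app (f ≫ g) n = f.app n ≫ g.app n := rfl

/-- The evaluation functor `Evₙ`. -/
@[simps]
def ev (G : C ⥤ C) (n : ℕ) : Spectrum G ⥤ C where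
  obj X := X.obj n
  map f := f.app n

/-! Limits and colimits of spectra are computed levelwise. -/

section LimitsColimits

variable {J : Type w} [Category.{w'} J]

/-- The structure map `G (lim Xₙ) ⟶ lim G Xₙ ⟶ lim Xₙ₊₁` of the limit of a diagram of spectra. -/
noncomputable def limitStr [HasLimitsOfShape J C] (F : J ⥤ Spectrum G) (n : ℕ) :
    G.obj (limit (F ⋙ ev G n)) ⟶ limit (F ⋙ ev G (n + 1)) :=
  limit.lift (F ⋙ ev G (n + 1))
    { pt := G.obj (limit (F ⋙ ev G n))
      π :=
        { app := fun j => G.map (limit.π (F ⋙ ev G n) j) ≫ (F.obj j).str n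
          naturality := fun j j' f =>
            (Category.id_comp _).trans <| by
              refine Eq.trans ?_ (Category.assoc _ _ _).symm
              refine Eq.trans ?_ (congrArg (G.map (limit.π (F ⋙ ev G n) j) ≫ ·) ((F.map f).comm n))
              refine Eq.trans ?_ (Category.assoc _ _ _)
              refine congrArg (· ≫ (F.obj j').str n) ?_
              exact (congrArg G.map (limit.w (F ⋙ ev G n) f)).symm.trans (G.map_comp _ _) } }

theorem limitStr_π [HasLimitsOfShape J C] (F : J ⥤ Spectrum G) (n : ℕ) (j : J) :
    limitStr F n ≫ limit.π (F ⋙ ev G (n + 1)) j =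
      G.map (limit.π (F ⋙ ev G n) j) ≫ (F.obj j).str n :=
  limit.lift_π _ j

/-- The levelwise limit of a diagram of spectra. -/
noncomputable def limitCone [HasLimitsOfShape J C] (F : J ⥤ Spectrum G) : Cone F where
  pt :=
    { obj := fun n => limit (F ⋙ ev G n)
      str := fun n => limitStr F n }
  π :=
    { app := fun j =>
        { app := fun n => limit.π (F ⋙ ev G n) j
          comm := fun n => (limitStr_π F n j).symm }
      naturality := fun _ _ f => hom_ext fun n =>
        (Category.id_comp _).trans (limit.w (F ⋙ ev G n) f).symm }

/-- The levelwise limit is a limit. -/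
noncomputable def isLimitLimitCone [HasLimitsOfShape J C] (F : J ⥤ Spectrum G) :
    IsLimit (limitCone F) where
  lift s :=
    { app := fun n => limit.lift (F ⋙ ev G n) ((ev G n).mapCone s)
      comm := fun n => by
        apply limit.hom_ext (F := F ⋙ ev G (n + 1))
        intro j
        refine (Category.assoc _ _ _).trans ?_
        refine (congrArg (_ ≫ ·) (limitStr_π F n j)).trans ?_
        refine (Category.assoc _ _ _).symm.trans ?_
        refine (congrArg (· ≫ _) (G.map_comp _ _).symm).trans ?_
        refine (congrArg (fun t => G.map t ≫ (F.obj j).str n)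
          (limit.lift_π ((ev G n).mapCone s) j)).trans ?_
        refine ((s.π.app j).comm n).trans ?_
        refine Eq.trans ?_ (Category.assoc _ _ _).symm
        exact congrArg (s.pt.str n ≫ ·) (limit.lift_π ((ev G (n + 1)).mapCone s) j).symm }
  fac s j := hom_ext fun n => limit.lift_π ((ev G n).mapCone s) j
  uniq s m hm := hom_ext fun n => limit.hom_ext (F := F ⋙ ev G n) fun j =>
    (congrArg (fun t => Hom.app t n) (hm j)).trans (limit.lift_π ((ev G n).mapCone s) j).symm

instance [HasLimitsOfShape J C] : HasLimitsOfShape J (Spectrum G) where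
  has_limit F := ⟨⟨⟨limitCone F, isLimitLimitCone F⟩⟩⟩

instance [HasLimits C] : HasLimits (Spectrum G) where
  has_limits_of_shape _ := inferInstance

/-- The structure map `G (colim Xₙ) ≅ colim G Xₙ ⟶ colim Xₙ₊₁` of the colimit of a diagram of
spectra; this uses that `G` preserves colimits. -/
noncomputable def colimitStr [HasColimitsOfShape J C] [PreservesColimitsOfShape J G]
    (F : J ⥤ Spectrum G) (n : ℕ) :
    G.obj (colimit (F ⋙ ev G n)) ⟶ colimit (F ⋙ ev G (n + 1)) :=
  (isColimitOfPreserves G (colimit.isColimit (F ⋙ ev G n))).desc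
    { pt := colimit (F ⋙ ev G (n + 1))
      ι :=
        { app := fun j => (F.obj j).str n ≫ colimit.ι (F ⋙ ev G (n + 1)) j
          naturality := fun j j' f => by
            refine Eq.trans ?_ (Category.comp_id _).symm
            refine (Category.assoc _ _ _).symm.trans ?_
            refine (congrArg (· ≫ colimit.ι (F ⋙ ev G (n + 1)) j') ((F.map f).comm n)).trans ?_
            refine (Category.assoc _ _ _).trans ?_
            exact congrArg ((F.obj j).str n ≫ ·) (colimit.w (F ⋙ ev G (n + 1)) f) } }

theorem ι_colimitStr [HasColimitsOfShape J C] [PreservesColimitsOfShape J G]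
    (F : J ⥤ Spectrum G) (n : ℕ) (j : J) :
    G.map (colimit.ι (F ⋙ ev G n) j) ≫ colimitStr F n =
      (F.obj j).str n ≫ colimit.ι (F ⋙ ev G (n + 1)) j :=
  (isColimitOfPreserves G (colimit.isColimit (F ⋙ ev G n))).fac _ j

/-- The levelwise colimit of a diagram of spectra. -/
noncomputable def colimitCocone [HasColimitsOfShape J C] [PreservesColimitsOfShape J G]
    (F : J ⥤ Spectrum G) : Cocone F where
  pt :=
    { obj := fun n => colimit (F ⋙ ev G n)
      str := fun n => colimitStr F n }
  ι :=
    { app := fun j =>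
        { app := fun n => colimit.ι (F ⋙ ev G n) j
          comm := fun n => ι_colimitStr F n j }
      naturality := fun _ _ f => hom_ext fun n =>
        (colimit.w (F ⋙ ev G n) f).trans (Category.comp_id _).symm }

/-- The levelwise colimit is a colimit. -/
noncomputable def isColimitColimitCocone [HasColimitsOfShape J C] [PreservesColimitsOfShape J G]
    (F : J ⥤ Spectrum G) : IsColimit (colimitCocone F) where
  desc s :=
    { app := fun n => colimit.desc (F ⋙ ev G n) ((ev G n).mapCocone s)
      comm := fun n => by
        apply (isColimitOfPreserves G (colimit.isColimit (F ⋙ ev G n))).hom_ext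
        intro j
        refine (Category.assoc _ _ _).symm.trans ?_
        refine (congrArg (· ≫ s.pt.str n) (G.map_comp _ _).symm).trans ?_
        refine (congrArg (fun t => G.map t ≫ s.pt.str n)
          (colimit.ι_desc ((ev G n).mapCocone s) j)).trans ?_
        refine ((s.ι.app j).comm n).trans ?_
        refine Eq.trans ?_ (Category.assoc _ _ _)
        refine Eq.trans ?_ (congrArg (· ≫ _) (ι_colimitStr F n j).symm)
        refine Eq.trans ?_ (Category.assoc _ _ _).symm
        exact congrArg ((F.obj j).str n ≫ ·)
          (colimit.ι_desc ((ev G (n + 1)).mapCocone s) j).symm }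
  fac s j := hom_ext fun n => colimit.ι_desc ((ev G n).mapCocone s) j
  uniq s m hm := hom_ext fun n => colimit.hom_ext (F := F ⋙ ev G n) fun j =>
    (congrArg (fun t => Hom.app t n) (hm j)).trans (colimit.ι_desc ((ev G n).mapCocone s) j).symm

instance [HasColimitsOfShape J C] [PreservesColimitsOfShape J G] :
    HasColimitsOfShape J (Spectrum G) where
  has_colimit F := ⟨⟨⟨colimitCocone F, isColimitColimitCocone F⟩⟩⟩

end LimitsColimits

/-! The classes of maps of the projective model structure. -/

section Projective

variable [ModelCategory C]

/-- Level equivalences. -/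
def levelEquivalences (G : C ⥤ C) : MorphismProperty (Spectrum G) :=
  fun _ _ f => ∀ n, weakEquivalences C (f.app n)

/-- Level fibrations. -/
def levelFibrations (G : C ⥤ C) : MorphismProperty (Spectrum G) :=
  fun _ _ f => ∀ n, fibrations C (f.app n)

/-- Level trivial fibrations. -/
def levelTrivialFibrations (G : C ⥤ C) : MorphismProperty (Spectrum G) :=
  fun _ _ f => ∀ n, trivialFibrations C (f.app n)

/-- Projective cofibrations. -/
def projectiveCofibrations (G : C ⥤ C) : MorphismProperty (Spectrum G) :=
  (levelTrivialFibrations G).llp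

instance : CategoryWithWeakEquivalences (Spectrum G) := ⟨levelEquivalences G⟩

instance : CategoryWithFibrations (Spectrum G) := ⟨levelFibrations G⟩

instance : CategoryWithCofibrations (Spectrum G) := ⟨projectiveCofibrations G⟩

/-- Level fibrant spectra. -/
def IsLevelFibrant (X : Spectrum G) : Prop := ∀ n, IsFibrant (X.obj n)

/-- `U`-spectra: level fibrant spectra such that all the adjoint structure maps `Xₙ ⟶ U Xₙ₊₁` are
weak equivalences. -/
def IsUSpectrum (adj : G ⊣ U) (X : Spectrum G) : Prop :=
  X.IsLevelFibrant ∧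
    ∀ n, weakEquivalences C (adj.homEquiv (X.obj n) (X.obj (n + 1)) (X.str n))

/-- Stable equivalences: the maps `f` such that `map(f, W)`, formed with respect to the projective
model structure, is a weak equivalence of simplicial sets for every `U`-spectrum `W`. -/
def IsStableEquivalence [HasLimits C] [HasColimits C] (adj : G ⊣ U) {A B : Spectrum G}
    (f : A ⟶ B) : Prop :=
  haveI : PreservesColimitsOfSize.{0, 0} G := adj.leftAdjoint_preservesColimits
  ∀ W : Spectrum G, IsUSpectrum adj W → IsMapEquivalence f W

end Projective

/-! The functors `s`, `U`, `R = sU` and `R^∞`. -/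

/-- The shift functor `s`, with `(sX)ₙ = Xₙ₊₁`. -/
@[simps]
def shift (G : C ⥤ C) : Spectrum G ⥤ Spectrum G where
  obj X := { obj := fun n => X.obj (n + 1), str := fun n => X.str (n + 1) }
  map f := { app := fun n => f.app (n + 1), comm := fun n => f.comm (n + 1) }

/-- The prolongation of a functor `F` along a natural transformation `τ : GF ⟶ FG`. -/
@[simps]
def prolong (F : C ⥤ C) (τ : F ⋙ G ⟶ G ⋙ F) : Spectrum G ⥤ Spectrum G where
  obj X :=
    { obj := fun n => F.obj (X.obj n)
      str := fun n => τ.app (X.obj n) ≫ F.map (X.str n) }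
  map {X Y} f :=
    { app := fun n => F.map (f.app n)
      comm := fun n => by
        have h := τ.naturality (f.app n)
        dsimp at h ⊢
        rw [← Category.assoc, h, Category.assoc, ← F.map_comp, f.comm, F.map_comp,
          Category.assoc] }
  map_id X := by ext n; simp
  map_comp f g := by ext n; simp

/-- The prolongation of `U`, along the composite `GU ⟶ 1 ⟶ UG` of the counit and the unit. -/
def prolongRight (adj : G ⊣ U) : Spectrum G ⥤ Spectrum G :=
  prolong U (adj.counit ≫ adj.unit)

/-- The functor `R = sU`. -/
def R (adj : G ⊣ U) : Spectrum G ⥤ Spectrum G := prolongRight adj ⋙ shift G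

/-- The natural map `ι : X ⟶ RX`, given by the adjoints `Xₙ ⟶ U Xₙ₊₁` of the structure maps. -/
def iota (adj : G ⊣ U) : 𝟭 (Spectrum G) ⟶ R adj where
  app X :=
    { app := fun n => adj.homEquiv (X.obj n) (X.obj (n + 1)) (X.str n)
      comm := fun n => by
        have h : G.map (adj.homEquiv (X.obj n) (X.obj (n + 1)) (X.str n)) ≫
            adj.counit.app (X.obj (n + 1)) = X.str n := by
          simp [Adjunction.homEquiv_unit]
        have h' : adj.homEquiv (X.obj (n + 1)) (X.obj (n + 2)) (X.str (n + 1)) =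
            adj.unit.app (X.obj (n + 1)) ≫ U.map (X.str (n + 1)) := adj.homEquiv_unit _ _ _
        change G.map (adj.homEquiv (X.obj n) (X.obj (n + 1)) (X.str n)) ≫
            (adj.counit.app (X.obj (n + 1)) ≫ adj.unit.app (X.obj (n + 1))) ≫
              U.map (X.str (n + 1)) =
          X.str n ≫ adj.homEquiv (X.obj (n + 1)) (X.obj (n + 2)) (X.str (n + 1))
        rw [h', Category.assoc, ← Category.assoc, h] }
  naturality X Y f := by
    ext n
    have h := f.comm n
    change f.app n ≫ adj.homEquiv _ _ (Y.str n) =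
      adj.homEquiv _ _ (X.str n) ≫ U.map (f.app (n + 1))
    rw [← Adjunction.homEquiv_naturality_left, h, Adjunction.homEquiv_naturality_right]

/-- The iterates `Rⁿ`, with `Rⁿ⁺¹ X = Rⁿ (RX)`. -/
def Rpow (adj : G ⊣ U) (n : ℕ) : Spectrum G ⥤ Spectrum G :=
  match n with
  | 0 => 𝟭 _
  | n + 1 => R adj ⋙ Rpow adj n

/-- The natural map `Rⁿ ι_X : Rⁿ X ⟶ Rⁿ⁺¹ X`. -/
def RpowStep (adj : G ⊣ U) (n : ℕ) : Rpow adj n ⟶ Rpow adj (n + 1) :=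
  (Rpow adj n).leftUnitor.inv ≫ Functor.whiskerRight (iota adj) (Rpow adj n)

/-- The functor that sends `X` to the sequence `X ⟶ RX ⟶ R²X ⟶ ⋯` with maps `Rⁿ ι_X`. -/
def tower (adj : G ⊣ U) : Spectrum G ⥤ (ℕ ⥤ Spectrum G) :=
  (Functor.ofSequence (RpowStep adj)).flip

section Rinfty

variable [HasColimits C]

theorem hasSequentialColimits (adj : G ⊣ U) : HasColimitsOfShape ℕ (Spectrum G) :=
  haveI : PreservesColimitsOfSize.{0, 0} G := adj.leftAdjoint_preservesColimits
  inferInstance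

/-- The functor `R^∞ = colim Rⁿ`. -/
noncomputable def Rinfty (adj : G ⊣ U) : Spectrum G ⥤ Spectrum G :=
  haveI := hasSequentialColimits adj
  tower adj ⋙ colim

/-- The natural map `j_X : X ⟶ R^∞ X`. -/
noncomputable def jinfty (adj : G ⊣ U) : 𝟭 (Spectrum G) ⟶ Rinfty adj :=
  haveI := hasSequentialColimits adj
  { app := fun X => colimit.ι ((tower adj).obj X) 0
    naturality := fun _ _ f => (ι_colimMap ((tower adj).map f) 0).symm }

end Rinfty

end Spectrum

end Hovey

/-! The functor Q = R^∞L' is a homotopical localization of the projective model structure whose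
local objects are the U-spectra. The description of stable equivalences follows formally from this.
`IsLocalization` records the properties of Q that are used, `IsLocalization.isMapEquivalence_iff` is
the formal consequence, and `isStableEquivalence_iff` checks the properties for spectra.

Why Q localizes. A triangle identity gives ι_{RX} = Rι_X (`iota_R_obj`). Since U preserves
sequential colimits, R(R^∞X) is the colimit of the same tower without its first term, so R^∞X →
R(R^∞X) is an isomorphism (`isIso_iotaApp_Rinfty`). Hence R^∞ of a level fibrant spectrum is a
U-spectrum, and R^∞ inverts j_X (`isIso_Rinfty_map_rinftyUnit`). Almost finite generation makes
sequential colimits preserve fibrant objects and trivial fibrations, hence, by Ken Brown's lemma,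
weak equivalences between levelwise fibrant sequences (`weakEquivalence_of_isColimit`). So Q
preserves level equivalences, and its unit is a level equivalence on U-spectra. The cogluing lemma
shows that U-spectra are stable under pullbacks of level fibrations.

Why maps inverted by Q induce equivalences of function complexes. A cofibration inverted by Q lifts
against every fibration between local objects (`hasLiftingProperty_of_map_weakEquivalence`).
Matching objects of a resolution of a local object are iterated pullbacks of local objects along
fibrations, hence local. So such a cofibration induces a trivial Kan fibration, and Brown
factorizations give the general case.

Why the converse holds. Only maps into discrete simplicial sets are needed. In a resolution of QA,
the maps out of A that Q inverts form a union of components containing the class of the unit. If f :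
A → B is a map equivalence, this union must meet the image of the maps out of B, which yields r with
Q(f ≫ r) an equivalence. Repeating this for r and applying two-out-of-six shows that Qf is an
equivalence. -/

namespace HomotopicalAlgebra

/-! ### Two-out-of-six, lifting against local fibrations, and cogluing in a model category -/

section ModelCategoryLemmas

variable {C : Type u} [Category.{v} C] [ModelCategory C]

/-- If `f ≫ g` and `g ≫ h` are weak equivalences, then so is `h`. -/
lemma weakEquivalence_of_two_of_six {A B X Y : C} (f : A ⟶ B) (g : B ⟶ X) (h : X ⟶ Y)
    [hfg : WeakEquivalence (f ≫ g)] [hgh : WeakEquivalence (g ≫ h)] : WeakEquivalence h := by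
  -- Up to the trivial fibrations `F.p` and `K.p`, the map `f` becomes a cofibration and `f ≫ g` a
  -- trivial cofibration. Cobase change of `K.i` along `F.i` then gives a weak equivalence, and `K.p
  -- ≫ h` is a retract of a map that two-out-of-three handles.
  have F := MorphismProperty.factorizationData (cofibrations C) (trivialFibrations C) f
  have K := MorphismProperty.factorizationData (trivialCofibrations C) (fibrations C) (f ≫ g)
  have : WeakEquivalence K.p := weakEquivalence_of_precomp_of_fac K.fac
  have sq : CommSq K.i F.i K.p (F.p ≫ g) := ⟨by simp⟩
  let g' : F.Z ⟶ K.Z := sq.lift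
  have hg' : g' ≫ K.p = F.p ≫ g := sq.fac_right
  have hg'' : F.i ≫ g' = K.i := sq.fac_left
  let fold : pushout K.i F.i ⟶ K.Z := pushout.desc (𝟙 _) g' (by simp [hg''])
  have h1 : WeakEquivalence (pushout.inr K.i F.i ≫ fold ≫ K.p ≫ h) := by
    have : pushout.inr K.i F.i ≫ fold ≫ K.p ≫ h = F.p ≫ g ≫ h := by
      simp only [fold, pushout.inr_desc_assoc, reassoc_of% hg']
    rw [this]; infer_instance
  have h2 : WeakEquivalence (fold ≫ K.p ≫ h) :=
    weakEquivalence_of_precomp (pushout.inr K.i F.i) _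
  have r : RetractArrow (K.p ≫ h) (fold ≫ K.p ≫ h) :=
    { i := Arrow.homMk (pushout.inl _ _) (𝟙 _) (by simp [fold, pushout.inl_desc_assoc])
      r := Arrow.homMk fold (𝟙 _) (by simp)
      retract := by ext <;> simp [fold, pushout.inl_desc] }
  have h3 : WeakEquivalence (K.p ≫ h) := by
    rw [weakEquivalence_iff] at h2 ⊢
    exact MorphismProperty.of_retract r h2
  exact weakEquivalence_of_precomp K.p h

/-- If `X` is weakly equivalent over `Y` to an object `T` that is fibrant over `Y`, then lifting
problems against the fibration `X ⟶ Y` can be solved in `T`. -/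
lemma exists_lift_of_weakEquivalence_over {A B X Y T : C} (f : A ⟶ B) [Cofibration f]
    (p : X ⟶ Y) [Fibration p] (ψ : X ⟶ T) [WeakEquivalence ψ] (t : T ⟶ Y) [Fibration t]
    (hψ : ψ ≫ t = p) (a : A ⟶ X) (β : B ⟶ T) (hβ : f ≫ β = a ≫ ψ) :
    ∃ l : B ⟶ X, f ≫ l = a ∧ l ≫ p = β ≫ t := by
  -- The lift is first found in `K.Z`, since `K.p` is a trivial fibration. It is then moved to `X`
  -- by a retraction of the trivial cofibration `K.i` over `Y`.
  have K := MorphismProperty.factorizationData (trivialCofibrations C) (fibrations C) ψ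
  have : WeakEquivalence K.p := weakEquivalence_of_precomp_of_fac K.fac
  have sq : CommSq (a ≫ K.i) f K.p β := ⟨by simp [hβ]⟩
  have sq' : CommSq (𝟙 X) K.i p (K.p ≫ t) := ⟨by simp [hψ]⟩
  exact ⟨sq.lift ≫ sq'.lift, by simp, by simp⟩

/-- Let `Q` be a functor with a natural map `η : X ⟶ Q X`. A cofibration that is sent by `Q` to a
weak equivalence has the left lifting property with respect to the fibrations between `η`-local
fibrant objects. -/
lemma hasLiftingProperty_of_map_weakEquivalence (Q : C ⥤ C) (η : 𝟭 C ⟶ Q)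
    {A B X Y : C} (f : A ⟶ B) [Cofibration f] [WeakEquivalence (Q.map f)]
    (p : X ⟶ Y) [Fibration p] [IsFibrant Y] [IsFibrant (Q.obj Y)]
    [WeakEquivalence (η.app X)] [WeakEquivalence (η.app Y)] : HasLiftingProperty f p where
  sq_hasLift {a b} sq := by
    have K := MorphismProperty.factorizationData (trivialCofibrations C) (fibrations C) (Q.map p)
    -- The image of the square under `Q` is solved up to homotopy: because `Q.map f` is an
    -- equivalence, factoring `u` produces a trivial fibration over `Q.obj B`, against which `f`
    -- lifts.
    let u : Q.obj A ⟶ pullback K.p (Q.map b) := pullback.lift (Q.map a ≫ K.i) (Q.map f) (by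
      rw [Category.assoc, K.fac, ← Q.map_comp, ← Q.map_comp, sq.w])
    have M := MorphismProperty.factorizationData (trivialCofibrations C) (fibrations C) u
    have : WeakEquivalence (M.p ≫ pullback.snd K.p (Q.map b)) :=
      weakEquivalence_of_precomp_of_fac (f := M.i) (fg := Q.map f) (by
        rw [M.fac_assoc]; exact pullback.lift_snd _ _ _)
    have hηf : f ≫ η.app B = η.app A ≫ Q.map f := η.naturality f
    have sq' : CommSq (η.app A ≫ M.i) f (M.p ≫ pullback.snd K.p (Q.map b)) (η.app B) :=
      ⟨by rw [Category.assoc, M.fac_assoc, hηf, pullback.lift_snd]⟩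
    let m : B ⟶ K.Z := sq'.lift ≫ M.p ≫ pullback.fst _ _
    have hηa : a ≫ η.app X = η.app A ≫ Q.map a := η.naturality a
    have hηb : b ≫ η.app Y = η.app B ≫ Q.map b := η.naturality b
    have hηp : p ≫ η.app Y = η.app X ≫ Q.map p := η.naturality p
    have hfm : f ≫ m = a ≫ η.app X ≫ K.i := by
      simp only [m]
      rw [sq'.fac_left_assoc, Category.assoc, M.fac_assoc, pullback.lift_fst, reassoc_of% hηa]
    have hmq : m ≫ K.p = b ≫ η.app Y := by
      have := sq'.fac_right
      simp only [m, Category.assoc]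
      rw [pullback.condition, reassoc_of% this, hηb]
    let ηY : Y ⟶ Q.obj Y := η.app Y
    have : WeakEquivalence ηY := ‹WeakEquivalence (η.app Y)›
    -- Right properness is not assumed, so `K.p` is pulled back along the trivial fibration `H.p`
    -- instead of along `ηY`. The retraction `H.r` brings the result back over `Y`.
    let H : FibrantBrownFactorization ηY := Classical.arbitrary _
    let ψ : X ⟶ pullback K.p H.p := pullback.lift (η.app X ≫ K.i) (p ≫ H.i) (by
      rw [Category.assoc, Category.assoc, K.fac, H.fac]; exact hηp.symm)
    have : WeakEquivalence ψ :=
      weakEquivalence_of_postcomp_of_fac (g := pullback.fst K.p H.p) (fg := η.app X ≫ K.i)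
        (pullback.lift_fst _ _ _)
    let t : pullback K.p H.p ⟶ Y := pullback.snd _ _ ≫ H.r
    let β : B ⟶ pullback K.p H.p := pullback.lift m (b ≫ H.i) (by
      rw [Category.assoc b, H.fac]; exact hmq)
    obtain ⟨l, hl, hl'⟩ := exists_lift_of_weakEquivalence_over f p ψ t 
      (by simp only [ψ, t, pullback.lift_snd_assoc, Category.assoc, H.i_r, Category.comp_id]) a β
      (by
        apply pullback.hom_ext
        · simpa only [β, ψ, Category.assoc, pullback.lift_fst] using hfm
        · simp only [β, ψ, Category.assoc, pullback.lift_snd, sq.w_assoc])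
    exact ⟨⟨⟨l, hl, by
      simpa only [β, t, pullback.lift_snd_assoc, Category.assoc, H.i_r, Category.comp_id] using hl'⟩⟩⟩

/-- **Ken Brown's lemma**: a functor that sends trivial fibrations between fibrant objects to weak
equivalences also sends weak equivalences between fibrant objects to weak equivalences. -/
lemma weakEquivalence_map_of_isFibrant {D : Type*} [Category* D] [CategoryWithWeakEquivalences D]
    [(weakEquivalences D).HasTwoOutOfThreeProperty] [(weakEquivalences D).ContainsIdentities]
    (F : C ⥤ D)
    (hF : ∀ ⦃X Y : C⦄ (p : X ⟶ Y) [IsFibrant X] [IsFibrant Y] [Fibration p] [WeakEquivalence p],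
      WeakEquivalence (F.map p))
    {X Y : C} (f : X ⟶ Y) [IsFibrant X] [IsFibrant Y] [WeakEquivalence f] :
    WeakEquivalence (F.map f) := by
  let H : FibrantBrownFactorization f := Classical.arbitrary _
  have : IsFibrant H.Z := isFibrant_of_fibration H.r
  have hr := hF H.r
  have hp := hF H.p
  have hi : WeakEquivalence (F.map H.i) :=
    weakEquivalence_of_postcomp_of_fac (g := F.map H.r) (fg := 𝟙 _)
      (by rw [← F.map_comp, H.i_r, F.map_id])
  have : F.map f = F.map H.i ≫ F.map H.p := by rw [← F.map_comp, H.fac]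
  rw [this]
  infer_instance

/-- A map of pullback squares is a weak equivalence if two of its components are, relatively, trivial
fibrations. -/
lemma weakEquivalence_of_isPullback_of_trivialFibration {P A B S P' A' B' S' : C}
    {fst : P ⟶ A} {snd : P ⟶ B} {f : A ⟶ S} {g : B ⟶ S} (sq : IsPullback fst snd f g)
    {fst' : P' ⟶ A'} {snd' : P' ⟶ B'} {f' : A' ⟶ S'} {g' : B' ⟶ S'}
    (sq' : IsPullback fst' snd' f' g') (φ : P ⟶ P') (a : A ⟶ A') (b : B ⟶ B') (s : S ⟶ S')
    (h₁ : φ ≫ fst' = fst ≫ a) (h₂ : φ ≫ snd' = snd ≫ b) (hf : f ≫ s = a ≫ f')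
    (hg : g ≫ s = b ≫ g') [Fibration a] [WeakEquivalence a]
    [Fibration (pullback.lift g b hg : B ⟶ pullback s g')]
    [WeakEquivalence (pullback.lift g b hg : B ⟶ pullback s g')] : WeakEquivalence φ := by
  suffices trivialFibrations C φ from (mem_trivialFibrations_iff φ).1 this |>.2
  rw [← cofibrations_rlp]
  intro U V i hi
  rw [← cofibration_iff] at hi
  refine ⟨fun {u w} q => ?_⟩
  -- The lift to `A` comes first. It fixes a map to `S`, which the relative trivial fibration then
  -- lifts to `B`.
  have q₁ : CommSq (u ≫ fst) i a (w ≫ fst') := ⟨by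
    rw [Category.assoc, ← h₁, q.w_assoc]⟩
  have e : (q₁.lift ≫ f) ≫ s = (w ≫ snd') ≫ g' := by
    rw [Category.assoc, hf, q₁.fac_right_assoc, Category.assoc, Category.assoc, sq'.w]
  have q₂ : CommSq (u ≫ snd) i (pullback.lift g b hg : B ⟶ pullback s g')
      (pullback.lift (q₁.lift ≫ f) (w ≫ snd') e) := ⟨by
    apply pullback.hom_ext
    · simp only [Category.assoc, pullback.lift_fst, q₁.fac_left_assoc, sq.w]
    · simp only [Category.assoc, pullback.lift_snd, ← h₂, q.w_assoc]⟩
  have r₁ : q₂.lift ≫ g = q₁.lift ≫ f := by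
    simpa only [Category.assoc, pullback.lift_fst] using q₂.fac_right =≫ pullback.fst _ _
  have r₂ : q₂.lift ≫ b = w ≫ snd' := by
    simpa only [Category.assoc, pullback.lift_snd] using q₂.fac_right =≫ pullback.snd _ _
  refine ⟨⟨⟨sq.lift q₁.lift q₂.lift r₁.symm, ?_, ?_⟩⟩⟩
  · apply sq.hom_ext
    · simp
    · simp
  · apply sq'.hom_ext
    · simp [h₁]
    · simp [h₂, r₂]

/-- A lifting problem for the conclusion prescribes only the `B₁` and `St` components. The missing
`B₂` component is a lift against the fibration `g₂`, after which `H` applies. -/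
lemma fibration_lift_of_joint_lifting {B₁ B₂ S₁ S₂ Bt St : C} (g₁ : B₁ ⟶ S₁) (g₂ : B₂ ⟶ S₂)
    [Fibration g₂] (q₁ : Bt ⟶ B₁) (q₂ : Bt ⟶ B₂) (gt : Bt ⟶ St) (σ₁ : St ⟶ S₁) (σ₂ : St ⟶ S₂)
    (w₁ : gt ≫ σ₁ = q₁ ≫ g₁) (w₂ : gt ≫ σ₂ = q₂ ≫ g₂)
    (H : ∀ ⦃U V : C⦄ (i : U ⟶ V) [Cofibration i] [WeakEquivalence i] (u : U ⟶ Bt) (v₁ : V ⟶ B₁)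
      (v₂ : V ⟶ B₂) (w : V ⟶ St), i ≫ v₁ = u ≫ q₁ → i ≫ v₂ = u ≫ q₂ → i ≫ w = u ≫ gt →
      w ≫ σ₁ = v₁ ≫ g₁ → w ≫ σ₂ = v₂ ≫ g₂ →
      ∃ l : V ⟶ Bt, i ≫ l = u ∧ l ≫ q₁ = v₁ ∧ l ≫ gt = w) :
    Fibration (pullback.lift gt q₁ w₁ : Bt ⟶ pullback σ₁ g₁) := by
  rw [fibration_iff, ← trivialCofibrations_rlp]
  intro U V i hi
  rw [mem_trivialCofibrations_iff] at hi
  obtain ⟨_, _⟩ := hi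
  refine ⟨fun {u w} q => ?_⟩
  have e₁ : u ≫ gt = i ≫ w ≫ pullback.fst _ _ := by
    simpa only [Category.assoc, pullback.lift_fst] using q.w =≫ pullback.fst _ _
  have e₂ : u ≫ q₁ = i ≫ w ≫ pullback.snd _ _ := by
    simpa only [Category.assoc, pullback.lift_snd] using q.w =≫ pullback.snd _ _
  have q' : CommSq (u ≫ q₂) i g₂ (w ≫ pullback.fst _ _ ≫ σ₂) := ⟨by
    rw [Category.assoc, ← w₂, reassoc_of% e₁]⟩
  obtain ⟨l, h₁, h₂, h₃⟩ := H i u (w ≫ pullback.snd _ _) q'.lift (w ≫ pullback.fst _ _)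
    e₂.symm (by simp) e₁.symm (by simp [pullback.condition]) (by simp)
  refine ⟨⟨⟨l, h₁, ?_⟩⟩⟩
  apply pullback.hom_ext
  · simp only [Category.assoc, pullback.lift_fst, h₃]
  · simp only [Category.assoc, pullback.lift_snd, h₂]

/-- The **cogluing lemma**: weak equivalences between fibrant objects induce a weak equivalence on
pullbacks along fibrations. -/
lemma weakEquivalence_of_isPullback {P A B S P' A' B' S' : C}
    {fst : P ⟶ A} {snd : P ⟶ B} {f : A ⟶ S} {g : B ⟶ S} (sq : IsPullback fst snd f g)
    {fst' : P' ⟶ A'} {snd' : P' ⟶ B'} {f' : A' ⟶ S'} {g' : B' ⟶ S'}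
    (sq' : IsPullback fst' snd' f' g') (φ : P ⟶ P') (a : A ⟶ A') (b : B ⟶ B') (s : S ⟶ S')
    (h₁ : φ ≫ fst' = fst ≫ a) (h₂ : φ ≫ snd' = snd ≫ b) (hf : f ≫ s = a ≫ f')
    (hg : g ≫ s = b ≫ g') [IsFibrant A] [IsFibrant A'] [IsFibrant S] [IsFibrant S']
    [Fibration g] [Fibration g'] [WeakEquivalence a] [WeakEquivalence b] [WeakEquivalence s] :
    WeakEquivalence φ := by
  let HA : FibrantBrownFactorization a := Classical.arbitrary _
  -- This is Ken Brown's argument carried out for cospans: a third cospan `ft`, `gt` is built with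
  -- projections to both given ones that are trivial fibrations in the relative sense, and with a
  -- common section from the first one.
  let d : pushout HA.i f ⟶ S' ⨯ S := pushout.desc
    (prod.lift (HA.p ≫ f') (HA.r ≫ f)) (prod.lift s (𝟙 S)) (by
      apply Limits.prod.hom_ext
      · simp only [Category.assoc, prod.lift_fst, HA.fac_assoc, hf]
      · simp only [Category.assoc, prod.lift_snd, HA.i_r_assoc, Category.comp_id])
  have KS := MorphismProperty.factorizationData (trivialCofibrations C) (fibrations C) d
  let ft : HA.Z ⟶ KS.Z := pushout.inl _ _ ≫ KS.i
  let iS : S ⟶ KS.Z := pushout.inr _ _ ≫ KS.i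
  let pS : KS.Z ⟶ S' := KS.p ≫ prod.fst
  let rS : KS.Z ⟶ S := KS.p ≫ prod.snd
  have iS_pS : iS ≫ pS = s := by
    simp only [iS, pS, Category.assoc, KS.fac_assoc, d, pushout.inr_desc_assoc, prod.lift_fst]
  have iS_rS : iS ≫ rS = 𝟙 S := by
    simp only [iS, rS, Category.assoc, KS.fac_assoc, d, pushout.inr_desc_assoc, prod.lift_snd]
  have ft_pS : ft ≫ pS = HA.p ≫ f' := by
    simp only [ft, pS, Category.assoc, KS.fac_assoc, d, pushout.inl_desc_assoc, prod.lift_fst]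
  have ft_rS : ft ≫ rS = HA.r ≫ f := by
    simp only [ft, rS, Category.assoc, KS.fac_assoc, d, pushout.inl_desc_assoc, prod.lift_snd]
  have i_ft : HA.i ≫ ft = f ≫ iS := by
    simp only [ft, iS, pushout.condition_assoc]
  have : WeakEquivalence pS := weakEquivalence_of_precomp_of_fac iS_pS
  have : WeakEquivalence rS := weakEquivalence_of_precomp_of_fac iS_rS
  let c : B ⟶ pullback (prod.map g' g) KS.p := pullback.lift (prod.lift b (𝟙 B)) (g ≫ iS) (by
    apply Limits.prod.hom_ext
    · rw [Category.assoc, Limits.prod.map_fst, prod.lift_fst_assoc, Category.assoc, Category.assoc,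
        ← hg, ← iS_pS]
    · rw [Category.assoc, Limits.prod.map_snd, prod.lift_snd_assoc, Category.assoc, Category.assoc,
        Category.id_comp]
      exact ((g ≫= iS_rS).trans (Category.comp_id _)).symm)
  have KB := MorphismProperty.factorizationData (trivialCofibrations C) (fibrations C) c
  let gt : KB.Z ⟶ KS.Z := KB.p ≫ pullback.snd _ _
  let pB : KB.Z ⟶ B' := KB.p ≫ pullback.fst _ _ ≫ prod.fst
  let rB : KB.Z ⟶ B := KB.p ≫ pullback.fst _ _ ≫ prod.snd
  have iB_pB : KB.i ≫ pB = b := by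
    simp only [pB, KB.fac_assoc, c, pullback.lift_fst_assoc, prod.lift_fst]
  have iB_rB : KB.i ≫ rB = 𝟙 B := by
    simp only [rB, KB.fac_assoc, c, pullback.lift_fst_assoc, prod.lift_snd]
  have iB_gt : KB.i ≫ gt = g ≫ iS := by
    simp only [gt, KB.fac_assoc, c, pullback.lift_snd]
  have gt_pS : gt ≫ pS = pB ≫ g' := by
    simp only [gt, pS, pB, Category.assoc]
    rw [← pullback.condition_assoc, Limits.prod.map_fst]
  have gt_rS : gt ≫ rS = rB ≫ g := by
    simp only [gt, rS, rB, Category.assoc]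
    rw [← pullback.condition_assoc, Limits.prod.map_snd]
  have : WeakEquivalence pB := weakEquivalence_of_precomp_of_fac iB_pB
  have : WeakEquivalence rB := weakEquivalence_of_precomp_of_fac iB_rB
  have joint : ∀ ⦃U V : C⦄ (i : U ⟶ V) [Cofibration i] [WeakEquivalence i] (u : U ⟶ KB.Z)
      (v₁ : V ⟶ B') (v₂ : V ⟶ B) (w : V ⟶ KS.Z), i ≫ v₁ = u ≫ pB → i ≫ v₂ = u ≫ rB →
      i ≫ w = u ≫ gt → w ≫ pS = v₁ ≫ g' → w ≫ rS = v₂ ≫ g →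
      ∃ l : V ⟶ KB.Z, i ≫ l = u ∧ l ≫ pB = v₁ ∧ l ≫ rB = v₂ ∧ l ≫ gt = w := by
    intro U V i _ _ u v₁ v₂ w e₁ e₂ e₃ e₄ e₅
    have q : CommSq u i KB.p (pullback.lift (prod.lift v₁ v₂) w (by
        apply Limits.prod.hom_ext
        · simpa [pS, prod.lift_fst] using e₄.symm
        · simpa [rS, prod.lift_snd] using e₅.symm)) := ⟨by
      apply pullback.hom_ext
      · apply Limits.prod.hom_ext
        · simpa only [Category.assoc, pullback.lift_fst_assoc, prod.lift_fst] using e₁.symm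
        · simpa only [Category.assoc, pullback.lift_fst_assoc, prod.lift_snd] using e₂.symm
      · simpa only [Category.assoc, pullback.lift_snd] using e₃.symm⟩
    refine ⟨q.lift, by simp, ?_, ?_, ?_⟩
    · simp only [pB, CommSq.fac_right_assoc, pullback.lift_fst_assoc, prod.lift_fst]
    · simp only [rB, CommSq.fac_right_assoc, pullback.lift_fst_assoc, prod.lift_snd]
    · simp only [gt, CommSq.fac_right_assoc, pullback.lift_snd]
  have : Fibration (pullback.lift gt pB gt_pS : KB.Z ⟶ pullback pS g') :=
    fibration_lift_of_joint_lifting g' g pB rB gt pS rS gt_pS gt_rS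
      (fun U V i _ _ u v₁ v₂ w e₁ e₂ e₃ e₄ e₅ => by
        obtain ⟨l, a₁, a₂, -, a₃⟩ := joint i u v₁ v₂ w e₁ e₂ e₃ e₄ e₅
        exact ⟨l, a₁, a₂, a₃⟩)
  have : Fibration (pullback.lift gt rB gt_rS : KB.Z ⟶ pullback rS g) :=
    fibration_lift_of_joint_lifting g g' rB pB gt rS pS gt_rS gt_pS
      (fun U V i _ _ u v₁ v₂ w e₁ e₂ e₃ e₄ e₅ => by
        obtain ⟨l, a₁, -, a₂, a₃⟩ := joint i u v₂ v₁ w e₂ e₁ e₃ e₅ e₄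
        exact ⟨l, a₁, a₂, a₃⟩)
  have : WeakEquivalence (pullback.lift gt pB gt_pS : KB.Z ⟶ pullback pS g') :=
    weakEquivalence_of_postcomp_of_fac (g := pullback.snd _ _) (pullback.lift_snd _ _ _)
  have : WeakEquivalence (pullback.lift gt rB gt_rS : KB.Z ⟶ pullback rS g) :=
    weakEquivalence_of_postcomp_of_fac (g := pullback.snd _ _) (pullback.lift_snd _ _ _)
  have sqt := IsPullback.of_hasPullback ft gt
  let φp := sq'.lift (pullback.fst ft gt ≫ HA.p) (pullback.snd ft gt ≫ pB) (by
    rw [Category.assoc, Category.assoc, ← ft_pS, ← gt_pS, pullback.condition_assoc])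
  let φr := sq.lift (pullback.fst ft gt ≫ HA.r) (pullback.snd ft gt ≫ rB) (by
    rw [Category.assoc, Category.assoc, ← ft_rS, ← gt_rS, pullback.condition_assoc])
  have : WeakEquivalence φp := weakEquivalence_of_isPullback_of_trivialFibration sqt sq' φp
    HA.p pB pS (by simp [φp]) (by simp [φp]) ft_pS gt_pS
  have : WeakEquivalence φr := weakEquivalence_of_isPullback_of_trivialFibration sqt sq φr
    HA.r rB rS (by simp [φr]) (by simp [φr]) ft_rS gt_rS
  -- As a section of the equivalence `φr`, this map is an equivalence, and `φ` factors as `ι ≫ φp`.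
  let ι : P ⟶ pullback ft gt := pullback.lift (fst ≫ HA.i) (snd ≫ KB.i) (by
    rw [Category.assoc, Category.assoc, i_ft, iB_gt, sq.w_assoc])
  have hι : ι ≫ φr = 𝟙 P := by
    apply sq.hom_ext
    · simp [ι, φr, pullback.lift_fst_assoc]
    · simp [ι, φr, pullback.lift_snd_assoc, iB_rB]
  have : WeakEquivalence ι := weakEquivalence_of_postcomp_of_fac hι
  have hφ : φ = ι ≫ φp := by
    apply sq'.hom_ext
    · simp [ι, φp, pullback.lift_fst_assoc, h₁]
    · simp [ι, φp, pullback.lift_snd_assoc, h₂, iB_pB]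
  rw [hφ]
  infer_instance

end ModelCategoryLemmas

end HomotopicalAlgebra

/-! ### Transition maps of a sequence -/

namespace CategoryTheory.Functor

lemma ofSequence_map_mem {E : Type*} [Category E] {F : ℕ → E} (f : ∀ n, F n ⟶ F (n + 1))
    (P : MorphismProperty E) [P.IsMultiplicative] (a : ℕ) (h : ∀ n, a ≤ n → P (f n)) (b c : ℕ)
    (hab : a ≤ b) (φ : b ⟶ c) : P ((Functor.ofSequence f).map φ) := by
  obtain ⟨k, rfl⟩ := Nat.exists_eq_add_of_le (leOfHom φ)
  obtain rfl : φ = homOfLE (Nat.le_add_right b k) := Subsingleton.elim _ _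
  induction k with
  | zero =>
    have : homOfLE (Nat.le_add_right b 0) = 𝟙 b := rfl
    rw [this, CategoryTheory.Functor.map_id]
    exact P.id_mem _
  | succ k hk =>
    have : homOfLE (Nat.le_add_right b (k + 1)) =
      homOfLE (Nat.le_add_right b k) ≫ homOfLE (Nat.le_add_right (b + k) 1) := rfl
    rw [this, CategoryTheory.Functor.map_comp, Functor.ofSequence_map_homOfLE_succ]
    exact P.comp_mem _ _ hk (h _ (by lia))

end CategoryTheory.Functor

/-! ### Homotopies into Kan complexes, trivial Kan fibrations, and discrete simplicial sets -/

namespace SSet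

open MonoidalCategory MonoidalClosed CartesianMonoidalCategory

variable {X Y Z K : SSet.{u}}

/-- Constructor for homotopies. -/
def Homotopy.ofMap {f g : X ⟶ Y} (h : X ⊗ Δ[1] ⟶ Y) (h₀ : ι₀ ≫ h = f) (h₁ : ι₁ ≫ h = g) :
    Homotopy f g where
  h := h
  h₀ := h₀
  h₁ := h₁
  rel := by
    ext n ⟨⟨x, hx⟩, y⟩
    simp at hx

lemma nonempty_homotopy_refl (f : X ⟶ Y) : Nonempty (Homotopy f f) :=
  ⟨Homotopy.ofMap (fst _ _ ≫ f) rfl rfl⟩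

lemma nonempty_homotopy_comp {f g : X ⟶ Y} (H : Nonempty (Homotopy f g)) (k : Y ⟶ Z) :
    Nonempty (Homotopy (f ≫ k) (g ≫ k)) := by
  obtain ⟨H⟩ := H
  exact ⟨Homotopy.ofMap (H.h ≫ k) (by simp) (by simp)⟩

lemma nonempty_homotopy_precomp (k : Z ⟶ X) {f g : X ⟶ Y} (H : Nonempty (Homotopy f g)) :
    Nonempty (Homotopy (k ≫ f) (k ≫ g)) := by
  obtain ⟨H⟩ := H
  exact ⟨Homotopy.ofMap (k ▷ _ ≫ H.h) (by simp) (by simp)⟩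

lemma whiskerLeft_δ_one (X : SSet.{u}) :
    X ◁ stdSimplex.δ (1 : Fin 2) = fst X _ ≫ ι₀ := by
  have : stdSimplex.δ (1 : Fin 2) = const (stdSimplex.obj₀Equiv.{u}.symm 0) := by
    apply yonedaEquiv.injective
    decide
  apply CartesianMonoidalCategory.hom_ext
  · simp
  · simp [this]

lemma whiskerLeft_δ_zero (X : SSet.{u}) :
    X ◁ stdSimplex.δ (0 : Fin 2) = fst X _ ≫ ι₁ := by
  have : stdSimplex.δ (0 : Fin 2) = const (stdSimplex.obj₀Equiv.{u}.symm 1) := by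
    apply yonedaEquiv.injective
    decide
  apply CartesianMonoidalCategory.hom_ext
  · simp
  · simp [this]

/-- Homotopy of maps into a Kan complex is a Euclidean relation. -/
lemma nonempty_homotopy_euclidean [KanComplex K] {f g h : X ⟶ K}
    (H : Nonempty (Homotopy f g)) (H' : Nonempty (Homotopy f h)) : Nonempty (Homotopy g h) := by
  obtain ⟨H⟩ := H
  obtain ⟨H'⟩ := H'
  have e₁ : ∀ {a b : X ⟶ K} (L : Homotopy a b),
      stdSimplex.δ (1 : Fin 2) ≫ curry L.h = curry (fst X Δ[0] ≫ a) := fun L => by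
    rw [← curry_natural_left, whiskerLeft_δ_one, Category.assoc, L.h₀]
  have e₀ : ∀ {a b : X ⟶ K} (L : Homotopy a b),
      stdSimplex.δ (0 : Fin 2) ≫ curry L.h = curry (fst X Δ[0] ≫ b) := fun L => by
    rw [← curry_natural_left, whiskerLeft_δ_zero, Category.assoc, L.h₁]
  -- Homotopies are edges of the internal hom, which is again a Kan complex. The two edges with
  -- common source `f` form a horn Λ[2,0], and face 0 of a filler runs from `g` to `h`.
  obtain ⟨σ, hσ⟩ := KanComplex.hornFilling (S := (ihom X).obj K)
    (horn₂₀.isPushout.desc (curry H.h) (curry H'.h) (by rw [e₁, e₁]))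
  have h₂ : stdSimplex.δ (2 : Fin 3) ≫ σ = curry H.h := by
    rw [← horn.ι_ι (0 : Fin 3) 2 (by simp), Category.assoc, ← hσ, IsPushout.inl_desc]
  have h₁ : stdSimplex.δ (1 : Fin 3) ≫ σ = curry H'.h := by
    rw [← horn.ι_ι (0 : Fin 3) 1 (by simp), Category.assoc, ← hσ, IsPushout.inr_desc]
  let φ : X ⊗ Δ[1] ⟶ K := uncurry (stdSimplex.δ (0 : Fin 3) ≫ σ)
  have hφ : curry φ = stdSimplex.δ (0 : Fin 3) ≫ σ := curry_uncurry _
  have k₁ : fst X Δ[0] ≫ ι₀ ≫ φ = fst X Δ[0] ≫ g := by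
    apply curry_injective
    rw [← Category.assoc, ← whiskerLeft_δ_one, curry_natural_left, hφ, ← e₀ H, ← h₂]
    rw [← Category.assoc, ← Category.assoc]
    congr 1
    exact (stdSimplex.δ_comp_δ (i := (0 : Fin 2)) (j := 1) (by simp)).symm
  have k₂ : fst X Δ[0] ≫ ι₁ ≫ φ = fst X Δ[0] ≫ h := by
    apply curry_injective
    rw [← Category.assoc, ← whiskerLeft_δ_zero, curry_natural_left, hφ, ← e₀ H', ← h₁]
    rw [← Category.assoc, ← Category.assoc]
    congr 1
  have r : lift (𝟙 X) (const (stdSimplex.obj₀Equiv.{u}.symm 0)) ≫ fst X Δ[0] = 𝟙 X := by simp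
  refine ⟨Homotopy.ofMap φ ?_ ?_⟩
  · simpa [reassoc_of% r] using (lift (𝟙 X) (const (stdSimplex.obj₀Equiv.{u}.symm 0))) ≫= k₁
  · simpa [reassoc_of% r] using (lift (𝟙 X) (const (stdSimplex.obj₀Equiv.{u}.symm 0))) ≫= k₂

lemma nonempty_homotopy_symm [KanComplex K] {f g : X ⟶ K}
    (H : Nonempty (Homotopy f g)) : Nonempty (Homotopy g f) :=
  nonempty_homotopy_euclidean H (nonempty_homotopy_refl f)

lemma nonempty_homotopy_trans [KanComplex K] {f g h : X ⟶ K}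
    (H : Nonempty (Homotopy f g)) (H' : Nonempty (Homotopy g h)) : Nonempty (Homotopy f h) :=
  nonempty_homotopy_euclidean (nonempty_homotopy_symm H) H'

/-- Trivial Kan fibrations, i.e. maps with the right lifting property with respect to boundary
inclusions, have a section which is a homotopy inverse. -/
lemma exists_section_of_trivialFibration (p : X ⟶ Y) (hp : modelCategoryQuillen.I.rlp p) :
    ∃ s : Y ⟶ X, s ≫ p = 𝟙 Y ∧ Nonempty (Homotopy (p ≫ s) (𝟙 X)) := by
  rw [← rlp_monomorphisms] at hp
  have : HasLiftingProperty (⊥ : Y.Subcomplex).ι p := hp _ (inferInstanceAs (Mono _))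
  have sq : CommSq (Subcomplex.isInitialBot.to X) (⊥ : Y.Subcomplex).ι p (𝟙 Y) :=
    ⟨Subcomplex.isInitialBot.hom_ext _ _⟩
  refine ⟨sq.lift, by simp, ?_⟩
  let A : (X ⊗ Δ[1]).Subcomplex := Subcomplex.range ι₀
  let B : (X ⊗ Δ[1]).Subcomplex := Subcomplex.range ι₁
  -- The two ends of the cylinder are disjoint, so a map on their union is a pair of maps. Here the
  -- pair is (`p ≫ sq.lift`, identity), extended over the cylinder by lifting against `p`.
  have bi : Subcomplex.BicartSq ⊥ A B (A ⊔ B) :=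
    { sup_eq := rfl
      inf_eq := by
        apply le_antisymm _ bot_le
        rintro n x ⟨⟨y, hy⟩, ⟨z, hz⟩⟩
        exfalso
        induction n using Opposite.rec with | _ n
        induction n using SimplexCategory.rec with | _ n
        have h₀ := congrArg Prod.snd hy
        have h₁ := congrArg Prod.snd hz
        have := h₀.trans h₁.symm
        have := congrArg (fun t : (Δ[1] : SSet.{u}) _⦋n⦌ => t 0) this
        exact zero_ne_one (α := Fin 2) this }
  have : HasLiftingProperty (A ⊔ B).ι p := hp _ (inferInstanceAs (Mono _))
  have sq' : CommSq (bi.isPushout.desc (A.ι ≫ fst _ _ ≫ p ≫ sq.lift) (B.ι ≫ fst _ _)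
      (Subcomplex.isInitialBot.hom_ext _ _)) (A ⊔ B).ι p (fst _ _ ≫ p) := ⟨by
    apply bi.isPushout.hom_ext
    · rw [IsPushout.inl_desc_assoc]
      simp only [Category.assoc, sq.fac_right, Category.comp_id]
      rfl
    · rw [IsPushout.inr_desc_assoc]
      rfl⟩
  refine ⟨Homotopy.ofMap sq'.lift ?_ ?_⟩
  · have h : (Subcomplex.toRange ι₀ ≫ Subcomplex.homOfLE le_sup_left) ≫ (A ⊔ B).ι = ι₀ := rfl
    rw [← h, Category.assoc, sq'.fac_left, Category.assoc]
    exact (Subcomplex.toRange ι₀ ≫= bi.isPushout.inl_desc _ _ _).trans rfl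
  · have h : (Subcomplex.toRange ι₁ ≫ Subcomplex.homOfLE le_sup_right) ≫ (A ⊔ B).ι = ι₁ := rfl
    rw [← h, Category.assoc, sq'.fac_left, Category.assoc]
    exact (Subcomplex.toRange ι₁ ≫= bi.isPushout.inr_desc _ _ _).trans rfl

/-- If `r` and `t` are trivial Kan fibrations and `σ` is a section of `r`, then `σ ≫ t` is a weak
equivalence. -/
lemma isWeakEquivalence_of_section_comp {r : X ⟶ Y} {σ : Y ⟶ X} (hσ : σ ≫ r = 𝟙 Y) {t : X ⟶ Z}
    (hr : modelCategoryQuillen.I.rlp r) (ht : modelCategoryQuillen.I.rlp t) :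
    IsWeakEquivalence (σ ≫ t) := by
  obtain ⟨s, hs, Hs⟩ := exists_section_of_trivialFibration r hr
  obtain ⟨s', hs', Hs'⟩ := exists_section_of_trivialFibration t ht
  intro K _
  refine ⟨fun g => ⟨s' ≫ r ≫ g, ?_⟩, fun h h' H => ?_⟩
  · have := nonempty_homotopy_precomp σ (nonempty_homotopy_comp Hs' (r ≫ g))
    simpa [reassoc_of% hσ] using this
  -- Although `s` and `σ` may be different sections of `r`, both `r ≫ σ ≫ k` and `k` are homotopic
  -- to `r ≫ s ≫ k`.
  · have key : ∀ k : X ⟶ K, Nonempty (Homotopy (r ≫ σ ≫ k) k) := fun k => by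
      have h₁ := nonempty_homotopy_comp Hs (r ≫ σ ≫ k)
      have h₂ := nonempty_homotopy_comp Hs k
      simp only [Category.assoc, reassoc_of% hs, Category.id_comp] at h₁ h₂
      have h₃ := nonempty_homotopy_precomp r (nonempty_homotopy_precomp σ
        (nonempty_homotopy_comp Hs k))
      simp only [Category.id_comp, Category.assoc, reassoc_of% hσ] at h₃
      exact nonempty_homotopy_euclidean h₃ h₂
    have h₁ := nonempty_homotopy_precomp r H
    simp only [Category.assoc] at h₁
    have h₂ : Nonempty (Homotopy (t ≫ h) (t ≫ h')) :=
      nonempty_homotopy_trans (nonempty_homotopy_symm (key _))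
        (nonempty_homotopy_trans h₁ (key _))
    have h₃ := nonempty_homotopy_precomp s' h₂
    simpa [reassoc_of% hs'] using h₃

section Discrete

/-- The discrete simplicial set on a type. -/
abbrev discrete (S : Type u) : SSet.{u} := (Functor.const _).obj S

variable {S : Type u}

lemma discrete_app_map {X : SSet.{u}} (f : X ⟶ discrete S) {m n : SimplexCategoryᵒᵖ}
    (α : m ⟶ n) (x : X.obj m) : f.app n (X.map α x) = f.app m x :=
  ConcreteCategory.congr_hom (f.naturality α) x

lemma discrete_app_stdSimplex {n : ℕ} (f : Δ[n] ⟶ discrete S) {m : SimplexCategoryᵒᵖ}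
    (x : (Δ[n] : SSet.{u}).obj m) :
    f.app m x = f.app (op ⦋n⦌) (stdSimplex.objEquiv.symm (𝟙 _)) := by
  obtain ⟨x, rfl⟩ := stdSimplex.objEquiv.symm.surjective x
  rw [← discrete_app_map f x.op]
  congr 1
  simp [stdSimplex.map_apply]

lemma discrete_hom_ext_stdSimplex {n : ℕ} {f g : Δ[n] ⟶ discrete S} (m : SimplexCategoryᵒᵖ)
    (x : (Δ[n] : SSet.{u}).obj m) (h : f.app m x = g.app m x) : f = g := by
  ext k y
  exact (discrete_app_stdSimplex f y).trans ((discrete_app_stdSimplex f x).symm.trans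
    (h.trans ((discrete_app_stdSimplex g x).trans (discrete_app_stdSimplex g y).symm)))

/-- A map from a simplex to a discrete set is constant. A horn of dimension 1 has one face; in
higher dimensions any two faces of the horn meet, so their constants agree and the constant map is a
filler. -/
instance kanComplex_discrete (S : Type u) : KanComplex (discrete S) := by
  rw [KanComplex.iff]
  intro n i f hf
  obtain ⟨j₀, hj₀⟩ : ∃ j₀ : Fin (n + 2), j₀ ≠ i := exists_ne i
  let s : S := (f j₀ hj₀).app (op ⦋n⦌) (stdSimplex.objEquiv.symm (𝟙 _))
  let φ : Δ[n + 1] ⟶ discrete S := { app := fun _ => ↾fun _ => s }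
  refine ⟨φ, fun j hj => ?_⟩
  suffices f j hj = f j₀ hj₀ by
    rw [this]
    exact discrete_hom_ext_stdSimplex (op ⦋n⦌) (stdSimplex.objEquiv.symm (𝟙 _)) rfl
  obtain _ | n := n
  · have : j = j₀ := by
      have h₁ := fun h => hj (Fin.ext h)
      have h₂ := fun h => hj₀ (Fin.ext h)
      ext
      lia
    subst this
    rfl
  · rw [horn.isCompatible_iff] at hf
    have key : ∀ (j k : Fin (n + 3)) (hj : j ≠ i) (hk : k ≠ i), j < k → f j hj = f k hk := by
      intro j k hj hk hjk
      have := hf j k hj hk hjk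
      have e : (f j hj).app (op ⦋n⦌) _ = (f k hk).app (op ⦋n⦌) _ :=
        ConcreteCategory.congr_hom (congr_app this (op ⦋n⦌)) (stdSimplex.objEquiv.symm (𝟙 _))
      ext m y
      exact (discrete_app_stdSimplex _ y).trans ((discrete_app_stdSimplex (m := op ⦋n⦌) (f j hj) _).symm.trans
        (e.trans ((discrete_app_stdSimplex (m := op ⦋n⦌) (f k hk) _).trans (discrete_app_stdSimplex _ y).symm)))
    rcases lt_trichotomy j j₀ with h | rfl | h
    · exact key _ _ _ _ h
    · rfl
    · exact (key _ _ _ _ h).symm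

/-- At a vertex `x`, the homotopy restricts to an edge from `f x` to `g x`, and an edge of a
discrete simplicial set has equal ends. Higher simplices take the value of one of their vertices. -/
lemma eq_of_homotopy_discrete {f g : X ⟶ discrete S} (H : Homotopy f g) : f = g := by
  have h₀ : ∀ x : X _⦋0⦌, f.app _ x = g.app _ x := fun x => by
    let y : (X ⊗ Δ[1] : SSet.{u}) _⦋1⦌ := (X.σ 0 x, stdSimplex.objEquiv.symm (𝟙 _))
    have d₁ : (Δ[1] : SSet.{u}).δ 1 (stdSimplex.objEquiv.symm (𝟙 _)) =
      stdSimplex.obj₀Equiv.symm 0 := by decide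
    have d₀ : (Δ[1] : SSet.{u}).δ 0 (stdSimplex.objEquiv.symm (𝟙 _)) =
      stdSimplex.obj₀Equiv.symm 1 := by decide
    have e₁ : (X ⊗ Δ[1] : SSet.{u}).δ 1 y = ι₀.app _ x := by
      refine Prod.ext ?_ ?_
      · exact X.δ_comp_σ_succ_apply 0 x
      · refine Eq.trans d₁ ?_
        ext i
        fin_cases i
        rfl
    have e₀ : (X ⊗ Δ[1] : SSet.{u}).δ 0 y = ι₁.app _ x := by
      refine Prod.ext ?_ ?_
      · exact X.δ_comp_σ_self_apply 0 x
      · refine Eq.trans d₀ ?_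
        ext i
        fin_cases i
        rfl
    have a₁ := discrete_app_map H.h (SimplexCategory.δ (1 : Fin 2)).op y
    have a₀ := discrete_app_map H.h (SimplexCategory.δ (0 : Fin 2)).op y
    have b₁ : H.h.app _ (ι₀.app _ x) = f.app _ x :=
      ConcreteCategory.congr_hom (congr_app H.h₀ _) x
    have b₀ : H.h.app _ (ι₁.app _ x) = g.app _ x :=
      ConcreteCategory.congr_hom (congr_app H.h₁ _) x
    rw [← b₁, ← b₀, ← e₁, ← e₀]
    exact a₁.trans a₀.symm
  ext n x
  let α : n ⟶ op ⦋0⦌ := (SimplexCategory.const ⦋0⦌ n.unop 0).op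
  exact (discrete_app_map f α x).symm.trans ((h₀ _).trans (discrete_app_map g α x))

/-- Precomposition with a weak equivalence is a bijection on the maps to a discrete simplicial
set. -/
lemma IsWeakEquivalence.bijective_discrete {f : X ⟶ Y} (hf : IsWeakEquivalence f) (S : Type u) :
    Function.Bijective (fun h : Y ⟶ discrete S => f ≫ h) := by
  obtain ⟨h₁, h₂⟩ := hf (discrete S) inferInstance
  refine ⟨fun a b hab => ?_, fun g => ?_⟩
  · obtain ⟨H⟩ := h₂ a b (by
      dsimp at hab
      rw [hab]
      exact nonempty_homotopy_refl _)
    exact eq_of_homotopy_discrete H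
  · obtain ⟨h, ⟨H⟩⟩ := h₁ g
    exact ⟨h, eq_of_homotopy_discrete H⟩

end Discrete

end SSet

/-! ### Powers of a simplicial object; matching objects as powers by boundaries -/

namespace Hovey

section Powers

variable {D : Type u} [Category.{v} D]

/-- The functor `A ↦ D(A, X_•)` attached to a simplicial object `X`. -/
abbrev simplicialHom (X : SimplicialObject D) : Dᵒᵖ ⥤ SSet.{v} :=
  coyoneda ⋙ (Functor.whiskeringLeft _ _ _).obj X

/-- The data of an isomorphism of `P` with the power `X^K`, characterized by
`D(A, X^K) ≃ SSet(K, D(A, X_•))`. -/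
abbrev IsPower (X : SimplicialObject D) (K : SSet.{v}) (P : D) :=
  (simplicialHom X ⋙ coyoneda.obj (op K)).RepresentableBy P

variable {X : SimplicialObject D}

namespace IsPower

variable {K L : SSet.{v}} {P Q : D} (hP : IsPower X K P) (hQ : IsPower X L Q)

lemma homEquiv_comp' {A B : D} (f : A ⟶ B) (g : B ⟶ P) :
    hP.homEquiv (f ≫ g) = (hP.homEquiv g : K ⟶ (simplicialHom X).obj (op B)) ≫
      (simplicialHom X).map f.op :=
  hP.homEquiv_comp f g

lemma homEquiv_symm_comp {A B : D} (f : A ⟶ B) (φ : K ⟶ (simplicialHom X).obj (op B)) :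
    f ≫ hP.homEquiv.symm φ = hP.homEquiv.symm (φ ≫ (simplicialHom X).map f.op) := by
  apply hP.homEquiv.injective
  rw [homEquiv_comp']
  simp

/-- The map `X^L ⟶ X^K` induced by `i : K ⟶ L`. -/
def map (i : K ⟶ L) : Q ⟶ P :=
  hP.homEquiv.symm (i ≫ (hQ.homEquiv (𝟙 Q) : L ⟶ (simplicialHom X).obj (op Q)))

lemma homEquiv_comp_map (i : K ⟶ L) {A : D} (f : A ⟶ Q) :
    hP.homEquiv (f ≫ map hP hQ i) = i ≫ (hQ.homEquiv f : L ⟶ (simplicialHom X).obj (op A)) := by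
  have : f = f ≫ 𝟙 Q := by simp
  conv_rhs => rw [this, homEquiv_comp']
  rw [map, homEquiv_symm_comp, Equiv.apply_symm_apply]
  simp

/-- Lifting problems of `K ⟶ L` against `D(B, X_•) ⟶ D(A, X_•)` are lifting problems of
`A ⟶ B` against `X^L ⟶ X^K`. -/
lemma hasLiftingProperty_iff (i : K ⟶ L) (m : Q ⟶ P)
    (hm : ∀ {A : D} (f : A ⟶ Q),
      hP.homEquiv (f ≫ m) = i ≫ (hQ.homEquiv f : L ⟶ (simplicialHom X).obj (op A)))
    {A B : D} (f : A ⟶ B) :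
    HasLiftingProperty i ((simplicialHom X).map f.op) ↔ HasLiftingProperty f m := by
  constructor
  · intro _
    refine ⟨fun {a b} sq => ?_⟩
    have sq' : CommSq (hP.homEquiv b : K ⟶ (simplicialHom X).obj (op B)) i
        ((simplicialHom X).map f.op) (hQ.homEquiv a : L ⟶ (simplicialHom X).obj (op A)) := ⟨by
      rw [← hm, ← homEquiv_comp', sq.w]⟩
    refine ⟨⟨⟨hQ.homEquiv.symm sq'.lift, ?_, ?_⟩⟩⟩
    · rw [homEquiv_symm_comp, sq'.fac_right, Equiv.symm_apply_apply]
    · apply hP.homEquiv.injective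
      rw [hm, Equiv.apply_symm_apply, sq'.fac_left]
  · intro _
    refine ⟨fun {b a} sq => ?_⟩
    have sq' : CommSq (hQ.homEquiv.symm a) f m (hP.homEquiv.symm b) := ⟨by
      apply hP.homEquiv.injective
      rw [hm, Equiv.apply_symm_apply, homEquiv_comp', Equiv.apply_symm_apply, sq.w]⟩
    refine ⟨⟨⟨hQ.homEquiv sq'.lift, ?_, ?_⟩⟩⟩
    · rw [← hm, sq'.fac_right, Equiv.apply_symm_apply]
    · rw [← homEquiv_comp', sq'.fac_left, Equiv.apply_symm_apply]

/-- Powers send pushouts to pullbacks. -/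
lemma isPower_of_isPushout {K₁ K₂ K₃ K₄ : SSet.{v}} {t : K₁ ⟶ K₂} {l : K₁ ⟶ K₃} {r : K₂ ⟶ K₄}
    {b : K₃ ⟶ K₄} (sq : IsPushout t l r b) {P₁ P₂ P₃ P₄ : D} (h₁ : IsPower X K₁ P₁)
    (h₂ : IsPower X K₂ P₂) (h₃ : IsPower X K₃ P₃) {p : P₄ ⟶ P₂} {q : P₄ ⟶ P₃}
    (sq' : IsPullback p q (map h₁ h₂ t) (map h₁ h₃ l)) : Nonempty (IsPower X K₄ P₄) := by
  let e (A : D) : (A ⟶ P₄) ≃ (K₄ ⟶ (simplicialHom X).obj (op A)) :=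
    { toFun := fun f => sq.desc (h₂.homEquiv (f ≫ p)) (h₃.homEquiv (f ≫ q)) (by
        rw [← homEquiv_comp_map, ← homEquiv_comp_map, Category.assoc, Category.assoc, sq'.w])
      invFun := fun φ => sq'.lift (h₂.homEquiv.symm (r ≫ φ)) (h₃.homEquiv.symm (b ≫ φ)) (by
        apply h₁.homEquiv.injective
        rw [homEquiv_comp_map, homEquiv_comp_map, Equiv.apply_symm_apply, Equiv.apply_symm_apply]
        exact sq.w_assoc φ)
      left_inv := fun f => by
        apply sq'.hom_ext
        · simp
        · simp
      right_inv := fun φ => by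
        apply sq.hom_ext
        · simp
        · simp }
  refine ⟨{ homEquiv := @fun A => e A, homEquiv_comp := ?_ }⟩
  intro A B f g
  apply sq.hom_ext
  · dsimp [e]
    rw [IsPushout.inl_desc, IsPushout.inl_desc_assoc, Category.assoc]
    exact homEquiv_comp' h₂ f _
  · dsimp [e]
    rw [IsPushout.inr_desc, IsPushout.inr_desc_assoc, Category.assoc]
    exact homEquiv_comp' h₃ f _

variable (X) in
/-- `X^{Δ[n]} = Xₙ`. -/
def stdSimplex (n : ℕ) : IsPower X Δ[n] (X.obj (op ⦋n⦌)) where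
  homEquiv := (SSet.yonedaEquiv (X := (simplicialHom X).obj _)).symm
  homEquiv_comp f g := by
    apply SSet.yonedaEquiv.injective
    refine (Equiv.apply_symm_apply _ _).trans ?_
    exact congrArg (f ≫ ·) ((SSet.yonedaEquiv
      (X := (simplicialHom X).obj (op _))).apply_symm_apply g).symm

end IsPower

/-- Change of universe for the boundary of a simplex. -/
def boundaryEquiv (n : ℕ) (m : SimplexCategoryᵒᵖ) :
    (SSet.boundary.{v} n : SSet.{v}).obj m ≃ (SSet.boundary.{0} n : SSet.{0}).obj m where
  toFun s := ⟨SSet.stdSimplex.objEquiv.symm (SSet.stdSimplex.objEquiv s.1), s.2⟩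
  invFun s := ⟨SSet.stdSimplex.objEquiv.symm (SSet.stdSimplex.objEquiv s.1), s.2⟩
  left_inv s := Subtype.ext (by simp)
  right_inv s := Subtype.ext (by simp)

variable [HasLimits D]

variable (X) in
/-- `X^{∂Δ[n]} = Mₙ X`. -/
noncomputable def isPowerMatchingObject (n : ℕ) :
    IsPower X (SSet.boundary.{v} n : SSet.{v}) (matchingObject X n) where
  homEquiv {A} :=
    { toFun := fun f =>
        { app := fun m => ↾fun s => f ≫ limit.π (matchingDiagram X n) ⟨m, boundaryEquiv n m s⟩
          naturality := fun m m' α => by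
            ext s
            have := limit.w (matchingDiagram X n) (j := ⟨m, boundaryEquiv n m s⟩)
              (j' := ⟨m', boundaryEquiv n m' ((SSet.boundary.{v} n : SSet.{v}).map α s)⟩)
              ⟨α, rfl⟩
            exact (f ≫= this.symm).trans (Category.assoc _ _ _).symm }
      invFun := fun φ => limit.lift (matchingDiagram X n)
        { pt := A
          π :=
            { app := fun p => φ.app p.1 ((boundaryEquiv n p.1).symm p.2)
              naturality := fun p q α => by
                refine (Category.id_comp _).trans ?_
                have h := ConcreteCategory.congr_hom (φ.naturality α.1)
                  ((boundaryEquiv n p.1).symm p.2)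
                refine Eq.trans ?_ h
                exact congrArg (fun y => φ.app q.1 ((boundaryEquiv n q.1).symm y)) α.2.symm } }
      left_inv := fun f => by
        apply limit.hom_ext
        intro p
        rw [limit.lift_π]
        dsimp
        rw [Equiv.apply_symm_apply]
        rfl
      right_inv := fun φ => by
        refine NatTrans.ext (funext fun m => ?_)
        ext s
        refine (limit.lift_π _ _).trans ?_
        dsimp
        rw [Equiv.symm_apply_apply] }
  homEquiv_comp f g := by
    refine NatTrans.ext (funext fun m => ?_)
    ext s
    exact Category.assoc _ _ _

lemma isPowerMatchingObject_comp_matchingMap (n : ℕ) {A : D} (f : A ⟶ X.obj (op ⦋n⦌)) :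
    (isPowerMatchingObject X n).homEquiv (f ≫ matchingMap X n) =
      (SSet.boundary n).ι ≫
        ((IsPower.stdSimplex X n).homEquiv f : Δ[n] ⟶ (simplicialHom X).obj (op A)) := by
  refine NatTrans.ext (funext fun m => ?_)
  ext s
  refine (Category.assoc _ _ _).trans ?_
  refine (f ≫= limit.lift_π (matchingCone X n) ⟨m, boundaryEquiv n m s⟩).trans ?_
  rfl

/-- This adjunction turns statements about trivial Kan fibrations of function complexes into lifting
against matching maps. -/
lemma hasLiftingProperty_boundary_iff {A B : D} (f : A ⟶ B) (n : ℕ) :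
    HasLiftingProperty (SSet.boundary.{v} n).ι ((simplicialHom X).map f.op) ↔
      HasLiftingProperty f (matchingMap X n) :=
  IsPower.hasLiftingProperty_iff (isPowerMatchingObject X n) (IsPower.stdSimplex X n) _ _
    (isPowerMatchingObject_comp_matchingMap n) f

end Powers

end Hovey

/-! ### Building the boundary of a simplex by gluing smaller simplices -/

namespace SSet

/-- To prove a property of `∂Δ[n]`, it suffices to prove it for the simplices of dimension `< n`
and to show that it is stable under gluing along monomorphisms. -/
lemma boundary_induction (n : ℕ) (P : SSet.{v} → Prop)
    (hinitial : ∀ K : SSet.{v}, IsInitial K → P K)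
    (hsimplex : ∀ (K : SSet.{v}) (m : ℕ), m < n → (Δ[m] ≅ K) → P K)
    (hpushout : ∀ {K₁ K₂ K₃ K₄ : SSet.{v}} {t : K₁ ⟶ K₂} {l : K₁ ⟶ K₃} {r : K₂ ⟶ K₄}
      {b : K₃ ⟶ K₄}, IsPushout t l r b → Mono t → Mono l → P K₁ → P K₂ → P K₃ → P K₄) :
    P (SSet.boundary.{v} n) := by
  -- The induction runs over the length of a list of faces. Adding the face `s` glues it along its
  -- intersection with the union of the others, which is again a union of `k` faces, possibly empty
  -- or repeated. This is why arbitrary lists are allowed.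
  have key (k : ℕ) (T : List (Finset (Fin (n + 1)))) (hT : T.length = k)
      (hT' : ∀ s ∈ T, s.card ≤ n) : P
      ((T.foldr (fun s K => stdSimplex.face.{v} s ⊔ K) ⊥ : (Δ[n] : SSet.{v}).Subcomplex) :
        SSet.{v}) := by
    induction k generalizing T with
    | zero =>
      obtain rfl := List.length_eq_zero_iff.1 hT
      exact hinitial _ Subcomplex.isInitialBot
    | succ k hk =>
      obtain _ | ⟨s, T⟩ := T
      · simp at hT
      obtain rfl : T.length = k := by simpa using hT
      have hs : P (stdSimplex.face.{v} s : SSet.{v}) := by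
        obtain rfl | hs := s.eq_empty_or_nonempty
        · rw [stdSimplex.face_empty]
          exact hinitial _ Subcomplex.isInitialBot
        · obtain ⟨m, hm⟩ : ∃ m, s.card = m + 1 :=
            Nat.exists_eq_succ_of_ne_zero hs.card_ne_zero
          have := hT' s (by simp)
          exact hsimplex _ m (by lia) (stdSimplex.isoOfRepresentableBy
            (stdSimplex.faceRepresentableBy s m (s.orderIsoOfFin hm)))
      have hinter : ∀ T : List (Finset (Fin (n + 1))),
          stdSimplex.face.{v} s ⊓ T.foldr (fun s K => stdSimplex.face.{v} s ⊔ K) ⊥ =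
          (T.map (s ⊓ ·)).foldr (fun s K => stdSimplex.face.{v} s ⊔ K) ⊥ := by
        intro T
        induction T with
        | nil => simp
        | cons t T ht =>
          have hdist (K₁ K₂ K₃ : (Δ[n] : SSet.{v}).Subcomplex) :
              K₁ ⊓ (K₂ ⊔ K₃) = (K₁ ⊓ K₂) ⊔ (K₁ ⊓ K₃) := by
            ext m x
            exact and_or_left
          refine (hdist _ _ _).trans ?_
          rw [ht, stdSimplex.face_inter_face]
          rfl
      have h₁ := hk (T.map (s ⊓ ·)) (by simp) (fun t ht => by
        obtain ⟨t, -, rfl⟩ := List.mem_map.1 ht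
        exact (Finset.card_le_card Finset.inter_subset_left).trans (hT' s (by simp)))
      rw [← hinter] at h₁
      have sq : Subcomplex.BicartSq
        (stdSimplex.face.{v} s ⊓ T.foldr (fun s K => stdSimplex.face.{v} s ⊔ K) ⊥)
        (stdSimplex.face.{v} s) (T.foldr (fun s K => stdSimplex.face.{v} s ⊔ K) ⊥)
        (stdSimplex.face.{v} s ⊔ T.foldr (fun s K => stdSimplex.face.{v} s ⊔ K) ⊥) :=
        ⟨rfl, rfl⟩
      exact hpushout sq.isPushout inferInstance inferInstance h₁ hs
        (hk T rfl (fun t ht => hT' t (by simp [ht])))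
  have h₁ : ((List.finRange (n + 1)).map fun i => ({i}ᶜ : Finset (Fin (n + 1)))).foldr
      (fun s K => stdSimplex.face.{v} s ⊔ K) ⊥ = boundary.{v} n := by
    have (T : List (Finset (Fin (n + 1)))) :
        T.foldr (fun s K => stdSimplex.face.{v} s ⊔ K) ⊥ =
          ⨆ s ∈ T, stdSimplex.face.{v} s := by
      induction T with
      | nil => simp
      | cons t T ht => simp [ht, iSup_or, iSup_sup_eq]
    rw [this, boundary_eq_iSup]
    simp only [List.mem_map, List.mem_finRange, true_and, iSup_exists]
    rw [iSup_comm]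
    simp
  rw [← h₁]
  refine key _ _ rfl fun s hs => ?_
  obtain ⟨i, -, rfl⟩ := List.mem_map.1 hs
  simp [Finset.card_compl]

end SSet

/-! ### Powers of Reedy fibrant objects -/

namespace Hovey

section

variable {D : Type u} [Category.{v} D] {X : SimplicialObject D}

namespace IsPower

/-- Powers only depend on the isomorphism class of the exponent. -/
def ofIso {K L : SSet.{v}} {P : D} (hP : IsPower X K P) (e : K ≅ L) : IsPower X L P :=
  Functor.RepresentableBy.ofIso hP
    (Functor.isoWhiskerLeft (simplicialHom X) (coyoneda.mapIso e.op.symm))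

/-- The power by the initial simplicial set is terminal. -/
def ofIsInitial {K : SSet.{v}} (hK : IsInitial K) {P : D} (hP : IsTerminal P) :
    IsPower X K P where
  homEquiv :=
    { toFun := fun _ => hK.to _
      invFun := fun _ => hP.from _
      left_inv := fun _ => hP.hom_ext _ _
      right_inv := fun _ => hK.hom_ext _ _ }
  homEquiv_comp _ _ := hK.hom_ext _ _

end IsPower

variable [HasLimits D]

lemma simplicialHom_map_mem_rlp_of_hasLiftingProperty {A B : D} (f : A ⟶ B)
    (hf : ∀ n, HasLiftingProperty f (matchingMap X n)) :
    SSet.modelCategoryQuillen.I.rlp ((simplicialHom X).map f.op) := by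
  rintro K L _ ⟨n⟩
  exact (hasLiftingProperty_boundary_iff f n).2 (hf n)

variable [ModelCategory D]

lemma IsReedyFibrant.simplicialHom_map_mem_rlp (hX : IsReedyFibrant X) {A B : D} (f : A ⟶ B)
    [Cofibration f] [WeakEquivalence f] :
    SSet.modelCategoryQuillen.I.rlp ((simplicialHom X).map f.op) := by
  refine simplicialHom_map_mem_rlp_of_hasLiftingProperty f fun n => ?_
  have : Fibration (matchingMap X n) := ⟨hX n⟩
  infer_instance

/-- The powers of a Reedy fibrant object send monomorphisms to fibrations. -/
lemma IsReedyFibrant.fibration_map (hX : IsReedyFibrant X) {K L : SSet.{v}} (i : K ⟶ L) [Mono i]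
    {P Q : D} (hP : IsPower X K P) (hQ : IsPower X L Q) : Fibration (IsPower.map hP hQ i) := by
  rw [fibration_iff, ← trivialCofibrations_rlp]
  rintro A B f ⟨hf, hf'⟩
  have : Cofibration f := ⟨hf⟩
  have : WeakEquivalence f := ⟨hf'⟩
  have h := hX.simplicialHom_map_mem_rlp f
  rw [← SSet.rlp_monomorphisms] at h
  exact (IsPower.hasLiftingProperty_iff hP hQ i _
    (fun g => IsPower.homEquiv_comp_map hP hQ i g) f).1 (h i ‹Mono i›)

lemma IsReedyFibrant.isFibrant_power (hX : IsReedyFibrant X) {K : SSet.{v}} {P : D}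
    (hP : IsPower X K P) : IsFibrant P := by
  have h := hX.fibration_map (initial.to K)
    (IsPower.ofIsInitial (X := X) initialIsInitial terminalIsTerminal) hP
  rw [isFibrant_iff_of_isTerminal _ terminalIsTerminal]
  exact h

/-- Gluing ∂Δ[n] from simplices of dimension below n presents the matching object as an iterated
pullback of terms of `X`. Both legs of each pullback are fibrations because both gluing maps are
monomorphisms. It is used to show that matching objects of local resolutions are local. -/
lemma IsReedyFibrant.matchingObject_mem (hX : IsReedyFibrant X) (S : ObjectProperty D)
    [S.IsClosedUnderIsomorphisms] (hterm : S (⊤_ D))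
    (hpull : ∀ {P₁ P₂ P₃ : D} (p : P₂ ⟶ P₁) (q : P₃ ⟶ P₁) [Fibration p] [Fibration q],
      S P₁ → S P₂ → S P₃ → S (pullback p q))
    (hS : ∀ m, S (X.obj (op ⦋m⦌))) (n : ℕ) : S (matchingObject X n) := by
  obtain ⟨P, hP, ⟨e⟩⟩ := SSet.boundary_induction n
    (fun K => ∃ P, S P ∧ Nonempty (IsPower X K P))
    (fun K hK => ⟨_, hterm, ⟨IsPower.ofIsInitial hK terminalIsTerminal⟩⟩)
    (fun K m _ i => ⟨_, hS m, ⟨(IsPower.stdSimplex X m).ofIso i⟩⟩)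
    (by
      rintro K₁ K₂ K₃ K₄ t l r b sq _ _ ⟨P₁, h₁, ⟨e₁⟩⟩ ⟨P₂, h₂, ⟨e₂⟩⟩ ⟨P₃, h₃, ⟨e₃⟩⟩
      have hp := hX.fibration_map t e₁ e₂
      have hq := hX.fibration_map l e₁ e₃
      exact ⟨_, hpull _ _ h₁ h₂ h₃, IsPower.isPower_of_isPushout sq e₁ e₂ e₃
        (IsPullback.of_hasPullback _ _)⟩)
  exact S.prop_of_iso (e.uniqueUpToIso (isPowerMatchingObject X n)) hP

lemma IsReedyFibrant.isFibrant_obj (hX : IsReedyFibrant X) (n : ℕ) :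
    IsFibrant (X.obj (op ⦋n⦌)) :=
  hX.isFibrant_power (IsPower.stdSimplex X n)

end

end Hovey

/-! ### Replacing one degree of a simplicial object by attaching cells -/

namespace Hovey

section Tensor

variable {D : Type u} [Category.{v} D] [HasColimits D]

/-- The simplicial object with `(K ⊗ B)_m = ∐_{K_m} B`. -/
noncomputable def tensor (K : SSet.{v}) (B : D) : SimplicialObject D where
  obj m := ∐ fun _ : K.obj m => B
  map {m m'} α := Sigma.desc fun s => Sigma.ι (fun _ : K.obj m' => B) (K.map α s)
  map_id m := by
    refine Sigma.hom_ext _ _ fun s => ?_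
    rw [Sigma.ι_desc, Category.comp_id]
    exact congrArg (Sigma.ι (fun _ : K.obj m => B)) (ConcreteCategory.congr_hom (K.map_id m) s)
  map_comp {m m' m''} α β := by
    refine Sigma.hom_ext _ _ fun s => ?_
    rw [Sigma.ι_desc, Sigma.ι_desc_assoc, Sigma.ι_desc]
    exact congrArg (Sigma.ι (fun _ : K.obj m'' => B))
      (ConcreteCategory.congr_hom (K.map_comp α β) s)

/-- The inclusion of the summand attached to a simplex. -/
noncomputable def tensorι (K : SSet.{v}) (B : D) {m : SimplexCategoryᵒᵖ} (s : K.obj m) :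
    B ⟶ (tensor K B).obj m := Sigma.ι (fun _ : K.obj m => B) s

variable {K L : SSet.{v}} {A B : D}

lemma tensor_hom_ext {m : SimplexCategoryᵒᵖ} {Z : D} {f g : (tensor K B).obj m ⟶ Z}
    (h : ∀ s, tensorι K B s ≫ f = tensorι K B s ≫ g) : f = g :=
  Sigma.hom_ext _ _ h

/-- Maps out of `∐_{K_m} B`. -/
noncomputable def tensorObjDesc {m : SimplexCategoryᵒᵖ} {Z : D} (f : K.obj m → (B ⟶ Z)) :
    (tensor K B).obj m ⟶ Z := Sigma.desc f

@[simp]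
lemma tensorι_tensorObjDesc {m : SimplexCategoryᵒᵖ} {Z : D} (f : K.obj m → (B ⟶ Z))
    (s : K.obj m) : tensorι K B s ≫ tensorObjDesc f = f s := Sigma.ι_desc _ _

@[simp]
lemma tensorι_tensorObjDesc_assoc {m : SimplexCategoryᵒᵖ} {Z Z' : D} (f : K.obj m → (B ⟶ Z))
    (s : K.obj m) (g : Z ⟶ Z') : tensorι K B s ≫ tensorObjDesc f ≫ g = f s ≫ g :=
  Sigma.ι_desc_assoc _ _ _

@[simp]
lemma tensorι_map {m m' : SimplexCategoryᵒᵖ} (s : K.obj m) (α : m ⟶ m') :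
    tensorι K B s ≫ (tensor K B).map α = tensorι K B (K.map α s) := Sigma.ι_desc _ _

@[simp]
lemma tensorι_map_assoc {m m' : SimplexCategoryᵒᵖ} (s : K.obj m) (α : m ⟶ m') {Z : D}
    (g : (tensor K B).obj m' ⟶ Z) :
    tensorι K B s ≫ (tensor K B).map α ≫ g = tensorι K B (K.map α s) ≫ g :=
  Sigma.ι_desc_assoc _ _ _

/-- The functoriality of `K ⊗ B`. -/
noncomputable def tensorMap (k : K ⟶ L) (f : A ⟶ B) : tensor K A ⟶ tensor L B where
  app m := tensorObjDesc fun s => f ≫ tensorι L B (k.app m s)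
  naturality m m' α := by
    refine tensor_hom_ext fun s => ?_
    rw [tensorι_map_assoc, tensorι_tensorObjDesc, tensorι_tensorObjDesc_assoc, Category.assoc,
      tensorι_map]
    exact congrArg (fun s => f ≫ tensorι L B s)
      (ConcreteCategory.congr_hom (k.naturality α) s)

@[simp]
lemma tensorι_tensorMap_app (k : K ⟶ L) (f : A ⟶ B) {m : SimplexCategoryᵒᵖ} (s : K.obj m) :
    tensorι K A s ≫ (tensorMap k f).app m = f ≫ tensorι L B (k.app m s) := Sigma.ι_desc _ _

@[simp]
lemma tensorι_tensorMap_app_assoc (k : K ⟶ L) (f : A ⟶ B) {m : SimplexCategoryᵒᵖ} (s : K.obj m)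
    {Z : D} (g : (tensor L B).obj m ⟶ Z) :
    tensorι K A s ≫ (tensorMap k f).app m ≫ g = f ≫ tensorι L B (k.app m s) ≫ g :=
  (Sigma.ι_desc_assoc _ _ _).trans (Category.assoc _ _ _)

variable {X : SimplicialObject D}

/-- The map `K ⊗ B ⟶ X` corresponding to `K ⟶ D(B, X_•)`. -/
noncomputable def tensorDesc (φ : K ⟶ (simplicialHom X).obj (op B)) : tensor K B ⟶ X where
  app m := tensorObjDesc fun s => (φ.app m s : B ⟶ X.obj m)
  naturality m m' α := by
    refine tensor_hom_ext fun s => ?_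
    rw [tensorι_map_assoc, tensorι_tensorObjDesc, tensorι_tensorObjDesc_assoc]
    exact ConcreteCategory.congr_hom (φ.naturality α) s

@[simp]
lemma tensorι_tensorDesc_app (φ : K ⟶ (simplicialHom X).obj (op B)) {m : SimplexCategoryᵒᵖ}
    (s : K.obj m) : tensorι K B s ≫ (tensorDesc φ).app m = φ.app m s := Sigma.ι_desc _ _

end Tensor

section Step

variable {D : Type u} [Category.{v} D] [HasColimits D] [HasLimits D]
  (X : SimplicialObject D) (n : ℕ) {B : D} (i : X.obj (op ⦋n⦌) ⟶ B) (p : B ⟶ matchingObject X n)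

/-- The projection of the matching object attached to a simplex of `∂Δ[n]`. -/
noncomputable def matchingπ {m : SimplexCategoryᵒᵖ}
    (s : (SSet.boundary.{v} n : SSet.{v}).obj m) : matchingObject X n ⟶ X.obj m :=
  limit.π (matchingDiagram X n) ⟨m, boundaryEquiv n m s⟩

lemma matchingMap_π {m : SimplexCategoryᵒᵖ} (s : (SSet.boundary.{v} n : SSet.{v}).obj m) :
    matchingMap X n ≫ matchingπ X n s = X.map (SSet.stdSimplex.objEquiv s.1).op :=
  limit.lift_π (matchingCone X n) ⟨m, boundaryEquiv n m s⟩

/-- The domain of the pushout-product of `∂Δ[n] ⟶ Δ[n]` and `i`. -/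
noncomputable abbrev cornerDomain : SimplicialObject D :=
  pushout (tensorMap (SSet.boundary.{v} n).ι (𝟙 (X.obj (op ⦋n⦌))))
    (tensorMap (𝟙 (SSet.boundary.{v} n : SSet.{v})) i)

lemma corner_condition :
    tensorMap (SSet.boundary.{v} n).ι (𝟙 (X.obj (op ⦋n⦌))) ≫ tensorMap (𝟙 Δ[n]) i =
      tensorMap (𝟙 (SSet.boundary.{v} n : SSet.{v})) i ≫
        tensorMap (SSet.boundary.{v} n).ι (𝟙 B) := by
  ext m
  refine tensor_hom_ext fun s => ?_
  simp

/-- The pushout-product of `∂Δ[n] ⟶ Δ[n]` and `i`. -/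
noncomputable def corner : cornerDomain X n i ⟶ tensor Δ[n] B :=
  pushout.desc (tensorMap (𝟙 _) i) (tensorMap (SSet.boundary.{v} n).ι (𝟙 B))
    (corner_condition X n i)

variable {i p} in
lemma attachingMap_condition (hp : i ≫ p = matchingMap X n) :
    tensorMap (SSet.boundary.{v} n).ι (𝟙 (X.obj (op ⦋n⦌))) ≫
      tensorDesc ((IsPower.stdSimplex X n).homEquiv (𝟙 _)) =
    tensorMap (𝟙 (SSet.boundary.{v} n : SSet.{v})) i ≫
      tensorDesc ((isPowerMatchingObject X n).homEquiv p) := by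
  ext m
  refine tensor_hom_ext fun s => ?_
  have h := isPowerMatchingObject_comp_matchingMap (X := X) n (𝟙 _)
  rw [Category.id_comp, ← hp, IsPower.homEquiv_comp'] at h
  have h' := ConcreteCategory.congr_hom (NatTrans.congr_app h m) s
  simpa using h'.symm

variable {i p} in
/-- The map attaching the new cells to `X`. -/
noncomputable def attachingMap (hp : i ≫ p = matchingMap X n) : cornerDomain X n i ⟶ X :=
  pushout.desc (tensorDesc ((IsPower.stdSimplex X n).homEquiv (𝟙 _)))
    (tensorDesc ((isPowerMatchingObject X n).homEquiv p)) (attachingMap_condition X n hp)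

/-- The summands of `cornerDomain X n i` indexed by the simplices of `Δ[n]`. -/
noncomputable def cornerInl {m : SimplexCategoryᵒᵖ} (s : (Δ[n] : SSet.{v}).obj m) :
    X.obj (op ⦋n⦌) ⟶ (cornerDomain X n i).obj m :=
  tensorι Δ[n] _ s ≫ (pushout.inl _ _ : _ ⟶ cornerDomain X n i).app m

/-- The summands of `cornerDomain X n i` indexed by the simplices of `∂Δ[n]`. -/
noncomputable def cornerInr {m : SimplexCategoryᵒᵖ}
    (s : (SSet.boundary.{v} n : SSet.{v}).obj m) : B ⟶ (cornerDomain X n i).obj m :=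
  tensorι _ B s ≫ (pushout.inr _ _ : _ ⟶ cornerDomain X n i).app m

lemma cornerInl_eq {m : SimplexCategoryᵒᵖ} (s : (SSet.boundary.{v} n : SSet.{v}).obj m) :
    cornerInl X n i s.1 = i ≫ cornerInr X n i s := by
  have := tensorι _ _ s ≫= NatTrans.congr_app (pushout.condition
    (f := tensorMap (SSet.boundary.{v} n).ι (𝟙 (X.obj (op ⦋n⦌))))
    (g := tensorMap (𝟙 (SSet.boundary.{v} n : SSet.{v})) i)) m
  simpa [cornerInl, cornerInr] using this

variable {X n i} in
lemma cornerDomain_hom_ext {m : SimplexCategoryᵒᵖ} {Z : D}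
    {f g : (cornerDomain X n i).obj m ⟶ Z}
    (h₁ : ∀ s, cornerInl X n i s ≫ f = cornerInl X n i s ≫ g)
    (h₂ : ∀ s, cornerInr X n i s ≫ f = cornerInr X n i s ≫ g) : f = g := by
  apply ((IsPushout.of_hasPushout
    (tensorMap (SSet.boundary.{v} n).ι (𝟙 (X.obj (op ⦋n⦌))))
    (tensorMap (𝟙 (SSet.boundary.{v} n : SSet.{v})) i)).map
      ((evaluation SimplexCategoryᵒᵖ D).obj m)).hom_ext
  · refine tensor_hom_ext fun s => ?_
    simpa [cornerInl] using h₁ s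
  · refine tensor_hom_ext fun s => ?_
    simpa [cornerInr] using h₂ s

@[simp]
lemma cornerInl_corner {m : SimplexCategoryᵒᵖ} (s : (Δ[n] : SSet.{v}).obj m) :
    cornerInl X n i s ≫ (corner X n i).app m = i ≫ tensorι Δ[n] B s := by
  have := tensorι _ _ s ≫= NatTrans.congr_app (pushout.inl_desc _ _ (corner_condition X n i)) m
  simpa [cornerInl, corner] using this

@[simp]
lemma cornerInr_corner {m : SimplexCategoryᵒᵖ} (s : (SSet.boundary.{v} n : SSet.{v}).obj m) :
    cornerInr X n i s ≫ (corner X n i).app m = tensorι Δ[n] B s.1 := by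
  have := tensorι _ _ s ≫= NatTrans.congr_app (pushout.inr_desc _ _ (corner_condition X n i)) m
  simpa [cornerInr, corner] using this

variable {i p} in
@[simp]
lemma cornerInl_attachingMap (hp : i ≫ p = matchingMap X n) {m : SimplexCategoryᵒᵖ}
    (s : (Δ[n] : SSet.{v}).obj m) :
    cornerInl X n i s ≫ (attachingMap X n hp).app m =
      X.map (SSet.stdSimplex.objEquiv s).op := by
  have := tensorι _ _ s ≫= NatTrans.congr_app
    (pushout.inl_desc _ _ (attachingMap_condition X n hp)) m
  refine (Category.assoc _ _ _).trans (this.trans ((tensorι_tensorDesc_app _ s).trans ?_))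
  exact Category.id_comp _

variable {i p} in
@[simp]
lemma cornerInr_attachingMap (hp : i ≫ p = matchingMap X n) {m : SimplexCategoryᵒᵖ}
    (s : (SSet.boundary.{v} n : SSet.{v}).obj m) :
    cornerInr X n i s ≫ (attachingMap X n hp).app m =
      p ≫ matchingπ X n s := by
  have := tensorι _ _ s ≫= NatTrans.congr_app
    (pushout.inr_desc _ _ (attachingMap_condition X n hp)) m
  exact (Category.assoc _ _ _).trans (this.trans (tensorι_tensorDesc_app _ s))

/-- In degree `m` the corner map is `i` on the summands of non-boundary simplices, while on boundary
simplices `B` is already present in the domain. Thus `hq` is vacuous when `m` is smaller than `n`.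
-/
lemma corner_app_hasLiftingProperty (m : SimplexCategoryᵒᵖ) {Y Z : D} (q : Y ⟶ Z)
    (hq : ∀ s : (Δ[n] : SSet.{v}).obj m, s ∉ (SSet.boundary.{v} n).obj m →
      HasLiftingProperty i q) : HasLiftingProperty ((corner X n i).app m) q := by
  refine ⟨fun {f g} sq => ?_⟩
  have sq' (s : (Δ[n] : SSet.{v}).obj m) :
      CommSq (cornerInl X n i s ≫ f) i q (tensorι Δ[n] B s ≫ g) := ⟨by
    rw [Category.assoc, sq.w, ← Category.assoc, cornerInl_corner, Category.assoc]⟩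
  have hl (s : (Δ[n] : SSet.{v}).obj m) : ∃ l : B ⟶ Y, i ≫ l = cornerInl X n i s ≫ f ∧
      l ≫ q = tensorι Δ[n] B s ≫ g ∧
      ∀ t : (SSet.boundary.{v} n : SSet.{v}).obj m, t.1 = s → l = cornerInr X n i t ≫ f := by
    by_cases hs : ∃ t : (SSet.boundary.{v} n : SSet.{v}).obj m, t.1 = s
    · obtain ⟨t, rfl⟩ := hs
      refine ⟨cornerInr X n i t ≫ f, ?_, ?_, fun t' ht => by rw [Subtype.ext ht]⟩
      · rw [← Category.assoc, ← cornerInl_eq]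
      · rw [Category.assoc, sq.w, ← Category.assoc, cornerInr_corner]
    · have := hq s fun h => hs ⟨⟨s, h⟩, rfl⟩
      exact ⟨(sq' s).lift, (sq' s).fac_left, (sq' s).fac_right, fun t h => (hs ⟨t, h⟩).elim⟩
  choose l hl₁ hl₂ hl₃ using hl
  refine ⟨⟨⟨tensorObjDesc l, ?_, ?_⟩⟩⟩
  · refine cornerDomain_hom_ext (fun s => ?_) (fun s => ?_)
    · rw [← Category.assoc, cornerInl_corner, Category.assoc, tensorι_tensorObjDesc, hl₁]
    · rw [← Category.assoc, cornerInr_corner, tensorι_tensorObjDesc, hl₃ s.1 s rfl]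
  · refine tensor_hom_ext fun s => ?_
    rw [tensorι_tensorObjDesc_assoc, hl₂]

end Step

section Attach

variable {D : Type u} [Category.{v} D] [HasColimits D] [HasLimits D]
  (X : SimplicialObject D) (n : ℕ) {B : D} {i : X.obj (op ⦋n⦌) ⟶ B} {p : B ⟶ matchingObject X n}
  (hp : i ≫ p = matchingMap X n)

/-- The simplicial object obtained from `X` by replacing `X_n` with `B`. -/
noncomputable abbrev attach : SimplicialObject D := pushout (attachingMap X n hp) (corner X n i)

/-- The inclusion of `X`. -/
noncomputable abbrev attachInl : X ⟶ attach X n hp := pushout.inl _ _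

/-- The characteristic map of the new cells. -/
noncomputable abbrev attachInr : tensor Δ[n] B ⟶ attach X n hp := pushout.inr _ _

lemma attach_isPushout (m : SimplexCategoryᵒᵖ) :
    IsPushout ((attachingMap X n hp).app m) ((corner X n i).app m)
      ((attachInl X n hp).app m) ((attachInr X n hp).app m) :=
  (IsPushout.of_hasPushout (attachingMap X n hp) (corner X n i)).map
    ((evaluation SimplexCategoryᵒᵖ D).obj m)

lemma attachInl_app_hasLiftingProperty (m : SimplexCategoryᵒᵖ) {Y Z : D} (q : Y ⟶ Z)
    (hq : ∀ s : (Δ[n] : SSet.{v}).obj m, s ∉ (SSet.boundary.{v} n).obj m →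
      HasLiftingProperty i q) : HasLiftingProperty ((attachInl X n hp).app m) q :=
  haveI := corner_app_hasLiftingProperty X n i m q hq
  (attach_isPushout X n hp m).hasLiftingProperty q

lemma isIso_of_hasLiftingProperty_self {A A' : D} (f : A ⟶ A') [HasLiftingProperty f f] :
    IsIso f :=
  have sq : CommSq (𝟙 A) f f (𝟙 A') := ⟨by simp⟩
  ⟨sq.lift, sq.fac_left, sq.fac_right⟩

/-- Below dimension `n` every simplex of Δ[n] lies in the boundary, so the map lifts against
everything, in particular against itself. -/
lemma isIso_attachInl_app (m : ℕ) (hm : m < n) : IsIso ((attachInl X n hp).app (op ⦋m⦌)) := by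
  have := attachInl_app_hasLiftingProperty X n hp (op ⦋m⦌) ((attachInl X n hp).app (op ⦋m⦌))
    (fun s hs => by
      exfalso
      refine hs fun hs' => ?_
      have := Fintype.card_le_of_surjective _ hs'
      simp at this
      lia)
  exact isIso_of_hasLiftingProperty_self _

/-- The inclusion of the new `n`-simplices. -/
noncomputable def attachCell : B ⟶ (attach X n hp).obj (op ⦋n⦌) :=
  tensorι Δ[n] B (SSet.stdSimplex.objEquiv.symm (𝟙 ⦋n⦌)) ≫ (attachInr X n hp).app _

lemma eq_id_of_notMem_boundary (s : (Δ[n] : SSet.{v}).obj (op ⦋n⦌))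
    (hs : s ∉ (SSet.boundary.{v} n).obj (op ⦋n⦌)) :
    s = SSet.stdSimplex.objEquiv.symm (𝟙 ⦋n⦌) := by
  obtain ⟨f, rfl⟩ := SSet.stdSimplex.objEquiv.symm.surjective s
  have : Epi f := SimplexCategory.epi_iff_surjective.2 (not_not.1 hs)
  rw [SimplexCategory.eq_id_of_epi f]

lemma id_notMem_boundary :
    (SSet.stdSimplex.objEquiv.symm (𝟙 ⦋n⦌) : (Δ[n] : SSet.{v}).obj (op ⦋n⦌)) ∉
      (SSet.boundary.{v} n).obj (op ⦋n⦌) :=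
  fun h => h fun a => ⟨a, rfl⟩

lemma comp_attachCell : i ≫ attachCell X n hp = (attachInl X n hp).app (op ⦋n⦌) := by
  have := cornerInl X n i (SSet.stdSimplex.objEquiv.symm (𝟙 ⦋n⦌)) ≫= (attach_isPushout X n hp _).w
  rw [← Category.assoc, ← Category.assoc, cornerInl_corner, cornerInl_attachingMap,
    Equiv.apply_symm_apply, op_id, X.map_id, Category.id_comp, Category.assoc] at this
  exact this.symm

lemma boundary_comp_attachInr (m : SimplexCategoryᵒᵖ)
    (s : (SSet.boundary.{v} n : SSet.{v}).obj m) :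
    tensorι Δ[n] B s.1 ≫ (attachInr X n hp).app m =
      p ≫ matchingπ X n s ≫ (attachInl X n hp).app m := by
  have := cornerInr X n i s ≫= (attach_isPushout X n hp _).w
  rw [← Category.assoc, ← Category.assoc, cornerInr_corner, cornerInr_attachingMap,
    Category.assoc] at this
  exact this.symm

instance isIso_attachCell : IsIso (attachCell X n hp) := by
  -- The only `n`-simplex outside the boundary is the identity. The inverse is the identity of `B`
  -- on that summand, and is forced through `p` and `i` on all the others.
  have hl (s : (Δ[n] : SSet.{v}).obj (op ⦋n⦌)) : ∃ l : B ⟶ B,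
      (∀ t : (SSet.boundary.{v} n : SSet.{v}).obj (op ⦋n⦌), t.1 = s →
        l = p ≫ matchingπ X n t ≫ i) ∧
      (s = SSet.stdSimplex.objEquiv.symm (𝟙 ⦋n⦌) → l = 𝟙 B) := by
    by_cases hs : ∃ t : (SSet.boundary.{v} n : SSet.{v}).obj (op ⦋n⦌), t.1 = s
    · obtain ⟨t, rfl⟩ := hs
      exact ⟨_, fun t' ht => by rw [Subtype.ext ht], fun h => (id_notMem_boundary n (h ▸ t.2)).elim⟩
    · exact ⟨𝟙 B, fun t h => (hs ⟨t, h⟩).elim, fun _ => rfl⟩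
  choose l hl₁ hl₂ using hl
  have hcases (s : (Δ[n] : SSet.{v}).obj (op ⦋n⦌)) :
      (∃ t : (SSet.boundary.{v} n : SSet.{v}).obj (op ⦋n⦌), t.1 = s) ∨
        s = SSet.stdSimplex.objEquiv.symm (𝟙 ⦋n⦌) := by
    by_cases hs : s ∈ (SSet.boundary.{v} n).obj (op ⦋n⦌)
    · exact Or.inl ⟨⟨s, hs⟩, rfl⟩
    · exact Or.inr (eq_id_of_notMem_boundary n s hs)
  have hw : (attachingMap X n hp).app (op ⦋n⦌) ≫ i =
      (corner X n i).app (op ⦋n⦌) ≫ tensorObjDesc l := by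
    refine cornerDomain_hom_ext (fun s => ?_) (fun s => ?_)
    · rw [← Category.assoc, ← Category.assoc, cornerInl_corner, cornerInl_attachingMap,
        Category.assoc, tensorι_tensorObjDesc]
      obtain ⟨t, rfl⟩ | rfl := hcases s
      · rw [hl₁ _ t rfl, ← Category.assoc, hp, ← Category.assoc, matchingMap_π]
      · rw [hl₂ _ rfl]
        simp
    · rw [← Category.assoc, ← Category.assoc, cornerInr_corner, cornerInr_attachingMap,
        tensorι_tensorObjDesc, hl₁ s.1 s rfl, Category.assoc]
  refine ⟨(attach_isPushout X n hp _).desc i (tensorObjDesc l) hw, ?_, ?_⟩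
  · rw [attachCell, Category.assoc, IsPushout.inr_desc, tensorι_tensorObjDesc, hl₂ _ rfl]
  · apply (attach_isPushout X n hp _).hom_ext
    · rw [IsPushout.inl_desc_assoc, comp_attachCell, Category.comp_id]
    · rw [IsPushout.inr_desc_assoc, Category.comp_id]
      refine tensor_hom_ext fun s => ?_
      rw [tensorι_tensorObjDesc_assoc]
      obtain ⟨t, rfl⟩ | rfl := hcases s
      · rw [hl₁ _ t rfl, Category.assoc, Category.assoc, comp_attachCell,
          boundary_comp_attachInr X n hp _ t]
      · rw [hl₂ _ rfl]
        exact Category.id_comp _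

end Attach

end Hovey

/-! ### Boundaries see only lower-dimensional simplices -/

namespace SSet

lemma boundary_hom_bijective {Y Y' : SSet.{v}} (g : Y ⟶ Y') (n : ℕ)
    (hg : ∀ m, m < n → IsIso (g.app (op ⦋m⦌))) :
    Function.Bijective (fun φ : (SSet.boundary.{v} n : SSet.{v}) ⟶ Y => φ ≫ g) := by
  refine boundary_induction n (fun K => Function.Bijective (fun φ : K ⟶ Y => φ ≫ g)) ?_ ?_ ?_
  · exact fun K hK => ⟨fun _ _ _ => hK.hom_ext _ _, fun φ => ⟨hK.to _, hK.hom_ext _ _⟩⟩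
  · intro K m hm e
    have := hg m hm
    have h := (isIso_iff_bijective (g.app (op ⦋m⦌))).1 inferInstance
    refine ⟨fun φ ψ hφ => ?_, fun φ => ?_⟩
    · rw [← cancel_epi e.hom]
      apply yonedaEquiv.injective
      apply h.1
      have := congrArg (fun t => yonedaEquiv (e.hom ≫ t)) hφ
      exact this
    · obtain ⟨y, hy⟩ := h.2 (yonedaEquiv (e.hom ≫ φ))
      refine ⟨e.inv ≫ yonedaEquiv.symm y, ?_⟩
      dsimp
      rw [Category.assoc, e.inv_comp_eq]
      apply yonedaEquiv.injective
      rw [← hy]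
      exact congrArg (g.app (op ⦋m⦌)) (yonedaEquiv.apply_symm_apply y)
  · intro K₁ K₂ K₃ K₄ t l r b sq _ _ h₁ h₂ h₃
    refine ⟨fun φ ψ hφ => ?_, fun φ => ?_⟩
    · apply sq.hom_ext
      · apply h₂.1
        have := r ≫= hφ
        simpa using this
      · apply h₃.1
        have := b ≫= hφ
        simpa using this
    · obtain ⟨y₂, hy₂⟩ := h₂.2 (r ≫ φ)
      obtain ⟨y₃, hy₃⟩ := h₃.2 (b ≫ φ)
      dsimp at hy₂ hy₃
      refine ⟨sq.desc y₂ y₃ (h₁.1 ?_), ?_⟩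
      · simp [hy₂, hy₃, sq.w_assoc]
      · apply sq.hom_ext
        · simpa using hy₂
        · simpa using hy₃

end SSet

/-! ### Matching maps of the replacement and existence of simplicial resolutions -/

namespace Hovey

section

variable {D : Type u} [Category.{v} D]

/-- The map `D(A, X_•) ⟶ D(A, Y_•)` induced by `X ⟶ Y`. -/
abbrev simplicialHomPostcomp {X Y : SimplicialObject D} (x : X ⟶ Y) (A : D) :
    (simplicialHom X).obj (op A) ⟶ (simplicialHom Y).obj (op A) :=
  Functor.whiskerRight x (coyoneda.obj (op A))

variable [HasLimits D]

/-- The map of matching objects induced by `X ⟶ Y`. -/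
noncomputable def matchingObjectMap {X Y : SimplicialObject D} (x : X ⟶ Y) (n : ℕ) :
    matchingObject X n ⟶ matchingObject Y n :=
  (isPowerMatchingObject Y n).homEquiv.symm
    (((isPowerMatchingObject X n).homEquiv (𝟙 _) : (SSet.boundary.{v} n : SSet.{v}) ⟶
      (simplicialHom X).obj (op _)) ≫ simplicialHomPostcomp x _)

lemma homEquiv_comp_matchingObjectMap {X Y : SimplicialObject D} (x : X ⟶ Y) (n : ℕ) {A : D}
    (f : A ⟶ matchingObject X n) :
    (isPowerMatchingObject Y n).homEquiv (f ≫ matchingObjectMap x n) =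
      ((isPowerMatchingObject X n).homEquiv f : (SSet.boundary.{v} n : SSet.{v}) ⟶
        (simplicialHom X).obj (op A)) ≫ simplicialHomPostcomp x A := by
  rw [matchingObjectMap, IsPower.homEquiv_symm_comp, Equiv.apply_symm_apply]
  conv_rhs => rw [← Category.comp_id f, IsPower.homEquiv_comp']
  refine NatTrans.ext (funext fun m => ?_)
  ext s
  exact (Category.assoc _ _ _).symm

lemma matchingMap_naturality {X Y : SimplicialObject D} (x : X ⟶ Y) (n : ℕ) :
    matchingMap X n ≫ matchingObjectMap x n = x.app (op ⦋n⦌) ≫ matchingMap Y n := by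
  apply (isPowerMatchingObject Y n).homEquiv.injective
  have h := isPowerMatchingObject_comp_matchingMap (X := X) n (𝟙 _)
  rw [Category.id_comp] at h
  rw [homEquiv_comp_matchingObjectMap, isPowerMatchingObject_comp_matchingMap, h]
  refine NatTrans.ext (funext fun m => ?_)
  ext s
  change (𝟙 _ ≫ X.map (SSet.stdSimplex.objEquiv s.1).op) ≫ x.app m =
    x.app _ ≫ Y.map (SSet.stdSimplex.objEquiv s.1).op
  rw [Category.id_comp, x.naturality]

lemma isIso_matchingObjectMap {X Y : SimplicialObject D} (x : X ⟶ Y) (n : ℕ)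
    (hx : ∀ m, m < n → IsIso (x.app (op ⦋m⦌))) : IsIso (matchingObjectMap x n) := by
  rw [isIso_iff_yoneda_map_bijective]
  intro A
  have h := SSet.boundary_hom_bijective (simplicialHomPostcomp x A) n (fun m hm => by
    have := hx m hm
    exact inferInstanceAs (IsIso ((coyoneda.obj (op A)).map (x.app (op ⦋m⦌)))))
  have h' := (((isPowerMatchingObject Y n).homEquiv (X := A)).symm.bijective.comp h).comp
    ((isPowerMatchingObject X n).homEquiv (X := A)).bijective
  convert h' using 1
  ext f
  apply (isPowerMatchingObject Y n).homEquiv.injective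
  rw [homEquiv_comp_matchingObjectMap]
  simp

variable [ModelCategory D]

lemma fibration_matchingMap_of_isIso {X Y : SimplicialObject D} (x : X ⟶ Y) (n : ℕ)
    (hx : ∀ m, m ≤ n → IsIso (x.app (op ⦋m⦌))) (h : Fibration (matchingMap X n)) :
    Fibration (matchingMap Y n) := by
  have := isIso_matchingObjectMap x n (fun m hm => hx m hm.le)
  have := hx n le_rfl
  have h' := (matchingMap_naturality x n).symm
  rw [← IsIso.eq_inv_comp] at h'
  rw [h']
  infer_instance

variable [HasColimits D]

/-- This identifies the new `n`-th matching map with `p`, up to the isomorphisms `attachCell` and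
`matchingObjectMap`. Choosing `p` to be a fibration therefore repairs degree `n`. -/
lemma attachCell_matchingMap (X : SimplicialObject D) (n : ℕ) {B : D}
    {i : X.obj (op ⦋n⦌) ⟶ B} {p : B ⟶ matchingObject X n} (hp : i ≫ p = matchingMap X n) :
    attachCell X n hp ≫ matchingMap (attach X n hp) n =
      p ≫ matchingObjectMap (attachInl X n hp) n := by
  apply (isPowerMatchingObject _ n).homEquiv.injective
  rw [homEquiv_comp_matchingObjectMap, isPowerMatchingObject_comp_matchingMap]
  refine NatTrans.ext (funext fun m => ?_)
  ext s
  have h := boundary_comp_attachInr X n hp m s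
  refine Eq.trans (?_ : attachCell X n hp ≫
    (attach X n hp).map (SSet.stdSimplex.objEquiv s.1).op = _)
    (h.trans (Category.assoc _ _ _).symm)
  rw [attachCell, Category.assoc, ← NatTrans.naturality, tensorι_map_assoc]
  congr 2
  apply (SSet.stdSimplex.objEquiv (n := ⦋n⦌) (m := m)).injective
  exact Category.comp_id (SSet.stdSimplex.objEquiv s.1)

/-- Replacing `X_n` so that the `n`-th matching map becomes a fibration. -/
lemma exists_fibration_matchingMap (X : SimplicialObject D) (n : ℕ) :
    ∃ (Y : SimplicialObject D) (x : X ⟶ Y), (∀ m, WeakEquivalence (x.app m)) ∧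
      (∀ m, m < n → IsIso (x.app (op ⦋m⦌))) ∧ Fibration (matchingMap Y n) := by
  let h := MorphismProperty.factorizationData (trivialCofibrations D) (fibrations D)
    (matchingMap X n)
  refine ⟨attach X n h.fac, attachInl X n h.fac, fun m => ?_, fun m hm => ?_, ?_⟩
  · have key : (fibrations D).llp ((attachInl X n h.fac).app m) := by
      intro Y Z q hq
      have : Fibration q := ⟨hq⟩
      have : Cofibration h.i := ⟨h.hi.1⟩
      have : WeakEquivalence h.i := ⟨h.hi.2⟩
      exact attachInl_app_hasLiftingProperty X n h.fac m q fun _ _ => inferInstance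
    rw [fibrations_llp] at key
    exact ⟨key.2⟩
  · exact isIso_attachInl_app X n h.fac m hm
  · have := isIso_matchingObjectMap (attachInl X n h.fac) n (isIso_attachInl_app X n h.fac)
    have h' := attachCell_matchingMap X n h.fac
    rw [← IsIso.eq_inv_comp] at h'
    have : Fibration h.p := ⟨h.hp⟩
    rw [h']
    infer_instance

/-- Successive stages in the construction of a Reedy fibrant replacement. -/
noncomputable def reedyStage (X : SimplicialObject D) (n : ℕ) : SimplicialObject D :=
  match n with
  | 0 => X
  | n + 1 => (exists_fibration_matchingMap (reedyStage X n) n).choose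

/-- The transition maps between the stages. -/
noncomputable def reedyStep (X : SimplicialObject D) (n : ℕ) :
    reedyStage X n ⟶ reedyStage X (n + 1) :=
  (exists_fibration_matchingMap (reedyStage X n) n).choose_spec.choose

lemma weakEquivalence_reedyStep (X : SimplicialObject D) (n : ℕ) (m : SimplexCategoryᵒᵖ) :
    WeakEquivalence ((reedyStep X n).app m) :=
  (exists_fibration_matchingMap (reedyStage X n) n).choose_spec.choose_spec.1 m

lemma isIso_reedyStep (X : SimplicialObject D) (n m : ℕ) (h : m < n) :
    IsIso ((reedyStep X n).app (op ⦋m⦌)) :=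
  (exists_fibration_matchingMap (reedyStage X n) n).choose_spec.choose_spec.2.1 m h

lemma fibration_matchingMap_reedyStage (X : SimplicialObject D) (n : ℕ) :
    Fibration (matchingMap (reedyStage X (n + 1)) n) :=
  (exists_fibration_matchingMap (reedyStage X n) n).choose_spec.choose_spec.2.2

/-- The sequence of the stages. -/
noncomputable def reedySequence (X : SimplicialObject D) : ℕ ⥤ SimplicialObject D :=
  Functor.ofSequence (reedyStep X)

lemma isIso_reedySequence_map (X : SimplicialObject D) {m a b : ℕ} (φ : a ⟶ b) (h : m < a) :
    IsIso (((reedySequence X).map φ).app (op ⦋m⦌)) :=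
  Functor.ofSequence_map_mem (reedyStep X)
    ((MorphismProperty.isomorphisms D).inverseImage ((evaluation _ _).obj (op ⦋m⦌))) a
    (fun n hn => isIso_reedyStep X n m (by lia)) a b le_rfl φ

lemma weakEquivalence_reedySequence_map (X : SimplicialObject D) {m : SimplexCategoryᵒᵖ} {a b : ℕ}
    (φ : a ⟶ b) : WeakEquivalence (((reedySequence X).map φ).app m) :=
  have h := Functor.ofSequence_map_mem (reedyStep X)
    ((weakEquivalences D).inverseImage ((evaluation _ _).obj m)) a
    (fun n _ => (weakEquivalence_reedyStep X n m).1) a b le_rfl φ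
  ⟨h⟩

/-- Step `n` does not change degrees below `n`, so degree `m` is constant from stage `m + 1` on. The
colimit thus inherits the fibration condition in each degree from a finite stage. -/
lemma isIso_reedySequence_ι (X : SimplicialObject D) {m a : ℕ} (h : m < a) :
    IsIso ((colimit.ι (reedySequence X) a).app (op ⦋m⦌)) := by
  have hF : (reedySequence X ⋙ (evaluation _ _).obj (op ⦋m⦌)).IsEventuallyConstantFrom a :=
    fun b φ => isIso_reedySequence_map X φ h
  exact hF.isIso_ι_of_isColimit (isColimitOfPreserves ((evaluation _ _).obj (op ⦋m⦌))
    (colimit.isColimit (reedySequence X)))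

/-- Simplicial resolutions exist. -/
theorem nonempty_simplicialResolution (W : D) : Nonempty (SimplicialResolution W) := by
  let X := (SimplicialObject.const D).obj W
  refine ⟨⟨colimit (reedySequence X), colimit.ι (reedySequence X) 0, fun m => ?_, fun n => ?_⟩⟩
  · obtain ⟨⟨m⟩⟩ := m
    have := isIso_reedySequence_ι X (show m < m + 1 by lia)
    have h₂ := NatTrans.congr_app
      (colimit.w (reedySequence X) (homOfLE (show 0 ≤ m + 1 by lia))) (op ⦋m⦌)
    have h₃ := weakEquivalence_reedySequence_map X (m := op ⦋m⦌)
      (homOfLE (show 0 ≤ m + 1 by lia))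
    rw [NatTrans.comp_app] at h₂
    have : WeakEquivalence ((colimit.ι (reedySequence X) 0).app (op ⦋m⦌)) := by
      rw [← h₂]
      infer_instance
    exact this.1
  · exact (fibration_matchingMap_of_isIso (colimit.ι (reedySequence X) (n + 1)) n
      (fun m hm => isIso_reedySequence_ι X (by lia)) (fibration_matchingMap_reedyStage X n)).1

end

end Hovey

/-! ### Map equivalences for an abstract localization functor -/

namespace Hovey

variable {D : Type u} [Category.{v} D] [ModelCategory D] [HasLimits D] [HasColimits D]

/-- A localization functor `Q` with unit `η` and class of local objects `S`. -/
structure IsLocalization (Q : D ⥤ D) (η : 𝟭 D ⟶ Q) (S : ObjectProperty D) : Prop where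
  isFibrant : ∀ ⦃W : D⦄, S W → IsFibrant W
  weakEquivalence_unit : ∀ ⦃W : D⦄, S W → WeakEquivalence (η.app W)
  obj_mem : ∀ W : D, S (Q.obj W)
  weakEquivalence_map : ∀ ⦃A B : D⦄ (f : A ⟶ B), WeakEquivalence f → WeakEquivalence (Q.map f)
  weakEquivalence_map_unit : ∀ A : D, WeakEquivalence (Q.map (η.app A))
  of_weakEquivalence : ∀ ⦃W W' : D⦄ (f : W ⟶ W'), WeakEquivalence f → IsFibrant W' → S W → S W'
  of_iso : S.IsClosedUnderIsomorphisms
  terminal_mem : S (⊤_ D)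
  pullback_mem : ∀ ⦃P₁ P₂ P₃ : D⦄ (p : P₂ ⟶ P₁) (q : P₃ ⟶ P₁), Fibration p → Fibration q →
      S P₁ → S P₂ → S P₃ → S (pullback p q)

namespace IsLocalization

variable {Q : D ⥤ D} {η : 𝟭 D ⟶ Q} {S : ObjectProperty D} (h : IsLocalization Q η S)

include h

lemma simplicialResolution_mem {W : D} (hW : S W) (W' : SimplicialResolution W) (n : ℕ) :
    S (W'.obj.obj (op ⦋n⦌)) :=
  h.of_weakEquivalence (W'.ι.app (op ⦋n⦌)) ⟨W'.weakEquivalence_ι _⟩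
    (W'.isReedyFibrant.isFibrant_obj n) hW

/-- The matching maps are fibrations between local objects, and these have the right lifting
property against cofibrations inverted by `Q`. -/
lemma simplicialHom_map_mem_rlp {X : SimplicialObject D} (hX : IsReedyFibrant X)
    (hX' : ∀ n, S (X.obj (op ⦋n⦌))) {A B : D} (i : A ⟶ B) [Cofibration i]
    [WeakEquivalence (Q.map i)] :
    SSet.modelCategoryQuillen.I.rlp ((simplicialHom X).map i.op) := by
  refine simplicialHom_map_mem_rlp_of_hasLiftingProperty i fun n => ?_
  have := h.of_iso
  have hM := hX.matchingObject_mem S h.terminal_mem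
    (fun p q hp hq => h.pullback_mem p q hp hq) hX' n
  have : Fibration (matchingMap X n) := ⟨hX n⟩
  have := h.isFibrant hM
  have := h.isFibrant (h.obj_mem (matchingObject X n))
  have := h.weakEquivalence_unit hM
  have := h.weakEquivalence_unit (hX' n)
  exact hasLiftingProperty_of_map_weakEquivalence Q η i (matchingMap X n)

/-- In a Brown factorization `f = b.i ≫ b.p`, the maps `b.i` and `b.s` are cofibrations inverted by
`Q`, so both induce trivial Kan fibrations; `b.p` induces a section of the one coming from `b.s`. -/
lemma isWeakEquivalence_simplicialHom_map {X : SimplicialObject D} (hX : IsReedyFibrant X)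
    (hX' : ∀ n, S (X.obj (op ⦋n⦌))) {A B : D} (f : A ⟶ B) [IsCofibrant A] [IsCofibrant B]
    [WeakEquivalence (Q.map f)] :
    SSet.IsWeakEquivalence ((simplicialHom X).map f.op) := by
  obtain ⟨b⟩ : Nonempty (CofibrantBrownFactorization f) := inferInstance
  have hp : WeakEquivalence (Q.map b.p) := h.weakEquivalence_map _ inferInstance
  have hs : WeakEquivalence (Q.map b.s) := h.weakEquivalence_map _ inferInstance
  have hi : WeakEquivalence (Q.map b.i) :=
    weakEquivalence_of_postcomp_of_fac (g := Q.map b.p) (fg := Q.map f)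
      (by rw [← Q.map_comp, b.fac])
  have := SSet.isWeakEquivalence_of_section_comp (σ := (simplicialHom X).map b.p.op)
    (r := (simplicialHom X).map b.s.op) (t := (simplicialHom X).map b.i.op)
    (by rw [← Functor.map_comp, ← op_comp, b.s_p, op_id, CategoryTheory.Functor.map_id])
    (h.simplicialHom_map_mem_rlp hX hX' b.s) (h.simplicialHom_map_mem_rlp hX hX' b.i)
  rwa [← Functor.map_comp, ← op_comp, b.fac] at this

lemma isMapEquivalence {A B : D} (f : A ⟶ B) [WeakEquivalence (Q.map f)] {W : D} (hW : S W) :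
    IsMapEquivalence f W := by
  intro f' W'
  have h₁ : WeakEquivalence (Q.map f'.pSrc) :=
    h.weakEquivalence_map _ ⟨f'.trivialFibration_pSrc.2⟩
  have h₂ : WeakEquivalence (Q.map f'.pTgt) :=
    h.weakEquivalence_map _ ⟨f'.trivialFibration_pTgt.2⟩
  have h₃ : WeakEquivalence (Q.map f'.map) :=
    weakEquivalence_of_postcomp_of_fac (g := Q.map f'.pTgt) (fg := Q.map f'.pSrc ≫ Q.map f)
      (by rw [← Q.map_comp, ← Q.map_comp, f'.comm])
  have := f'.cofibrant_src
  have := f'.cofibrant_tgt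
  exact h.isWeakEquivalence_simplicialHom_map W'.isReedyFibrant (h.simplicialResolution_mem hW W')
    f'.map

lemma weakEquivalence_resolution_map {W : D} (W' : SimplicialResolution W)
    {m m' : SimplexCategoryᵒᵖ} (α : m ⟶ m') : WeakEquivalence (Q.map (W'.obj.map α)) := by
  refine h.weakEquivalence_map _ ?_
  have h₁ : WeakEquivalence (W'.ι.app m) := ⟨W'.weakEquivalence_ι m⟩
  have h₂ : WeakEquivalence (W'.ι.app m') := ⟨W'.weakEquivalence_ι m'⟩
  exact weakEquivalence_of_precomp_of_fac (f := W'.ι.app m) (fg := W'.ι.app m')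
    ((W'.ι.naturality α).symm.trans (Category.id_comp _))

/-- The map classifying the simplices of `D(A, W_•)` that are `Q`-equivalences. -/
noncomputable def classifier {W : D} (W' : SimplicialResolution W) (A : D) :
    (simplicialHom W'.obj).obj (op A) ⟶ SSet.discrete (ULift.{v} Prop) where
  app m := ↾fun f : A ⟶ W'.obj.obj m => ULift.up (WeakEquivalence (Q.map f))
  naturality m m' α := by
    ext f
    have := h.weakEquivalence_resolution_map W' α
    refine congrArg ULift.up (propext ?_)
    change WeakEquivalence (Q.map ((f : A ⟶ W'.obj.obj m) ≫ W'.obj.map α)) ↔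
      WeakEquivalence (Q.map (f : A ⟶ W'.obj.obj m))
    rw [Q.map_comp]
    exact ⟨fun _ => weakEquivalence_of_postcomp _ (Q.map (W'.obj.map α)), fun _ => inferInstance⟩

/-- If no such `r` existed, the classifier of `Q`-equivalences and the constant map False would
agree after restriction to maps out of `B`. By injectivity they would agree on maps out of `A`,
contradicting that the unit of `A` is a `Q`-equivalence. -/
lemma exists_weakEquivalence_map_comp {A B : D} (f : A ⟶ B) (W' : SimplicialResolution (Q.obj A))
    (hf : Function.Bijective
      (fun φ : (simplicialHom W'.obj).obj (op A) ⟶ SSet.discrete (ULift.{v} Prop) =>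
        (simplicialHom W'.obj).map f.op ≫ φ)) :
    ∃ r : B ⟶ W'.obj.obj (op ⦋0⦌), WeakEquivalence (Q.map (f ≫ r)) := by
  by_contra! hr
  let φ : (simplicialHom W'.obj).obj (op A) ⟶ SSet.discrete (ULift.{v} Prop) :=
    { app := fun _ => ↾fun _ => ULift.up False }
  have key : h.classifier W' A = φ := by
    apply hf.1
    refine NatTrans.ext (funext fun m => ?_)
    ext s
    have hs : ¬ WeakEquivalence (Q.map (f ≫ (s : B ⟶ W'.obj.obj m))) := by
      intro hs
      -- A simplex of any dimension can be replaced by one of its vertices, because `Q` inverts the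
      -- structure maps of the resolution.
      let α : m ⟶ op ⦋0⦌ := (SimplexCategory.const ⦋0⦌ m.unop 0).op
      apply hr ((s : B ⟶ W'.obj.obj m) ≫ W'.obj.map α)
      have := h.weakEquivalence_resolution_map W' α
      rw [← Category.assoc, Q.map_comp]
      infer_instance
    exact congrArg ULift.up (propext ⟨fun h => hs h, False.elim⟩)
  have h₁ : WeakEquivalence (Q.map (η.app A ≫ W'.ι.app (op ⦋0⦌))) := by
    have := h.weakEquivalence_map_unit A
    have := h.weakEquivalence_map (W'.ι.app (op ⦋0⦌)) ⟨W'.weakEquivalence_ι _⟩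
    rw [Q.map_comp]
    exact inferInstance
  let x : A ⟶ W'.obj.obj (op ⦋0⦌) := η.app A ≫ W'.ι.app (op ⦋0⦌)
  have h₂ : ULift.up.{v} (WeakEquivalence (Q.map x)) = ULift.up False :=
    ConcreteCategory.congr_hom (NatTrans.congr_app key (op ⦋0⦌)) x
  exact (congrArg ULift.down h₂).mp h₁

omit h in
lemma exists_cofibrant_replacement (A : D) :
    ∃ (A' : D) (p : A' ⟶ A), IsCofibrant A' ∧ Fibration p ∧ WeakEquivalence p := by
  let F := MorphismProperty.factorizationData (cofibrations D) (trivialFibrations D)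
    (initial.to A)
  have : IsCofibrant (⊥_ D) := (isCofibrant_iff_of_isInitial (𝟙 _) initialIsInitial).2 inferInstance
  have : Cofibration F.i := ⟨F.hi⟩
  exact ⟨F.Z, F.p, isCofibrant_of_cofibration F.i, ⟨F.hp.1⟩, ⟨F.hp.2⟩⟩

lemma weakEquivalence_map_of_isWeakEquivalence {A B : D} (f : A ⟶ B) [IsCofibrant A]
    [IsCofibrant B] (hf : ∀ (W : D), S W → ∀ (W' : SimplicialResolution W),
      SSet.IsWeakEquivalence ((simplicialHom W'.obj).map f.op)) :
    WeakEquivalence (Q.map f) := by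
  obtain ⟨W'⟩ := nonempty_simplicialResolution (Q.obj A)
  obtain ⟨r, hr⟩ := h.exists_weakEquivalence_map_comp f W'
    ((hf _ (h.obj_mem A) W').bijective_discrete _)
  -- The target of `r` need not be cofibrant. Lifting `r` to `T` makes `f ≫ r'` a map between
  -- cofibrant objects, to which the direct implication applies.
  obtain ⟨T, q, _, _, _⟩ := exists_cofibrant_replacement (W'.obj.obj (op ⦋0⦌))
  have sq : CommSq (initial.to T) (initial.to B) q r := ⟨initial.hom_ext _ _⟩
  obtain ⟨r', hr'⟩ : ∃ r' : B ⟶ T, r' ≫ q = r := ⟨sq.lift, sq.fac_right⟩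
  have hq := h.weakEquivalence_map q inferInstance
  have h₁ : WeakEquivalence (Q.map (f ≫ r')) :=
    weakEquivalence_of_postcomp_of_fac (g := Q.map q) (fg := Q.map (f ≫ r))
      (by rw [← Q.map_comp, Category.assoc, hr'])
  obtain ⟨W''⟩ := nonempty_simplicialResolution (Q.obj B)
  have hW'' := h.obj_mem B
  -- Both `f` and `f ≫ r'` induce bijections on maps into discrete sets, hence so does `r'`. The
  -- argument can therefore be repeated with `r'` in place of `f`.
  obtain ⟨r'', hr''⟩ := h.exists_weakEquivalence_map_comp r' W'' (by
    have b₁ := (h.isWeakEquivalence_simplicialHom_map W''.isReedyFibrant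
      (h.simplicialResolution_mem hW'' W'') (f ≫ r')).bijective_discrete (ULift.{v} Prop)
    have b₂ := (hf _ hW'' W'').bijective_discrete (ULift.{v} Prop)
    rw [← Function.Bijective.of_comp_iff _ b₂]
    convert b₁ using 1
    ext1 φ
    simp)
  rw [Q.map_comp] at h₁ hr''
  have h₂ := weakEquivalence_of_two_of_six (Q.map f) (Q.map r') (Q.map r'')
  have h₃ := weakEquivalence_of_postcomp (Q.map r') (Q.map r'')
  exact weakEquivalence_of_postcomp (Q.map f) (Q.map r')

theorem isMapEquivalence_iff {A B : D} (f : A ⟶ B) :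
    (∀ W, S W → IsMapEquivalence f W) ↔ WeakEquivalence (Q.map f) := by
  refine ⟨fun hf => ?_, fun _ W hW => h.isMapEquivalence f hW⟩
  obtain ⟨A', p, _, _, _⟩ := exists_cofibrant_replacement A
  obtain ⟨B', q, _, _, _⟩ := exists_cofibrant_replacement B
  have sq : CommSq (initial.to B') (initial.to A') q (p ≫ f) := ⟨initial.hom_ext _ _⟩
  let f' : CofibrantApproximation f :=
    { src := A'
      tgt := B'
      map := sq.lift
      pSrc := p
      pTgt := q
      cofibrant_src := inferInstance
      cofibrant_tgt := inferInstance
      trivialFibration_pSrc := mem_trivialFibrations p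
      trivialFibration_pTgt := mem_trivialFibrations q
      comm := sq.fac_right }
  have h₁ : WeakEquivalence (Q.map sq.lift) :=
    h.weakEquivalence_map_of_isWeakEquivalence sq.lift (fun W hW W' => hf W hW f' W')
  have h₂ := h.weakEquivalence_map p inferInstance
  have h₃ := h.weakEquivalence_map q inferInstance
  have h₄ : Q.map sq.lift ≫ Q.map q = Q.map p ≫ Q.map f := by
    rw [← Q.map_comp, ← Q.map_comp, sq.fac_right]
  have h₅ : WeakEquivalence (Q.map p ≫ Q.map f) := by
    rw [← h₄]
    infer_instance
  exact weakEquivalence_of_precomp (Q.map p) (Q.map f)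

end IsLocalization

end Hovey

/-! ### The projective model structure on spectra -/

namespace Hovey

namespace Spectrum

variable {C : Type u} [Category.{v} C] {G : C ⥤ C}

section Factorization

variable [HasPushouts C] {X Y : Spectrum G} (f : X ⟶ Y) (V V' : MorphismProperty C)

/-- A factorization of `f` in degree `n`. -/
structure LevelFactorization (n : ℕ) where
  obj : C
  i : X.obj n ⟶ obj
  p : obj ⟶ Y.obj n
  fac : i ≫ p = f.app n

variable {f}

/-- The map `X_{n+1} ⊔_{GX_n} GZ_n ⟶ Y_{n+1}`. -/
noncomputable def LevelFactorization.relativeMap {n : ℕ} (d : LevelFactorization f n) :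
    pushout (X.str n) (G.map d.i) ⟶ Y.obj (n + 1) :=
  pushout.desc (f.app (n + 1)) (G.map d.p ≫ Y.str n) (by
    rw [← Category.assoc, ← G.map_comp, d.fac]
    exact (f.comm n).symm)

variable [MorphismProperty.HasFactorization V V']

/-- A factorization of the relative map. -/
noncomputable def LevelFactorization.data {n : ℕ} (d : LevelFactorization f n) :
    MorphismProperty.MapFactorizationData V V' d.relativeMap :=
  MorphismProperty.factorizationData V V' _

/-- The factorization in the next degree. -/
noncomputable def LevelFactorization.next {n : ℕ} (d : LevelFactorization f n) :
    LevelFactorization f (n + 1) where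
  obj := (d.data V V').Z
  i := pushout.inl _ _ ≫ (d.data V V').i
  p := (d.data V V').p
  fac := by
    rw [Category.assoc, (d.data V V').fac]
    exact pushout.inl_desc _ _ _

variable (f)

/-- The inductive construction of a factorization. -/
noncomputable def levelFactorization (n : ℕ) : LevelFactorization f n :=
  match n with
  | 0 =>
    let d := MorphismProperty.factorizationData V V' (f.app 0)
    ⟨d.Z, d.i, d.p, d.fac⟩
  | n + 1 => (levelFactorization n).next V V'

/-- The middle object of the factorization. -/
noncomputable def factorizationObj : Spectrum G where
  obj n := (levelFactorization f V V' n).obj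
  str n := (pushout.inr _ _ ≫ ((levelFactorization f V V' n).data V V').i :
    G.obj (levelFactorization f V V' n).obj ⟶ ((levelFactorization f V V' n).next V V').obj)

/-- The first map of the factorization. -/
noncomputable def factorizationI : X ⟶ factorizationObj f V V' where
  app n := (levelFactorization f V V' n).i
  comm n := by
    refine (Category.assoc _ _ _).symm.trans ?_
    refine (congrArg (· ≫ _) pushout.condition.symm).trans ?_
    exact Category.assoc _ _ _

/-- The second map of the factorization. -/
noncomputable def factorizationP : factorizationObj f V V' ⟶ Y where
  app n := (levelFactorization f V V' n).p
  comm n := by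
    refine Eq.trans ?_ (Category.assoc _ _ _).symm
    refine Eq.trans ?_ (congrArg (pushout.inr _ _ ≫ ·)
      ((levelFactorization f V V' n).data V V').fac.symm)
    exact (pushout.inr_desc _ _ _).symm

lemma factorization_fac : factorizationI f V V' ≫ factorizationP f V V' = f := by
  ext n
  exact (levelFactorization f V V' n).fac

lemma factorizationP_mem (n : ℕ) : V' ((factorizationP f V V').app n) := by
  obtain _ | n := n
  · exact (MorphismProperty.factorizationData V V' (f.app 0)).hp
  · exact ((levelFactorization f V V' n).data V V').hp

lemma factorizationI_mem [V.IsStableUnderCobaseChange] [V.IsStableUnderComposition]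
    (hG : ∀ ⦃A B : C⦄ (i : A ⟶ B), V i → V (G.map i)) (n : ℕ) :
    V ((factorizationI f V V').app n) := by
  induction n with
  | zero => exact (MorphismProperty.factorizationData V V' (f.app 0)).hi
  | succ n hn =>
    exact V.comp_mem _ _ (V.pushout_inl _ _ (hG _ hn)) ((levelFactorization f V V' n).data V V').hi

/-- The lift is built degree by degree. The next lift is taken relative to the pushout of `X.obj (n
+ 1)` and `G` of the previous stage, which is exactly what makes the components commute with
structure maps. -/
lemma factorizationI_hasLiftingProperty {E B : Spectrum G} (p : E ⟶ B)
    (hp : ∀ n, V.rlp (p.app n)) : HasLiftingProperty (factorizationI f V V') p := by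
  refine ⟨fun {a b} sq => ?_⟩
  have w (n : ℕ) : a.app n ≫ p.app n = (levelFactorization f V V' n).i ≫ b.app n :=
    congrArg (fun t => Hom.app t n) sq.w
  let T (n : ℕ) := { l : (levelFactorization f V V' n).obj ⟶ E.obj n //
    (levelFactorization f V V' n).i ≫ l = a.app n ∧ l ≫ p.app n = b.app n }
  have h₀ : Nonempty (T 0) := by
    have := hp 0 (MorphismProperty.factorizationData V V' (f.app 0)).i
      (MorphismProperty.factorizationData V V' (f.app 0)).hi
    have sq₀ : CommSq (a.app 0) (MorphismProperty.factorizationData V V' (f.app 0)).i (p.app 0)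
      (b.app 0 : (MorphismProperty.factorizationData V V' (f.app 0)).Z ⟶ _) := ⟨w 0⟩
    have := this.sq_hasLift sq₀
    exact ⟨sq₀.lift, sq₀.fac_left, sq₀.fac_right⟩
  have h₁ (n : ℕ) (l : T n) : ∃ l' : T (n + 1),
      G.map l.1 ≫ E.str n =
        (pushout.inr _ _ ≫ ((levelFactorization f V V' n).data V V').i) ≫ l'.1 := by
    obtain ⟨l, hl, hl'⟩ := l
    let d := (levelFactorization f V V' n).data V V'
    have := hp (n + 1) d.i d.hi
    have hb : G.map (b.app n) ≫ B.str n = pushout.inr _ _ ≫ d.i ≫ b.app (n + 1) :=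
      (b.comm n).trans (Category.assoc _ _ _)
    have sq₁ : CommSq (pushout.desc (a.app (n + 1)) (G.map l ≫ E.str n) (by
        rw [← Category.assoc, ← G.map_comp, hl]
        exact (a.comm n).symm)) d.i (p.app (n + 1)) (b.app (n + 1) : d.Z ⟶ _) := ⟨by
      apply pushout.hom_ext
      · rw [pushout.inl_desc_assoc]
        exact (w (n + 1)).trans (Category.assoc _ _ _)
      · rw [pushout.inr_desc_assoc, Category.assoc, ← p.comm, ← Category.assoc, ← G.map_comp, hl']
        exact hb⟩
    have := this.sq_hasLift sq₁
    refine ⟨⟨sq₁.lift, ?_, sq₁.fac_right⟩, ?_⟩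
    · refine (Category.assoc _ _ _).trans ?_
      refine (congrArg (_ ≫ ·) sq₁.fac_left).trans ?_
      exact pushout.inl_desc _ _ _
    · refine Eq.trans ?_ (Category.assoc _ _ _).symm
      refine Eq.trans ?_ (congrArg (_ ≫ ·) sq₁.fac_left.symm)
      exact (pushout.inr_desc _ _ _).symm
  choose next hnext using h₁
  let l (n : ℕ) : T n := Nat.rec h₀.some next n
  exact ⟨⟨⟨{ app := fun n => (l n).1, comm := fun n => hnext n (l n) },
    hom_ext fun n => (l n).2.1, hom_ext fun n => (l n).2.2⟩⟩⟩

end Factorization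

section ModelStructure

variable [ModelCategory C]

instance levelEquivalences_hasTwoOutOfThreeProperty :
    (levelEquivalences G).HasTwoOutOfThreeProperty where
  comp_mem _ _ hf hg n := (weakEquivalences C).comp_mem _ _ (hf n) (hg n)
  of_postcomp _ _ hg hfg n := (weakEquivalences C).of_postcomp _ _ (hg n) (hfg n)
  of_precomp _ _ hf hfg n := (weakEquivalences C).of_precomp _ _ (hf n) (hfg n)

instance levelEquivalences_isStableUnderRetracts :
    (levelEquivalences G).IsStableUnderRetracts where
  of_retract r hg n := (weakEquivalences C).of_retract (r.map (ev G n)) (hg n)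

instance levelFibrations_isStableUnderRetracts :
    (levelFibrations G).IsStableUnderRetracts where
  of_retract r hg n := (fibrations C).of_retract (r.map (ev G n)) (hg n)

instance projectiveCofibrations_isStableUnderRetracts :
    (projectiveCofibrations G).IsStableUnderRetracts := by
  dsimp only [projectiveCofibrations]
  infer_instance

lemma levelTrivialFibrations_iff {X Y : Spectrum G} (f : X ⟶ Y) :
    levelTrivialFibrations G f ↔ Fibration f ∧ WeakEquivalence f :=
  ⟨fun h => ⟨⟨fun n => (h n).1⟩, ⟨fun n => (h n).2⟩⟩, fun h n => ⟨h.1.1 n, h.2.1 n⟩⟩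

lemma exists_factorization_of_map_trivialCofibration
    (hG : ∀ ⦃A B : C⦄ (i : A ⟶ B), trivialCofibrations C i → trivialCofibrations C (G.map i))
    {X Y : Spectrum G} (f : X ⟶ Y) :
    ∃ (Z : Spectrum G) (i : X ⟶ Z) (p : Z ⟶ Y), i ≫ p = f ∧
      (levelFibrations G).llp i ∧ levelEquivalences G i ∧ levelFibrations G p := by
  refine ⟨_, _, _, factorization_fac f (trivialCofibrations C) (fibrations C), ?_, ?_, ?_⟩
  · intro E B p hp
    refine factorizationI_hasLiftingProperty f _ _ p fun n => ?_
    rw [trivialCofibrations_rlp]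
    exact hp n
  · exact fun n => (factorizationI_mem f (trivialCofibrations C) (fibrations C) hG n).2
  · exact factorizationP_mem f (trivialCofibrations C) (fibrations C)

lemma exists_factorization_cofibration {X Y : Spectrum G} (f : X ⟶ Y) :
    ∃ (Z : Spectrum G) (i : X ⟶ Z) (p : Z ⟶ Y), i ≫ p = f ∧
      projectiveCofibrations G i ∧ levelTrivialFibrations G p := by
  refine ⟨_, _, _, factorization_fac f (cofibrations C) (trivialFibrations C), ?_, ?_⟩
  · intro E B p hp
    refine factorizationI_hasLiftingProperty f _ _ p fun n => ?_
    rw [cofibrations_rlp]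
    exact hp n
  · exact factorizationP_mem f (cofibrations C) (trivialFibrations C)

/-- The projective model structure. -/
@[reducible]
noncomputable def projectiveModelCategory [HasLimits C] [HasColimits C]
    [PreservesColimitsOfSize.{0, 0} G]
    (hG : ∀ ⦃A B : C⦄ (i : A ⟶ B), trivialCofibrations C i → trivialCofibrations C (G.map i)) :
    ModelCategory (Spectrum G) where
  categoryWithFibrations := inferInstance
  categoryWithCofibrations := inferInstance
  categoryWithWeakEquivalences := inferInstance
  cm1a := ⟨fun J _ _ => inferInstance⟩
  cm1b := ⟨fun J _ _ => inferInstance⟩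
  cm2 := levelEquivalences_hasTwoOutOfThreeProperty (G := G)
  cm3a := levelEquivalences_isStableUnderRetracts (G := G)
  cm3b := levelFibrations_isStableUnderRetracts (G := G)
  cm3c := projectiveCofibrations_isStableUnderRetracts (G := G)
  cm4a {A B X Y} i p hi hi' hp := by
    -- The retract argument: `q` is a level trivial fibration by two-out-of-three, so `i` is a
    -- retract of `j` and inherits its lifting against level fibrations.
    obtain ⟨Z, j, q, fac, hj, hj', hq⟩ := exists_factorization_of_map_trivialCofibration hG i
    have hq' : levelEquivalences G q :=
      (levelEquivalences G).of_precomp j q hj' (by rw [fac]; exact hi'.1)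
    have : HasLiftingProperty i q := (show projectiveCofibrations G i from hi.1) q fun n => ⟨hq n, hq' n⟩
    have sq : CommSq j i q (𝟙 B) := ⟨by simp [fac]⟩
    have : HasLiftingProperty j p := hj p hp.1
    refine ⟨fun {a b} sq' => ?_⟩
    have sq'' : CommSq a j p (q ≫ b) := ⟨by rw [sq'.w, ← fac, Category.assoc]⟩
    exact ⟨⟨⟨sq.lift ≫ sq''.lift, by
      rw [← Category.assoc, sq.fac_left, sq''.fac_left], by
      rw [Category.assoc, sq''.fac_right, ← Category.assoc, sq.fac_right, Category.id_comp]⟩⟩⟩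
  cm4b i p hi hp hp' := (show projectiveCofibrations G i from hi.1) p ((levelTrivialFibrations_iff p).2 ⟨hp, hp'⟩)
  cm5a := ⟨fun f => by
    obtain ⟨Z, j, q, fac, hj, hj', hq⟩ := exists_factorization_of_map_trivialCofibration hG f
    exact ⟨Z, j, q, fac, ⟨fun _ _ p hp => hj p fun n => (hp n).1, hj'⟩, hq⟩⟩
  cm5b := ⟨fun f => by
    obtain ⟨Z, j, q, fac, hj, hq⟩ := exists_factorization_cofibration f
    exact ⟨Z, j, q, fac, hj, fun n => (hq n).1, fun n => (hq n).2⟩⟩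

end ModelStructure

end Spectrum

end Hovey

/-! ### The tower of iterates of R and the idempotence of R^∞ -/

namespace Hovey

namespace Spectrum

variable {C : Type u} [Category.{v} C] {G U : C ⥤ C} (adj : G ⊣ U)

/-- The structure map of UX passes through the counit and then the unit. Taking its adjoint cancels
the counit by a triangle identity and leaves `U` of the adjoint structure map of `X`. -/
lemma iota_R_obj (X : Spectrum G) : (iota adj).app ((R adj).obj X) = (R adj).map ((iota adj).app X) := by
  ext n
  change adj.homEquiv (U.obj (X.obj (n + 1))) (U.obj (X.obj (n + 2)))
    ((adj.counit.app (X.obj (n + 1)) ≫ adj.unit.app (X.obj (n + 1))) ≫ U.map (X.str (n + 1))) =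
      U.map (adj.homEquiv _ _ (X.str (n + 1)))
  simp [Adjunction.homEquiv_unit]

/-- The map `X ⟶ RX`. -/
def iotaApp (X : Spectrum G) : X ⟶ (R adj).obj X := (iota adj).app X

lemma iotaApp_naturality {X Y : Spectrum G} (f : X ⟶ Y) :
    f ≫ iotaApp adj Y = iotaApp adj X ≫ (R adj).map f :=
  (iota adj).naturality f

lemma iotaApp_R_obj (X : Spectrum G) :
    iotaApp adj ((R adj).obj X) = (R adj).map (iotaApp adj X) :=
  iota_R_obj adj X

/-- The map `Rᵏ X ⟶ Rᵏ⁺¹ X`. -/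
def rpowMap (X : Spectrum G) (k : ℕ) : (Rpow adj k).obj X ⟶ (Rpow adj (k + 1)).obj X :=
  (Rpow adj k).map (iotaApp adj X)

/-- The isomorphism `R Rᵏ ≅ Rᵏ⁺¹`. -/
def rpowCompIso (k : ℕ) : Rpow adj k ⋙ R adj ≅ R adj ⋙ Rpow adj k :=
  match k with
  | 0 => Iso.refl (R adj)
  | k + 1 => Functor.isoWhiskerLeft (R adj) (rpowCompIso k)

/-- The isomorphism `R (Rᵏ X) ≅ Rᵏ⁺¹ X`. -/
def rpowIso (X : Spectrum G) (k : ℕ) :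
    (R adj).obj ((Rpow adj k).obj X) ≅ (Rpow adj (k + 1)).obj X :=
  (rpowCompIso adj k).app X

lemma iotaApp_rpowIso (X : Spectrum G) (k : ℕ) :
    iotaApp adj ((Rpow adj k).obj X) ≫ (rpowIso adj X k).hom = rpowMap adj X k := by
  induction k generalizing X with
  | zero => exact Category.comp_id _
  | succ k hk =>
    refine (hk ((R adj).obj X)).trans ?_
    rw [rpowMap, iotaApp_R_obj]
    rfl

lemma R_map_rpowMap (X : Spectrum G) (k : ℕ) :
    (R adj).map (rpowMap adj X k) ≫ (rpowIso adj X (k + 1)).hom =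
      (rpowIso adj X k).hom ≫ rpowMap adj X (k + 1) :=
  (rpowCompIso adj k).hom.naturality (iotaApp adj X)

lemma rpowStep_app (k : ℕ) (X : Spectrum G) : (RpowStep adj k).app X = rpowMap adj X k :=
  Category.id_comp _

lemma tower_map_succ (X : Spectrum G) (k : ℕ) :
    ((tower adj).obj X).map (homOfLE (Nat.le_add_right k 1)) = rpowMap adj X k :=
  (NatTrans.congr_app (Functor.ofSequence_map_homOfLE_succ (RpowStep adj) k) X).trans
    (rpowStep_app adj k X)

/-- `Rᵏ X ⟶ Rᵏ⁺¹ X` is an epimorphism relatively to the spectra `Z` for which `Z ⟶ RZ` is a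
monomorphism. -/
lemma eq_of_rpowMap_comp_eq (X : Spectrum G) (k : ℕ) {Z : Spectrum G}
    [Mono (iotaApp adj Z)] {u v : (Rpow adj (k + 1)).obj X ⟶ Z}
    (h : rpowMap adj X k ≫ u = rpowMap adj X k ≫ v) : u = v := by
  rw [← iotaApp_rpowIso, Category.assoc, Category.assoc] at h
  rw [← cancel_epi (rpowIso adj X k).hom, ← cancel_mono (iotaApp adj Z)]
  -- Naturality together with ι_R = Rι shows that `t`, followed by the monomorphism into RZ, depends
  -- only on the restriction of `t` along ι.
  have key (t : (R adj).obj ((Rpow adj k).obj X) ⟶ Z) : t ≫ iotaApp adj Z =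
      (R adj).map (iotaApp adj ((Rpow adj k).obj X) ≫ t) := by
    rw [iotaApp_naturality, iotaApp_R_obj, ← Functor.map_comp]
  rw [key, h, ← key]

section

variable [HasColimits C]

lemma preservesColimitsOfShape_left (adj : G ⊣ U) : PreservesColimitsOfShape ℕ G :=
  haveI : PreservesColimitsOfSize.{0, 0} G := adj.leftAdjoint_preservesColimits
  inferInstance

/-- The evaluation functors preserve sequential colimits. -/
lemma preservesColimitsOfShape_ev [PreservesColimitsOfShape ℕ G] (n : ℕ) :
    PreservesColimitsOfShape ℕ (ev G n) where
  preservesColimit {F} := preservesColimit_of_preserves_colimit_cocone (isColimitColimitCocone F)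
    (colimit.isColimit (F ⋙ ev G n))

lemma isIso_of_isIso_app {X Y : Spectrum G} (f : X ⟶ Y) (hf : ∀ n, IsIso (f.app n)) : IsIso f :=
  ⟨{ app := fun n => inv (f.app n)
     comm := fun n => by
      rw [IsIso.eq_comp_inv, Category.assoc, ← f.comm, ← Category.assoc, ← G.map_comp]
      simp }, by ext n; simp, by ext n; simp⟩

/-- The cocone `R^∞ X`. -/
noncomputable def rinftyCocone (X : Spectrum G) : Cocone ((tower adj).obj X) :=
  haveI := hasSequentialColimits adj
  colimit.cocone ((tower adj).obj X)

/-- The universal property of `R^∞ X`. -/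
noncomputable def isColimitRinftyCocone (X : Spectrum G) : IsColimit (rinftyCocone adj X) :=
  haveI := hasSequentialColimits adj
  colimit.isColimit ((tower adj).obj X)

/-- The map `Rᵏ X ⟶ R^∞ X`. -/
noncomputable def rinftyι (X : Spectrum G) (k : ℕ) : (Rpow adj k).obj X ⟶ (Rinfty adj).obj X :=
  (rinftyCocone adj X).ι.app k

lemma rpowMap_rinftyι (X : Spectrum G) (k : ℕ) :
    rpowMap adj X k ≫ rinftyι adj X (k + 1) = rinftyι adj X k := by
  rw [← tower_map_succ]
  exact (rinftyCocone adj X).w _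

/-- The map `X ⟶ R^∞ X`. -/
noncomputable def rinftyUnit (X : Spectrum G) : X ⟶ (Rinfty adj).obj X := rinftyι adj X 0

variable {adj} in
lemma rinfty_hom_ext {X Z : Spectrum G} {u v : (Rinfty adj).obj X ⟶ Z}
    (h : ∀ k, rinftyι adj X k ≫ u = rinftyι adj X k ≫ v) : u = v :=
  (isColimitRinftyCocone adj X).hom_ext h

lemma rinftyι_map {X Y : Spectrum G} (f : X ⟶ Y) (k : ℕ) :
    rinftyι adj X k ≫ (Rinfty adj).map f = (Rpow adj k).map f ≫ rinftyι adj Y k :=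
  haveI := hasSequentialColimits adj
  ι_colimMap ((tower adj).map f) k

variable [PreservesColimitsOfShape ℕ U]

/-- `R` preserves sequential colimits. -/
lemma preservesColimitsOfShape_R : PreservesColimitsOfShape ℕ (R adj) where
  preservesColimit {F} := by
    have := preservesColimitsOfShape_left adj
    refine preservesColimit_of_preserves_colimit_cocone (isColimitColimitCocone F) ?_
    let t := (R adj).mapCocone (colimitCocone F)
    have : IsIso ((isColimitColimitCocone (F ⋙ R adj)).desc t) := by
      refine isIso_of_isIso_app _ fun n => ?_
      have h₁ : IsColimit ((ev G n).mapCocone t) :=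
        isColimitOfPreserves U (colimit.isColimit (F ⋙ ev G (n + 1)))
      exact ((colimit.isColimit ((F ⋙ R adj) ⋙ ev G n)).coconePointUniqueUpToIso h₁).isIso_hom
    exact IsColimit.ofPointIso (isColimitColimitCocone (F ⋙ R adj))

/-- `R^∞ X ⟶ R R^∞ X` is an isomorphism. -/
lemma isIso_iotaApp_Rinfty (X : Spectrum G) : IsIso (iotaApp adj ((Rinfty adj).obj X)) := by
  have := preservesColimitsOfShape_R adj
  have hR := isColimitOfPreserves (R adj) (isColimitRinftyCocone adj X)
  have hw (k : ℕ) : (R adj).map (rpowMap adj X k) ≫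
      (rpowIso adj X (k + 1)).hom ≫ rinftyι adj X (k + 2) =
      (rpowIso adj X k).hom ≫ rinftyι adj X (k + 1) := by
    rw [← Category.assoc, R_map_rpowMap, Category.assoc, rpowMap_rinftyι]
  -- As `R` preserves this colimit, its value at R^∞X is the colimit of the shifted tower; `d` is
  -- the comparison with the original tower, inverse to ι.
  obtain ⟨d, hd⟩ : ∃ d : (R adj).obj ((Rinfty adj).obj X) ⟶ (Rinfty adj).obj X,
      ∀ k, (R adj).map (rinftyι adj X k) ≫ d =
        (rpowIso adj X k).hom ≫ rinftyι adj X (k + 1) := by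
    let t : Cocone ((tower adj).obj X ⋙ R adj) :=
      { pt := (Rinfty adj).obj X
        ι := NatTrans.ofSequence
          (fun k => (rpowIso adj X k).hom ≫ rinftyι adj X (k + 1)) (fun k => by
            refine Eq.trans ?_ (Category.comp_id _).symm
            exact (congrArg (fun x => (R adj).map x ≫ _) (tower_map_succ adj X k)).trans (hw k)) }
    exact ⟨hR.desc t, hR.fac t⟩
  refine ⟨d, ?_, ?_⟩
  · refine rinfty_hom_ext fun k => ?_
    rw [← Category.assoc, iotaApp_naturality, Category.assoc, hd, ← Category.assoc,
      iotaApp_rpowIso, rpowMap_rinftyι, Category.comp_id]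
  · refine hR.hom_ext fun k => ?_
    change (R adj).map (rinftyι adj X k) ≫ d ≫ iotaApp adj ((Rinfty adj).obj X) =
      (R adj).map (rinftyι adj X k) ≫ 𝟙 _
    have h₁ : (rpowIso adj X k).hom ≫ iotaApp adj ((Rpow adj (k + 1)).obj X) =
        (R adj).map (rpowMap adj X k) := by
      rw [← cancel_mono (rpowIso adj X (k + 1)).hom, R_map_rpowMap, Category.assoc,
        iotaApp_rpowIso]
    rw [← Category.assoc, hd, Category.assoc, iotaApp_naturality, ← Category.assoc, h₁,
      ← Functor.map_comp, rpowMap_rinftyι, Category.comp_id]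

lemma isIso_rinftyUnit {Z : Spectrum G} [IsIso (iotaApp adj Z)] :
    IsIso (rinftyUnit adj Z) := by
  have hF : ((tower adj).obj Z).IsEventuallyConstantFrom 0 := fun k φ =>
    Functor.ofSequence_map_mem (RpowStep adj)
      ((MorphismProperty.isomorphisms _).inverseImage ((evaluation _ _).obj Z)) 0
      (fun k _ => by
        change IsIso ((RpowStep adj k).app Z)
        rw [rpowStep_app]
        exact Functor.map_isIso (Rpow adj k) (iotaApp adj Z)) 0 k le_rfl φ
  exact hF.isIso_ι_of_isColimit (isColimitRinftyCocone adj Z)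

lemma rinftyUnit_naturality {X Y : Spectrum G} (f : X ⟶ Y) :
    rinftyUnit adj X ≫ (Rinfty adj).map f = f ≫ rinftyUnit adj Y :=
  rinftyι_map adj f 0

/-- `R^∞ X ⟶ R^∞ R^∞ X` is an isomorphism. -/
lemma isIso_Rinfty_map_rinftyUnit (X : Spectrum G) :
    IsIso ((Rinfty adj).map (rinftyUnit adj X)) := by
  have := isIso_iotaApp_Rinfty adj X
  have := isIso_iotaApp_Rinfty adj ((Rinfty adj).obj X)
  -- The unit at R^∞X is invertible because the tower of R^∞X consists of isomorphisms. The two maps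
  -- agree on the zeroth stage by naturality, and each stage determines the next since ι of the
  -- target is a monomorphism.
  suffices (Rinfty adj).map (rinftyUnit adj X) =
      rinftyUnit adj ((Rinfty adj).obj X) by
    rw [this]
    exact isIso_rinftyUnit adj
  refine rinfty_hom_ext fun k => ?_
  induction k with
  | zero => exact rinftyUnit_naturality adj _
  | succ k hk =>
    apply eq_of_rpowMap_comp_eq adj X k
    rw [← Category.assoc, ← Category.assoc, rpowMap_rinftyι, hk]

end

end Spectrum

end Hovey

/-! ### Sequential colimits in an almost finitely generated model category -/

namespace Hovey

section Sequences

variable {C : Type u} [Category.{v} C] {F F' : ℕ ⥤ C} {c : Cocone F} {c' : Cocone F'}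

lemma IsFinitelyPresented.exists_factorization {A : C} (hA : IsFinitelyPresented A)
    (hc : IsColimit c) (a : A ⟶ c.pt) : ∃ (k : ℕ) (a' : A ⟶ F.obj k), a' ≫ c.ι.app k = a := by
  have : PreservesColimitsOfShape ℕ (coyoneda.obj (op A)) := hA
  exact Types.jointly_surjective_of_isColimit (isColimitOfPreserves (coyoneda.obj (op A)) hc) a

lemma IsFinitelyPresented.exists_eq {A : C} (hA : IsFinitelyPresented A)
    (hc : IsColimit c) {k : ℕ} (a b : A ⟶ F.obj k) (h : a ≫ c.ι.app k = b ≫ c.ι.app k) :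
    ∃ (k' : ℕ) (φ : k ⟶ k'), a ≫ F.map φ = b ≫ F.map φ := by
  have : PreservesColimitsOfShape ℕ (coyoneda.obj (op A)) := hA
  obtain ⟨k', φ, ψ, hφ⟩ := (Types.FilteredColimit.isColimit_eq_iff _
    (isColimitOfPreserves (coyoneda.obj (op A)) hc)).1 h
  obtain rfl : φ = ψ := Subsingleton.elim _ _
  exact ⟨k', φ, hφ⟩

/-- Sequential colimits preserve the right lifting property with respect to maps between finitely
presented objects. -/
lemma rlp_of_isColimit {I : MorphismProperty C} (hI : HasFinitelyPresentedEnds I)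
    (hc : IsColimit c) (hc' : IsColimit c') (α : F ⟶ F') (hα : ∀ k, I.rlp (α.app k))
    (g : c.pt ⟶ c'.pt) (hg : ∀ k, c.ι.app k ≫ g = α.app k ≫ c'.ι.app k) : I.rlp g := by
  intro A B i hi
  obtain ⟨hA, hB⟩ := hI i hi
  refine ⟨fun {a b} sq => ?_⟩
  obtain ⟨k₁, a₁, rfl⟩ := hA.exists_factorization hc a
  obtain ⟨k₂, b₂, rfl⟩ := hB.exists_factorization hc' b
  -- The top and bottom of the square factor through finite stages, but the square may only commute
  -- further along the sequence, since it is known to commute only in the colimit.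
  obtain ⟨k, φ, hφ⟩ := hA.exists_eq hc' (k := max k₁ k₂)
    (a₁ ≫ F.map (homOfLE (le_max_left _ _)) ≫ α.app _)
    (i ≫ b₂ ≫ F'.map (homOfLE (le_max_right _ _))) (by
      have := sq.w
      rw [Category.assoc, hg] at this
      simp only [Category.assoc, Cocone.w, ← this, NatTrans.naturality_assoc])
  have := hα k i hi
  have sq' : CommSq (a₁ ≫ F.map (homOfLE (le_max_left _ _)) ≫ F.map φ) i (α.app k)
      (b₂ ≫ F'.map (homOfLE (le_max_right _ _)) ≫ F'.map φ) := ⟨by simpa using hφ⟩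
  exact ⟨⟨⟨sq'.lift ≫ c.ι.app k, by simp [sq'.fac_left_assoc], by
    rw [Category.assoc, hg, sq'.fac_right_assoc]; simp⟩⟩⟩

variable [ModelCategory C]

/-- The set `J'` detects fibrations only over fibrant codomains, which suffices for the map to the
terminal object. -/
lemma isFibrant_of_isColimit (hC : IsAlmostFinitelyGenerated C) (hc : IsColimit c)
    (hF : ∀ k, IsFibrant (F.obj k)) : IsFibrant c.pt := by
  obtain ⟨I, J, -, -, J', -, hJ', hJ'', h⟩ := hC
  have hterm : IsFibrant (⊤_ C) :=
    (isFibrant_iff_of_isTerminal (𝟙 _) terminalIsTerminal).2 inferInstance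
  rw [isFibrant_iff_of_isTerminal (terminal.from c.pt) terminalIsTerminal, fibration_iff,
    h _ hterm]
  intro A B j hj
  obtain ⟨h₁, h₂⟩ := hJ' _ hj
  have : Cofibration j := ⟨h₁⟩
  have : WeakEquivalence j := ⟨h₂⟩
  refine ⟨fun {a b} sq => ?_⟩
  obtain ⟨k, a, rfl⟩ := (hJ'' j hj).1.exists_factorization hc a
  have sq' : CommSq a j (terminal.from (F.obj k)) (terminal.from B) := ⟨terminal.hom_ext _ _⟩
  exact ⟨⟨⟨sq'.lift ≫ c.ι.app k, by rw [sq'.fac_left_assoc], terminal.hom_ext _ _⟩⟩⟩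

lemma trivialFibration_of_isColimit (hC : IsAlmostFinitelyGenerated C) (hc : IsColimit c)
    (hc' : IsColimit c') (α : F ⟶ F') (hα : ∀ k, trivialFibrations C (α.app k))
    (g : c.pt ⟶ c'.pt) (hg : ∀ k, c.ι.app k ≫ g = α.app k ≫ c'.ι.app k) :
    trivialFibrations C g := by
  obtain ⟨I, J, hIJ, hI, -⟩ := hC
  rw [hIJ.trivialFibrations_eq] at hα ⊢
  exact rlp_of_isColimit hI hc hc' α hα g hg

end Sequences

namespace Spectrum

section

variable {C : Type u} [Category.{v} C] {G : C ⥤ C}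

lemma preservesLimitsOfShape_ev {J : Type w} [Category.{w'} J] [HasLimitsOfShape J C] (n : ℕ) :
    PreservesLimitsOfShape J (ev G n) where
  preservesLimit {F} := preservesLimit_of_preserves_limit_cone (isLimitLimitCone F)
    (limit.isLimit (F ⋙ ev G n))

variable [HasLimits C]

/-- The terminal spectrum is terminal in each degree. -/
noncomputable def isTerminalObj (n : ℕ) : IsTerminal ((⊤_ (Spectrum G)).obj n) :=
  haveI : PreservesLimitsOfShape (Discrete PEmpty) (ev G n) := preservesLimitsOfShape_ev n
  IsTerminal.isTerminalObj (ev G n) _ terminalIsTerminal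

variable [ModelCategory C]

lemma isFibrant_iff_isLevelFibrant (X : Spectrum G) : IsFibrant X ↔ X.IsLevelFibrant := by
  rw [isFibrant_iff, fibration_iff]
  refine forall_congr' fun n => ?_
  rw [isFibrant_iff_of_isTerminal ((terminal.from X).app n) (isTerminalObj n), fibration_iff]

end

section

variable {C : Type u} [Category.{v} C] [HasColimits C]

/-- The map of sequences attached to a map of spectra for the identity functor. -/
def sequenceMap {X Y : Spectrum (𝟭 C)} (f : X ⟶ Y) :
    Functor.ofSequence X.str ⟶ Functor.ofSequence Y.str :=
  NatTrans.ofSequence f.app (fun n => by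
    simp only [Functor.ofSequence_map_homOfLE_succ]
    exact (f.comm n).symm)

/-- The colimit of a sequence, as a functor on the spectra for the identity functor. -/
noncomputable def sequenceColimit : Spectrum (𝟭 C) ⥤ C where
  obj X := colimit (Functor.ofSequence X.str)
  map f := colimMap (sequenceMap f)
  map_id X := by
    refine colimit.hom_ext fun n => ?_
    rw [ι_colimMap]
    exact (Category.id_comp _).trans (Category.comp_id _).symm
  map_comp f g := by
    refine colimit.hom_ext fun n => ?_
    rw [ι_colimMap, ι_colimMap_assoc, ι_colimMap]
    exact Category.assoc _ _ _

variable [HasLimits C] [ModelCategory C]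

/-- Sequential colimits preserve weak equivalences between levelwise fibrant sequences. -/
lemma weakEquivalence_sequenceColimit_map (hC : IsAlmostFinitelyGenerated C)
    {X Y : Spectrum (𝟭 C)} (f : X ⟶ Y) (hX : X.IsLevelFibrant) (hY : Y.IsLevelFibrant)
    (hf : levelEquivalences _ f) : WeakEquivalence (sequenceColimit.map f) := by
  -- Spectra for the identity functor are sequences, so the projective model structure already
  -- constructed lets Ken Brown's lemma apply to the colimit functor.
  let : ModelCategory (Spectrum (𝟭 C)) := projectiveModelCategory (fun _ _ _ hi => hi)
  have : IsFibrant X := (isFibrant_iff_isLevelFibrant X).2 hX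
  have : IsFibrant Y := (isFibrant_iff_isLevelFibrant Y).2 hY
  have : WeakEquivalence f := ⟨hf⟩
  refine weakEquivalence_map_of_isFibrant sequenceColimit (fun X Y p _ _ hp hp' => ?_) f
  exact ⟨(trivialFibration_of_isColimit hC (colimit.isColimit _) (colimit.isColimit _)
    (sequenceMap p) (fun k => ⟨hp.1 k, hp'.1 k⟩) _ (fun k => ι_colimMap _ k)).2⟩

end

end Spectrum

section Sequences

variable {C : Type u} [Category.{v} C] [HasColimits C] [HasLimits C] [ModelCategory C]

lemma weakEquivalence_of_isColimit (hC : IsAlmostFinitelyGenerated C) {F F' : ℕ ⥤ C}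
    {c : Cocone F} {c' : Cocone F'} (hc : IsColimit c) (hc' : IsColimit c') (α : F ⟶ F')
    (hF : ∀ k, IsFibrant (F.obj k)) (hF' : ∀ k, IsFibrant (F'.obj k))
    (hα : ∀ k, WeakEquivalence (α.app k)) (g : c.pt ⟶ c'.pt)
    (hg : ∀ k, c.ι.app k ≫ g = α.app k ≫ c'.ι.app k) : WeakEquivalence g := by
  let S (F : ℕ ⥤ C) : Spectrum (𝟭 C) :=
    { obj := F.obj, str := fun n => F.map (homOfLE (Nat.le_add_right n 1)) }
  let f : S F ⟶ S F' := { app := fun n => α.app n, comm := fun n => (α.naturality _).symm }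
  have key := Spectrum.weakEquivalence_sequenceColimit_map hC f hF hF' (fun n => (hα n).1)
  let e (F : ℕ ⥤ C) : Functor.ofSequence (S F).str ≅ F :=
    NatIso.ofComponents (fun n => Iso.refl (F.obj n)) (fun {n m} φ =>
      (NatTrans.ofSequence (F := Functor.ofSequence (S F).str) (G := F) (fun n => 𝟙 (F.obj n))
        (fun n => by
          rw [Functor.ofSequence_map_homOfLE_succ]
          exact (Category.comp_id _).trans (Category.id_comp _).symm)).naturality φ)
  let i (F : ℕ ⥤ C) (c : Cocone F) (hc : IsColimit c) : Spectrum.sequenceColimit.obj (S F) ≅ c.pt :=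
    IsColimit.coconePointsIsoOfNatIso (colimit.isColimit (Functor.ofSequence (S F).str)) hc (e F)
  have h : g = (i F c hc).inv ≫ Spectrum.sequenceColimit.map f ≫ (i F' c' hc').hom := by
    rw [Iso.eq_inv_comp]
    refine colimit.hom_ext fun n => ?_
    have h₁ (F : ℕ ⥤ C) (c : Cocone F) (hc : IsColimit c) :
        colimit.ι (Functor.ofSequence (S F).str) n ≫ (i F c hc).hom = c.ι.app n :=
      (IsColimit.comp_coconePointsIsoOfNatIso_hom _ _ _ _).trans (Category.id_comp _)
    have h₂ : colimit.ι (Functor.ofSequence (S F).str) n ≫ Spectrum.sequenceColimit.map f =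
        α.app n ≫ colimit.ι (Functor.ofSequence (S F').str) n := ι_colimMap _ n
    refine (Category.assoc _ _ _).symm.trans ((congrArg (· ≫ g) (h₁ F c hc)).trans
      ((hg n).trans ?_))
    refine Eq.trans ?_ (Category.assoc _ _ _)
    refine Eq.trans ?_ (congrArg (· ≫ _) h₂.symm)
    refine Eq.trans ?_ (Category.assoc _ _ _).symm
    exact congrArg (α.app n ≫ ·) (h₁ F' c' hc').symm
  rw [h]
  infer_instance

lemma weakEquivalence_ι_zero_of_isColimit (hC : IsAlmostFinitelyGenerated C) {F : ℕ ⥤ C}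
    {c : Cocone F} (hc : IsColimit c) (hF : ∀ k, IsFibrant (F.obj k))
    (h : ∀ k, WeakEquivalence (F.map (homOfLE (Nat.zero_le k)))) :
    WeakEquivalence (c.ι.app 0) := by
  let α : (Functor.const ℕ).obj (F.obj 0) ⟶ F :=
    { app := fun k => F.map (homOfLE (Nat.zero_le k))
      naturality := fun k k' φ => by
        simp [← Functor.map_comp]
        rfl }
  exact weakEquivalence_of_isColimit hC (isColimitConstCocone ℕ (F.obj 0)) hc α
    (fun _ => hF 0) hF h _ (fun k => by
      refine (Category.id_comp _).trans ?_
      exact (c.w _).symm)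

end Sequences

end Hovey

/-! ### U-spectra as the local objects for R^∞L' -/

namespace Hovey

section RightQuillen

variable {C : Type u} [Category.{v} C] [ModelCategory C] {G U : C ⥤ C} (adj : G ⊣ U)
  (hG : IsLeftQuillen G)

include adj hG

lemma IsLeftQuillen.fibration_map {X Y : C} (p : X ⟶ Y) [Fibration p] : Fibration (U.map p) := by
  rw [fibration_iff, ← trivialCofibrations_rlp]
  intro A B i hi
  rw [← adj.hasLiftingProperty_iff]
  have h := hG.map_trivialCofibration i hi
  have : Cofibration (G.map i) := ⟨h.1⟩
  have : WeakEquivalence (G.map i) := ⟨h.2⟩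
  infer_instance

lemma IsLeftQuillen.trivialFibration_map {X Y : C} (p : X ⟶ Y) [Fibration p]
    [WeakEquivalence p] : trivialFibrations C (U.map p) := by
  rw [← cofibrations_rlp]
  intro A B i hi
  rw [← adj.hasLiftingProperty_iff]
  have : Cofibration (G.map i) := ⟨hG.map_cofibration i hi⟩
  infer_instance

lemma IsLeftQuillen.isFibrant_obj {X : C} (hX : IsFibrant X) : IsFibrant (U.obj X) := by
  have : PreservesLimitsOfSize.{0, 0} U := adj.rightAdjoint_preservesLimits
  rw [isFibrant_iff_of_isTerminal (U.map (terminal.from X))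
    (IsTerminal.isTerminalObj U _ terminalIsTerminal)]
  have : Fibration (terminal.from X) := hX
  exact hG.fibration_map adj _

lemma IsLeftQuillen.weakEquivalence_map {X Y : C} (f : X ⟶ Y) (hX : IsFibrant X)
    (hY : IsFibrant Y) (hf : WeakEquivalence f) : WeakEquivalence (U.map f) :=
  weakEquivalence_map_of_isFibrant U
    (fun _ _ p _ _ _ _ => ⟨(hG.trivialFibration_map adj p).2⟩) f

end RightQuillen

namespace Spectrum

variable {C : Type u} [Category.{v} C] [ModelCategory C] {G U : C ⥤ C} (adj : G ⊣ U)
  (hG : IsLeftQuillen G)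

section

include hG

lemma isLevelFibrant_R_obj {X : Spectrum G} (hX : X.IsLevelFibrant) :
    ((R adj).obj X).IsLevelFibrant :=
  fun n => hG.isFibrant_obj adj (hX (n + 1))

lemma levelEquivalences_R_map {X Y : Spectrum G} (f : X ⟶ Y) (hX : X.IsLevelFibrant)
    (hY : Y.IsLevelFibrant) (hf : levelEquivalences G f) :
    levelEquivalences G ((R adj).map f) :=
  fun n => (hG.weakEquivalence_map adj (f.app (n + 1)) (hX _) (hY _) ⟨hf _⟩).1

lemma isLevelFibrant_rpow_obj {X : Spectrum G} (hX : X.IsLevelFibrant) (k : ℕ) :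
    ((Rpow adj k).obj X).IsLevelFibrant := by
  induction k generalizing X with
  | zero => exact hX
  | succ k hk => exact hk (isLevelFibrant_R_obj adj hG hX)

lemma levelEquivalences_rpow_map {X Y : Spectrum G} (f : X ⟶ Y) (hX : X.IsLevelFibrant)
    (hY : Y.IsLevelFibrant) (hf : levelEquivalences G f) (k : ℕ) :
    levelEquivalences G ((Rpow adj k).map f) := by
  induction k generalizing X Y with
  | zero => exact hf
  | succ k hk =>
    exact hk _ (isLevelFibrant_R_obj adj hG hX) (isLevelFibrant_R_obj adj hG hY)
      (levelEquivalences_R_map adj hG f hX hY hf)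

lemma IsUSpectrum.of_levelEquivalences {X Y : Spectrum G} (f : X ⟶ Y)
    (hf : levelEquivalences G f) (hX : IsUSpectrum adj X) (hY : Y.IsLevelFibrant) :
    IsUSpectrum adj Y := by
  refine ⟨hY, fun n => ?_⟩
  have h₁ := levelEquivalences_R_map adj hG f hX.1 hY hf n
  have h₂ : f.app n ≫ (iotaApp adj Y).app n = (iotaApp adj X).app n ≫ ((R adj).map f).app n :=
    congrArg (fun t => Hom.app t n) (iotaApp_naturality adj f)
  refine (weakEquivalences C).of_precomp (f.app n) _ (hf n) ?_
  exact h₂ ▸ (weakEquivalences C).comp_mem _ _ (hX.2 n) h₁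

end

variable [HasColimits C]

/-- The colimit cocone defining `R^∞ X`, in degree `n`. -/
noncomputable abbrev rinftyCoconeEv (X : Spectrum G) (n : ℕ) :
    Cocone ((tower adj).obj X ⋙ ev G n) := (ev G n).mapCocone (rinftyCocone adj X)

/-- `R^∞ X` is computed levelwise. -/
noncomputable def isColimitRinftyCoconeEv (X : Spectrum G) (n : ℕ) :
    IsColimit (rinftyCoconeEv adj X n) :=
  haveI := preservesColimitsOfShape_left adj
  haveI : PreservesColimitsOfShape ℕ (ev G n) := preservesColimitsOfShape_ev n
  isColimitOfPreserves (ev G n) (isColimitRinftyCocone adj X)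

variable (hC : IsAlmostFinitelyGenerated C)

section

include hC hG

lemma isLevelFibrant_Rinfty_obj {X : Spectrum G} (hX : X.IsLevelFibrant) :
    ((Rinfty adj).obj X).IsLevelFibrant :=
  fun n => isFibrant_of_isColimit hC (isColimitRinftyCoconeEv adj X n)
    (fun k => isLevelFibrant_rpow_obj adj hG hX k n)

lemma isUSpectrum_Rinfty_obj [PreservesColimitsOfShape ℕ U] {X : Spectrum G}
    (hX : X.IsLevelFibrant) : IsUSpectrum adj ((Rinfty adj).obj X) := by
  refine ⟨isLevelFibrant_Rinfty_obj adj hG hC hX, fun n => ?_⟩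
  have := isIso_iotaApp_Rinfty adj X
  have h : IsIso ((ev G n).map (iotaApp adj ((Rinfty adj).obj X))) := inferInstance
  have h' : WeakEquivalence ((ev G n).map (iotaApp adj ((Rinfty adj).obj X))) := inferInstance
  exact h'.1

variable [HasLimits C]

lemma levelEquivalences_Rinfty_map {X Y : Spectrum G} (f : X ⟶ Y) (hX : X.IsLevelFibrant)
    (hY : Y.IsLevelFibrant) (hf : levelEquivalences G f) :
    levelEquivalences G ((Rinfty adj).map f) := fun n =>
  (weakEquivalence_of_isColimit hC (isColimitRinftyCoconeEv adj X n)
    (isColimitRinftyCoconeEv adj Y n) (Functor.whiskerRight ((tower adj).map f) (ev G n))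
    (fun k => isLevelFibrant_rpow_obj adj hG hX k n)
    (fun k => isLevelFibrant_rpow_obj adj hG hY k n)
    (fun k => ⟨levelEquivalences_rpow_map adj hG f hX hY hf k n⟩) (((Rinfty adj).map f).app n)
    (fun k => congrArg (fun t => Hom.app t n) (rinftyι_map adj f k))).1

/-- For a U-spectrum the tower consists of level equivalences between level fibrant spectra, so its
colimit can be compared with that of the constant sequence. -/
lemma levelEquivalences_rinftyUnit {X : Spectrum G} (hX : IsUSpectrum adj X) :
    levelEquivalences G (rinftyUnit adj X) := fun n =>
  (weakEquivalence_ι_zero_of_isColimit hC (isColimitRinftyCoconeEv adj X n)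
    (fun k => isLevelFibrant_rpow_obj adj hG hX.1 k n)
    (fun k => ⟨Functor.ofSequence_map_mem (RpowStep adj)
      ((weakEquivalences C).inverseImage ((evaluation _ _).obj X ⋙ ev G n)) 0
      (fun k _ => by
        change weakEquivalences C (((RpowStep adj k).app X).app n)
        rw [rpowStep_app]
        exact levelEquivalences_rpow_map adj hG (iotaApp adj X) hX.1
          (isLevelFibrant_R_obj adj hG hX.1) hX.2 k n) 0 k le_rfl _⟩)).1

end

section

variable [HasLimits C]

lemma isUSpectrum_terminal : IsUSpectrum adj (⊤_ (Spectrum G)) := by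
  have : PreservesLimitsOfSize.{0, 0} U := adj.rightAdjoint_preservesLimits
  refine ⟨fun n => ?_, fun n => ?_⟩
  · exact (isFibrant_iff_of_isTerminal (𝟙 _) (isTerminalObj n)).2 inferInstance
  · have := isIso_of_isTerminal (isTerminalObj (G := G) n)
      (IsTerminal.isTerminalObj U _ (isTerminalObj (n + 1)))
      ((adj.homEquiv _ _) ((⊤_ (Spectrum G)).str n))
    exact (inferInstance : WeakEquivalence _).1

include hG in
-- Since `U` preserves pullbacks and fibrations, the adjoint structure maps form a map of pullback
-- squares to which the cogluing lemma applies.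
lemma isUSpectrum_pullback {P₁ P₂ P₃ : Spectrum G} (p : P₂ ⟶ P₁) (q : P₃ ⟶ P₁)
    (hp : levelFibrations G p) (hq : levelFibrations G q) (h₁ : IsUSpectrum adj P₁)
    (h₂ : IsUSpectrum adj P₂) (h₃ : IsUSpectrum adj P₃) :
    IsUSpectrum adj (pullback p q) := by
  have : PreservesLimitsOfSize.{0, 0} U := adj.rightAdjoint_preservesLimits
  have sq (n : ℕ) : IsPullback ((pullback.fst p q).app n) ((pullback.snd p q).app n)
      (p.app n) (q.app n) :=
    haveI : PreservesLimitsOfShape WalkingCospan (ev G n) := preservesLimitsOfShape_ev n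
    (IsPullback.of_hasPullback p q).map (ev G n)
  have hp' (n : ℕ) : Fibration (p.app n) := ⟨hp n⟩
  have hq' (n : ℕ) : Fibration (q.app n) := ⟨hq n⟩
  have f₁ := h₁.1
  have f₂ := h₂.1
  have f₃ := h₃.1
  refine ⟨fun n => ?_, fun n => ?_⟩
  · have : Fibration ((pullback.fst p q).app n) :=
      ⟨(fibrations C).of_isPullback (sq n).flip (hq n)⟩
    have := f₂ n
    exact isFibrant_of_fibration ((pullback.fst p q).app n)
  · have := f₁ n
    have := f₂ n
    have := hG.isFibrant_obj adj (f₁ (n + 1))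
    have := hG.isFibrant_obj adj (f₂ (n + 1))
    have := hG.fibration_map adj (q.app (n + 1))
    let a (X : Spectrum G) : X.obj n ⟶ U.obj (X.obj (n + 1)) := (iotaApp adj X).app n
    have w₁ : WeakEquivalence (a P₁) := ⟨h₁.2 n⟩
    have w₂ : WeakEquivalence (a P₂) := ⟨h₂.2 n⟩
    have w₃ : WeakEquivalence (a P₃) := ⟨h₃.2 n⟩
    have nat {X Y : Spectrum G} (f : X ⟶ Y) :
        f.app n ≫ a Y = a X ≫ U.map (f.app (n + 1)) :=
      congrArg (fun t => Hom.app t n) (iotaApp_naturality adj f)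
    exact (weakEquivalence_of_isPullback (sq n) ((sq (n + 1)).map U)
      (a (pullback p q)) (a P₂) (a P₃) (a P₁) (nat _).symm (nat _).symm (nat _) (nat _)).1

variable (L' : Spectrum G ⥤ Spectrum G) (l : 𝟭 (Spectrum G) ⟶ L')

/-- The natural map `A ⟶ L'A ⟶ R^∞ L'A`. -/
noncomputable def stableUnit : 𝟭 (Spectrum G) ⟶ L' ⋙ Rinfty adj where
  app A := l.app A ≫ (jinfty adj).app (L'.obj A)
  naturality A B f := by
    have h₁ := l.naturality f
    have h₂ := (jinfty adj).naturality (L'.map f)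
    dsimp at h₁ h₂ ⊢
    rw [← Category.assoc, h₁, Category.assoc, Category.assoc, h₂]

variable {L' l} (hl : ∀ A : Spectrum G, levelEquivalences G (l.app A))
  (hL' : ∀ A : Spectrum G, (L'.obj A).IsLevelFibrant)

include hl in
lemma levelEquivalences_replacement_map {A B : Spectrum G} (f : A ⟶ B)
    (hf : levelEquivalences G f) : levelEquivalences G (L'.map f) :=
  (levelEquivalences G).of_precomp (l.app A) (L'.map f) (hl A)
    ((l.naturality f : f ≫ l.app B = l.app A ≫ L'.map f) ▸
      (levelEquivalences G).comp_mem _ _ hf (hl B))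

include hG hC hl hL' in
lemma levelEquivalences_Rinfty_map_replacement_map {A B : Spectrum G} (f : A ⟶ B)
    (hf : levelEquivalences G f) : levelEquivalences G ((Rinfty adj).map (L'.map f)) :=
  levelEquivalences_Rinfty_map adj hG hC _ (hL' A) (hL' B)
    (levelEquivalences_replacement_map hl f hf)

lemma levelEquivalences_of_isIso {X Y : Spectrum G} (f : X ⟶ Y) [IsIso f] :
    levelEquivalences G f := fun n =>
  (inferInstance : WeakEquivalence ((ev G n).map f)).1

variable [PreservesColimitsOfShape ℕ U]

include hG hC hl hL' in
lemma levelEquivalences_map_stableUnit (A : Spectrum G) :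
    levelEquivalences G ((L' ⋙ Rinfty adj).map ((stableUnit adj L' l).app A)) := by
  have h₁ := levelEquivalences_Rinfty_map_replacement_map adj hG hC hl hL' (l.app A) (hl A)
  let j := rinftyUnit adj (L'.obj A)
  have hj := isIso_Rinfty_map_rinftyUnit adj (L'.obj A)
  -- R^∞ is known to preserve level equivalences only between level fibrant spectra. This square
  -- therefore compares `L'.map j` with `j`, which R^∞ inverts, through maps between level fibrant
  -- spectra.
  have nat : j ≫ l.app ((Rinfty adj).obj (L'.obj A)) = l.app (L'.obj A) ≫ L'.map j :=
    l.naturality j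
  have hfib := isLevelFibrant_Rinfty_obj adj hG hC (hL' A)
  have h₂ : levelEquivalences G ((Rinfty adj).map (L'.map j)) := by
    refine (levelEquivalences G).of_precomp ((Rinfty adj).map (l.app (L'.obj A))) _
      (levelEquivalences_Rinfty_map adj hG hC _ (hL' A) (hL' (L'.obj A)) (hl _)) ?_
    have e : (Rinfty adj).map (l.app (L'.obj A)) ≫ (Rinfty adj).map (L'.map j) =
        (Rinfty adj).map j ≫ (Rinfty adj).map (l.app ((Rinfty adj).obj (L'.obj A))) :=
      ((Rinfty adj).map_comp _ _).symm.trans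
        ((congrArg (Rinfty adj).map nat.symm).trans ((Rinfty adj).map_comp _ _))
    rw [e]
    exact (levelEquivalences G).comp_mem _ _ (levelEquivalences_of_isIso _)
      (levelEquivalences_Rinfty_map adj hG hC _ hfib (hL' _) (hl _))
  have h₃ : (L' ⋙ Rinfty adj).map ((stableUnit adj L' l).app A) =
      (Rinfty adj).map (L'.map (l.app A)) ≫ (Rinfty adj).map (L'.map j) :=
    (congrArg (Rinfty adj).map (L'.map_comp (l.app A) j)).trans ((Rinfty adj).map_comp _ _)
  rw [h₃]
  exact (levelEquivalences G).comp_mem _ _ h₁ h₂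

include hG hC hl hL' in
/-- The stable equivalences are the maps inverted by `R^∞ L'`. -/
theorem isStableEquivalence_iff {A B : Spectrum G} (f : A ⟶ B) :
    IsStableEquivalence adj f ↔ levelEquivalences G ((Rinfty adj).map (L'.map f)) := by
  have : PreservesColimitsOfSize.{0, 0} G := adj.leftAdjoint_preservesColimits
  have : PreservesColimitsOfSize.{v, v} G := adj.leftAdjoint_preservesColimits
  let := projectiveModelCategory (G := G) hG.map_trivialCofibration
  have : HasColimits (Spectrum G) := ⟨fun _ => inferInstance⟩
  have h : IsLocalization (L' ⋙ Rinfty adj) (stableUnit adj L' l) (IsUSpectrum adj) :=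
    { isFibrant := fun W hW => (isFibrant_iff_isLevelFibrant W).2 hW.1
      weakEquivalence_unit := fun W hW => ⟨(levelEquivalences G).comp_mem _ _ (hl W)
        (levelEquivalences_rinftyUnit adj hG hC
          (hW.of_levelEquivalences adj hG _ (hl W) (hL' W)))⟩
      obj_mem := fun W => isUSpectrum_Rinfty_obj adj hG hC (hL' W)
      weakEquivalence_map := fun A B f hf =>
        ⟨levelEquivalences_Rinfty_map_replacement_map adj hG hC hl hL' f hf.1⟩
      weakEquivalence_map_unit := fun A =>
        ⟨levelEquivalences_map_stableUnit adj hG hC hl hL' A⟩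
      of_weakEquivalence := fun W W' f hf hW' hW =>
        hW.of_levelEquivalences adj hG f hf.1 ((isFibrant_iff_isLevelFibrant W').1 hW')
      of_iso := ⟨fun {W W'} e hW => by
        have : IsFibrant W := (isFibrant_iff_isLevelFibrant W).2 hW.1
        have : IsFibrant W' := isFibrant_of_fibration e.inv
        exact hW.of_levelEquivalences adj hG e.hom (levelEquivalences_of_isIso _)
          ((isFibrant_iff_isLevelFibrant W').1 this)⟩
      terminal_mem := isUSpectrum_terminal adj
      pullback_mem := fun P₁ P₂ P₃ p q hp hq h₁ h₂ h₃ =>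
        isUSpectrum_pullback adj hG p q hp.1 hq.1 h₁ h₂ h₃ }
  exact (h.isMapEquivalence_iff f).trans (weakEquivalence_iff _)

end

end Spectrum

end Hovey

theorem mainTheorem7 {C : Type u} [Category.{v} C] [ModelCategory C] [HasLimits C] [HasColimits C]
    (hC : Hovey.IsAlmostFinitelyGenerated C)
    (hprod : PreservesFiniteProducts (colim : (ℕ ⥤ C) ⥤ C))
    (G U : C ⥤ C) (adj : G ⊣ U) (hG : Hovey.IsLeftQuillen G)
    (hU : PreservesColimitsOfShape ℕ U)
    (L' : Hovey.Spectrum G ⥤ Hovey.Spectrum G) (l : 𝟭 (Hovey.Spectrum G) ⟶ L')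
    (hl : ∀ A : Hovey.Spectrum G, Hovey.Spectrum.levelEquivalences G (l.app A))
    (hL' : ∀ A : Hovey.Spectrum G, (L'.obj A).IsLevelFibrant) :
    (∀ A : Hovey.Spectrum G,
      Hovey.Spectrum.IsStableEquivalence adj
        (l.app A ≫ (Hovey.Spectrum.jinfty adj).app (L'.obj A)) ∧
      Hovey.Spectrum.IsUSpectrum adj ((Hovey.Spectrum.Rinfty adj).obj (L'.obj A))) ∧
    (∀ (A B : Hovey.Spectrum G) (f : A ⟶ B),
      Hovey.Spectrum.IsStableEquivalence adj f ↔
        Hovey.Spectrum.levelEquivalences G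
          ((Hovey.Spectrum.Rinfty adj).map (L'.map f))) := by
  refine ⟨fun A => ⟨?_, ?_⟩, fun A B f => ?_⟩
  · rw [Hovey.Spectrum.isStableEquivalence_iff adj hG hC hl hL']
    exact Hovey.Spectrum.levelEquivalences_map_stableUnit adj hG hC hl hL' A
  · exact Hovey.Spectrum.isUSpectrum_Rinfty_obj adj hG hC (hL' A)
  · exact Hovey.Spectrum.isStableEquivalence_iff adj hG hC hl hL' f
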